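/- We work over $\mathbb{C}$. Let $L\subset\mathbf{P}^2$ be a line, let $\pi=[\ell_1,\dots,\ell_n]$ be a sequence of nonnegative integers, and let $d=\sum_{i=1}^n i\,\ell_i$. A divisor on $L\cong\mathbf{P}^1$ is said to be of type $\pi$ if it has the form $\sum_{i=1}^n\sum_{j=1}^{\ell_i} i\,P_{ij}$ for pairwise distinct points $P_{ij}\in L$. Let $\mathcal{P}(d)=\mathbf{P}^{\binom{d+2}{2}-1}$ be the projective space of plane curves of degree $d$, and let $\mathcal{S}(\pi)\subset\mathcal{P}(d)$ be the set of all smooth curves $C$ of degree $d$ that do not contain $L$ and whose intersection divisor $C\cap L$ (counted with multiplicities) is of type $\pi$. Then $\mathcal{S}(\pi)$ is locally closed in $\mathcal{P}(d)$ in the Zariski topology, and its Zariski closure has degree $$\deg\overline{\mathcal{S}(\pi)}=n(\pi)\,m(\pi),\qquad\text{where } n(\pi)=\frac{(\ell_1+\dots+\ell_n)!}{\ell_1!\cdots\ell_n!},\quad m(\pi)=\prod_{i=1}^n i^{\ell_i}.$$ Here the degree of a closed subset $X$ of a projective space is $r!$ times the leading coefficient of its Hilbert polynomial, where $r=\dim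 X$ is the degree of that polynomial. -/

import Mathlib

open Filter
open scoped LinearAlgebra.Projectivization

noncomputable section

namespace TangencyLocus

/-! ### Closed subsets of projective space: Zariski topology, Hilbert polynomial, degree

The projective space with homogeneous coordinates indexed by `ι` is `ℙ ℂ (ι → ℂ)`. Whether a
homogeneous polynomial vanishes at a point does not depend on the representative, so it is
expressed through the representative `x.rep`. -/

/-- The Zariski topology on projective space: the sets `{F ≠ 0}`, for `F` homogeneous, are a
basis of open sets. -/
abbrev zariskiTopology (ι : Type) : TopologicalSpace (ℙ ℂ (ι → ℂ)) :=
  TopologicalSpace.generateFrom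
    {U | ∃ (t : ℕ) (F : MvPolynomial ι ℂ), F.IsHomogeneous t ∧
      U = {x | MvPolynomial.eval x.rep F ≠ 0}}

/-- The Zariski closure of a set of points of projective space. -/
def zariskiClosure {ι : Type} (X : Set (ℙ ℂ (ι → ℂ))) : Set (ℙ ℂ (ι → ℂ)) :=
  @closure _ (zariskiTopology ι) X

/-- `X` is locally closed in the Zariski topology. -/
def IsZariskiLocallyClosed {ι : Type} (X : Set (ℙ ℂ (ι → ℂ))) : Prop :=
  @IsLocallyClosed _ (zariskiTopology ι) X

/-- The degree `t` part `I(X)_t` of the homogeneous ideal of `X`, inside the space of all forms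
of degree `t`. -/
def vanishingForms {ι : Type} (X : Set (ℙ ℂ (ι → ℂ))) (t : ℕ) :
    Submodule ℂ (MvPolynomial.homogeneousSubmodule ι ℂ t) where
  carrier := {F | ∀ x ∈ X, MvPolynomial.eval x.rep (F : MvPolynomial ι ℂ) = 0}
  zero_mem' := by
    intro x _
    simp
  add_mem' := by
    intro F G hF hG x hx
    simp [hF x hx, hG x hx]
  smul_mem' := by
    intro c F hF x hx
    simp [MvPolynomial.smul_eval, hF x hx]

/-- The Hilbert function of `X`: the dimension of the degree `t` part of the homogeneous
coordinate ring of `X`. -/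
def hilbertFunction {ι : Type} (X : Set (ℙ ℂ (ι → ℂ))) (t : ℕ) : ℕ :=
  Module.finrank ℂ (MvPolynomial.homogeneousSubmodule ι ℂ t ⧸ vanishingForms X t)

/-- `P` is the Hilbert polynomial of `X`. -/
def IsHilbertPolynomial {ι : Type} (X : Set (ℙ ℂ (ι → ℂ))) (P : Polynomial ℚ) : Prop :=
  ∀ᶠ t : ℕ in atTop, (hilbertFunction X t : ℚ) = P.eval (t : ℚ)

/-- The closed subset `X` of projective space has degree `e`: it has a Hilbert polynomial
(necessarily unique), and `e` is `r !` times its leading coefficient, where `r = dim X` is the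
degree of the Hilbert polynomial. -/
def HasDegree {ι : Type} (X : Set (ℙ ℂ (ι → ℂ))) (e : ℕ) : Prop :=
  ∃ P : Polynomial ℚ, IsHilbertPolynomial X P ∧
    (P.natDegree.factorial : ℚ) * P.leadingCoeff = e

/-! ### Plane curves of degree `d` -/

/-- The exponents of the monomials of degree `d` in three variables. -/
abbrev Exponent (d : ℕ) : Type :=
  {m : Fin 3 →₀ ℕ // m ∈ Finset.finsuppAntidiag (Finset.univ : Finset (Fin 3)) d}

/-- The linear system of plane curves of degree `d`: the projective space whose homogeneous
coordinates are the coefficients of a ternary form of degree `d`. -/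
abbrev CurveSpace (d : ℕ) : Type := ℙ ℂ (Exponent d → ℂ)

/-- The ternary form with the given coefficients. -/
def form {d : ℕ} (a : Exponent d → ℂ) : MvPolynomial (Fin 3) ℂ :=
  ∑ m : Exponent d, MvPolynomial.monomial (m : Fin 3 →₀ ℕ) (a m)

/-- An equation of a curve (well defined up to a nonzero factor). -/
def CurveSpace.equation {d : ℕ} (C : CurveSpace d) : MvPolynomial (Fin 3) ℂ :=
  form C.rep

/-- The plane curve `f = 0` is smooth (Jacobian criterion): at every point of the curve some
partial derivative of `f` does not vanish. -/
def IsSmoothCurve (f : MvPolynomial (Fin 3) ℂ) : Prop :=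
  ∀ p : Fin 3 → ℂ, p ≠ 0 → MvPolynomial.eval p f = 0 →
    ∃ i : Fin 3, MvPolynomial.eval p (MvPolynomial.pderiv i f) ≠ 0

/-! ### The divisor cut out on a line

A line in the projective plane is a two-dimensional subspace `L` of `ℂ³`; its points are
`ℙ ℂ L`. An effective divisor on it is a finitely supported function `ℙ ℂ L →₀ ℕ`. -/

/-- The one-variable polynomial `f (p + T q)`. -/
def restrictTo (f : MvPolynomial (Fin 3) ℂ) (p q : Fin 3 → ℂ) : Polynomial ℂ :=
  MvPolynomial.aeval (fun i => Polynomial.C (p i) + Polynomial.X * Polynomial.C (q i)) f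

/-- `D` is the intersection divisor of the curve `f = 0` with the line `L`: the curve does not
contain `L`, and the multiplicity of `D` at each point `[p]` of `L` is the order of vanishing of
`f` restricted to `L` at `[p]`. This order is computed in the affine coordinate `T` centred at
`[p]` for which the point with coordinate `T` is `[p + T q]`; here `q` is any vector of `L` not
proportional to `p`. -/
def IsIntersectionDivisor (f : MvPolynomial (Fin 3) ℂ) (L : Submodule ℂ (Fin 3 → ℂ))
    (D : ℙ ℂ L →₀ ℕ) : Prop :=
  (∃ x ∈ L, MvPolynomial.eval x f ≠ 0) ∧
    ∀ (p q : L) (hp : p ≠ 0), q ∉ Submodule.span ℂ {p} →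
      D (Projectivization.mk ℂ p hp) = (restrictTo f p q).rootMultiplicity 0

/-! ### Partitions

A partition `[ℓ₁, …, ℓₙ]` is a sequence of nonnegative integers, given as `ℓ : Fin n → ℕ`; the
entry `ℓᵢ` is the value of `ℓ` at the index `i - 1`. -/

/-- The divisor `D` is of type `[ℓ₁, …, ℓₙ]`: it is `∑ᵢ ∑_{j ≤ ℓᵢ} i • Pᵢⱼ` for some distinct
points `Pᵢⱼ`. -/
def IsOfType {A : Type} {n : ℕ} (ℓ : Fin n → ℕ) (D : A →₀ ℕ) : Prop :=
  ∃ P : (Σ i : Fin n, Fin (ℓ i)) → A, Function.Injective P ∧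
    D = ∑ k : (Σ i : Fin n, Fin (ℓ i)), Finsupp.single (P k) ((k.1 : ℕ) + 1)

/-- `∑ i ℓᵢ`, the degree of a divisor of type `ℓ`. -/
def weight {n : ℕ} (ℓ : Fin n → ℕ) : ℕ := ∑ i : Fin n, ((i : ℕ) + 1) * ℓ i

/-- `m = ∏ i ^ ℓᵢ`. -/
def mNumber {n : ℕ} (ℓ : Fin n → ℕ) : ℕ := ∏ i : Fin n, ((i : ℕ) + 1) ^ ℓ i

/-- `n = (∑ ℓᵢ)! / (ℓ₁! ⋯ ℓₙ!)`, an exact division: the multinomial coefficient. -/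
def nNumber {n : ℕ} (ℓ : Fin n → ℕ) : ℕ :=
  (∑ i : Fin n, ℓ i).factorial / ∏ i : Fin n, (ℓ i).factorial

/-- The set of all smooth plane curves of degree `d` whose intersection with the line `L` is a
divisor of type `ℓ`. -/
def smoothLocus (d : ℕ) (L : Submodule ℂ (Fin 3 → ℂ)) {n : ℕ} (ℓ : Fin n → ℕ) :
    Set (CurveSpace d) :=
  {C | IsSmoothCurve C.equation ∧
    ∃ D : ℙ ℂ L →₀ ℕ, IsIntersectionDivisor C.equation L D ∧ IsOfType ℓ D}

end TangencyLocus

end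

/-!
The degree is computed by parametrizing the closure of the locus and comparing Hilbert functions.

Choose coordinates `u, v, w` of the plane such that the line is `w = 0`. A form `F` of degree `d`
restricts to a divisor of type `ℓ` when `F(u, v, 0) = ∏ fᵢ ^ i` up to a factor, for squarefree and
pairwise coprime binary forms `fᵢ` of degree `ℓᵢ` (`exists_divisor_iff_exists_linearProduct`).
Elimination theory (`isClosed_setOf_exists_zero`, from a multigraded Nullstellensatz) shows that the
restrictions of the form `∏ fᵢ ^ i`, for arbitrary nonzero `fᵢ`, are a closed condition, and that
smoothness, not containing the line, and the absence of collisions between the roots are open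
conditions inside it. This gives local closedness (`smoothLocus_eq_inter`).

The forms of the closed condition are the values of `θ ∏ fᵢ ^ i + ∑ z_m u ^ m₀ v ^ m₁ w ^ m₂`, with
`m₂ ≠ 0`, whose parameters are the coefficients of the `fᵢ`, the scalar `θ` and the `z_m`. The
smooth curves form a nonempty open subset (`smoothLocus_nonempty`), so that a form in the
coefficients vanishes on them if and only if it vanishes identically in the parameters
(`forall_eval_eq_zero_iff`). Hence the homogeneous coordinate ring of the closure is that of a cone
over the image `Y` of the map `(fᵢ)ᵢ ↦ ∏ fᵢ ^ i` from a product of projective spaces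
`ℙ ^ ℓ₁ × ⋯ × ℙ ^ ℓₙ` (`span_range_genericParametrization`), and passing to a cone does not change
the degree (`exists_polynomial_sum_multichoose`).

The map to `Y` is finite, since the product vanishes only if some factor does
(`exists_multiForms_le_mul`), and birational, since the `fᵢ` can be recovered rationally from the
product by separating the roots of different multiplicities (`div_mem_imageFunctionField`).
Therefore the Hilbert function of `Y` is squeezed between two shifts of
`s ↦ dim H⁰(∏ ℙ ^ ℓᵢ, O(s, 2s, …, ns)) = ∏ binom(ℓᵢ + i s, ℓᵢ)` (`exists_finrank_multiForms_le`),
and so has the same degree as this polynomial, namely `(∑ ℓᵢ)! / ∏ ℓᵢ! * ∏ i ^ ℓᵢ`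
(`exists_polynomial_prod_multichoose`). That the Hilbert function is eventually a polynomial at all
is the theorem of Hilbert and Serre (`exists_isHilbertPolynomial`).
-/

noncomputable section

namespace TangencyLocus

/-! ### Existence of Hilbert polynomials -/

/-- Every polynomial is the forward difference of a polynomial: for powers of the variable,
these are the Bernoulli polynomials. -/
theorem exists_eval_add_one_sub (P : Polynomial ℚ) :
    ∃ S : Polynomial ℚ, ∀ x : ℚ, S.eval (x + 1) - S.eval x = P.eval x := by
  induction P using Polynomial.induction_on' with
  | add p q hp hq =>
    obtain ⟨S, hS⟩ := hp
    obtain ⟨T, hT⟩ := hq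
    refine ⟨S + T, fun x => ?_⟩
    rw [Polynomial.eval_add, Polynomial.eval_add, Polynomial.eval_add, ← hS, ← hT]
    ring
  | monomial n c =>
    refine ⟨Polynomial.C (c / (n + 1)) * Polynomial.bernoulli (n + 1), fun x => ?_⟩
    have h := Polynomial.bernoulli_eval_one_add (n + 1) x
    have hn : (n : ℚ) + 1 ≠ 0 := by positivity
    simp only [add_comm x 1, Polynomial.eval_mul, h, Polynomial.eval_C, Polynomial.eval_monomial,
      Nat.add_sub_cancel, Nat.cast_add, Nat.cast_one]
    field_simp
    ring

theorem eventually_eq_eval_of_difference {f : ℕ → ℚ} {P : Polynomial ℚ}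
    (h : ∀ᶠ t : ℕ in atTop, f (t + 1) - f t = P.eval (t : ℚ)) :
    ∃ Q : Polynomial ℚ, ∀ᶠ t : ℕ in atTop, f t = Q.eval (t : ℚ) := by
  obtain ⟨S, hS⟩ := exists_eval_add_one_sub P
  obtain ⟨N, hN⟩ := eventually_atTop.1 h
  refine ⟨S + Polynomial.C (f N - S.eval (N : ℚ)), eventually_atTop.2 ⟨N, fun t ht => ?_⟩⟩
  induction t, ht using Nat.le_induction with
  | base => simp
  | succ t ht ih =>
    have h1 := hN t ht
    have h2 := hS t
    simp only [Polynomial.eval_add, Polynomial.eval_C] at ih ⊢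
    push_cast
    linarith

section HilbertSerre

open MvPolynomial

variable {ι : Type}

/-- An ideal of a polynomial ring is homogeneous if it contains the homogeneous components of its
elements. -/
def HomogeneousIdealProp (I : Ideal (MvPolynomial ι ℂ)) : Prop :=
  ∀ f ∈ I, ∀ t, homogeneousComponent t f ∈ I

/-- The forms of degree `t` in the ideal `I`. -/
def gradedPart (I : Ideal (MvPolynomial ι ℂ)) (t : ℕ) : Submodule ℂ (MvPolynomial ι ℂ) :=
  I.restrictScalars ℂ ⊓ homogeneousSubmodule ι ℂ t

theorem mem_gradedPart {I : Ideal (MvPolynomial ι ℂ)} {t : ℕ} {f : MvPolynomial ι ℂ} :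
    f ∈ gradedPart I t ↔ f ∈ I ∧ f.IsHomogeneous t := Iff.rfl

instance [Finite ι] (t : ℕ) : FiniteDimensional ℂ (homogeneousSubmodule ι ℂ t) :=
  Module.Finite.iff_fg.2 (homogeneousSubmodule_fg ι ℂ t)

instance [Finite ι] (I : Ideal (MvPolynomial ι ℂ)) (t : ℕ) :
    FiniteDimensional ℂ (gradedPart I t) :=
  Submodule.finiteDimensional_of_le (inf_le_right : gradedPart I t ≤ homogeneousSubmodule ι ℂ t)

theorem homogeneousComponent_X_mul (i : ι) (g : MvPolynomial ι ℂ) (t : ℕ) :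
    homogeneousComponent (t + 1) (X i * g) = X i * homogeneousComponent t g := by
  classical
  induction g using MvPolynomial.induction_on' with
  | monomial m c =>
    have h1 : monomial m c ∈ homogeneousSubmodule ι ℂ m.degree := isHomogeneous_monomial c rfl
    have h2 : X i * monomial m c ∈ homogeneousSubmodule ι ℂ (1 + m.degree) :=
      (isHomogeneous_X ℂ i).mul h1
    rw [homogeneousComponent_of_mem h1, homogeneousComponent_of_mem h2]
    by_cases h : t = m.degree
    · simp [h, add_comm]
    · rw [if_neg h, if_neg (by omega), mul_zero]
  | add p q hp hq => rw [mul_add, map_add, hp, hq, map_add, mul_add]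

theorem homogeneousComponent_zero_X_mul (i : ι) (g : MvPolynomial ι ℂ) :
    homogeneousComponent 0 (X i * g) = 0 := by
  rw [homogeneousComponent_zero, ← constantCoeff_eq, map_mul, constantCoeff_X, zero_mul, C_0]

theorem HomogeneousIdealProp.sup_X_mul {I J : Ideal (MvPolynomial ι ℂ)}
    (hI : HomogeneousIdealProp I) (hJ : HomogeneousIdealProp J) (i : ι) :
    HomogeneousIdealProp (J ⊔ Ideal.span {X i} * I) := by
  intro f hf t
  obtain ⟨j, hj, y, hy, rfl⟩ := Submodule.mem_sup.1 hf
  obtain ⟨g, hg, rfl⟩ := Ideal.mem_span_singleton_mul.1 hy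
  rw [map_add]
  refine Submodule.add_mem_sup (hJ j hj t) ?_
  cases t with
  | zero => rw [homogeneousComponent_zero_X_mul]; exact Submodule.zero_mem _
  | succ t =>
    rw [homogeneousComponent_X_mul]
    exact Ideal.mem_span_singleton_mul.2 ⟨_, hI g hg t, rfl⟩

/-- The elements of `I` that multiplication by the variable `X i` sends into `J`. -/
def colonX (I J : Ideal (MvPolynomial ι ℂ)) (i : ι) : Ideal (MvPolynomial ι ℂ) where
  carrier := {f | f ∈ I ∧ X i * f ∈ J}
  zero_mem' := by simp
  add_mem' := by
    rintro f g ⟨hf, hf'⟩ ⟨hg, hg'⟩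
    exact ⟨add_mem hf hg, by rw [mul_add]; exact add_mem hf' hg'⟩
  smul_mem' := by
    rintro c f ⟨hf, hf'⟩
    refine ⟨I.mul_mem_left c hf, ?_⟩
    rw [smul_eq_mul, mul_left_comm]
    exact J.mul_mem_left c hf'

theorem HomogeneousIdealProp.colonX {I J : Ideal (MvPolynomial ι ℂ)}
    (hI : HomogeneousIdealProp I) (hJ : HomogeneousIdealProp J) (i : ι) :
    HomogeneousIdealProp (colonX I J i) := by
  rintro f ⟨hf, hf'⟩ t
  refine ⟨hI f hf t, ?_⟩
  rw [← homogeneousComponent_X_mul]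
  exact hJ _ hf' _

/-- Multiplication by `X i` maps `I_t` onto `(X i • I)_{t+1}` and `(J : X i)_t` onto
`J_{t+1} ∩ X i • I_t`; compare dimensions. -/
theorem finrank_gradedPart_sup_X_mul [Finite ι] {I J : Ideal (MvPolynomial ι ℂ)}
    (hI : HomogeneousIdealProp I) (hJ : HomogeneousIdealProp J) (i : ι) (t : ℕ) :
    Module.finrank ℂ (gradedPart (J ⊔ Ideal.span {X i} * I) (t + 1)) +
        Module.finrank ℂ (gradedPart (colonX I J i) t) =
      Module.finrank ℂ (gradedPart J (t + 1)) + Module.finrank ℂ (gradedPart I t) := by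
  set μ : MvPolynomial ι ℂ →ₗ[ℂ] MvPolynomial ι ℂ := LinearMap.mulLeft ℂ (X i) with hμ
  have hinj : Function.Injective μ := fun a b hab => mul_left_cancel₀ (X_ne_zero i) hab
  have hX : ∀ f : MvPolynomial ι ℂ, f.IsHomogeneous t → (X i * f).IsHomogeneous (t + 1) := by
    intro f hf
    rw [add_comm]
    exact (isHomogeneous_X ℂ i).mul hf
  have h1 : gradedPart (J ⊔ Ideal.span {X i} * I) (t + 1) =
      gradedPart J (t + 1) ⊔ (gradedPart I t).map μ := by
    apply le_antisymm
    · rintro f ⟨hf, hft⟩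
      obtain ⟨j, hj, y, hy, rfl⟩ := Submodule.mem_sup.1 hf
      obtain ⟨g, hg, rfl⟩ := Ideal.mem_span_singleton_mul.1 hy
      have h : j + X i * g =
          homogeneousComponent (t + 1) j + X i * homogeneousComponent t g := by
        rw [← homogeneousComponent_X_mul, ← map_add]
        exact (homogeneousComponent_eq_self hft).symm
      rw [h]
      refine Submodule.add_mem_sup ⟨hJ j hj _, homogeneousComponent_isHomogeneous _ _⟩ ?_
      exact ⟨_, ⟨hI g hg t, homogeneousComponent_isHomogeneous _ _⟩, rfl⟩
    · refine sup_le ?_ ?_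
      · rintro f ⟨hf, hft⟩
        exact ⟨Ideal.mem_sup_left hf, hft⟩
      · rintro _ ⟨f, ⟨hf, hft⟩, rfl⟩
        exact ⟨Ideal.mem_sup_right (Ideal.mem_span_singleton_mul.2 ⟨f, hf, rfl⟩), hX f hft⟩
  have h2 : gradedPart J (t + 1) ⊓ (gradedPart I t).map μ = (gradedPart (colonX I J i) t).map μ := by
    apply le_antisymm
    · rintro _ ⟨⟨hf, hft⟩, g, ⟨hg, hgt⟩, rfl⟩
      exact ⟨g, ⟨⟨hg, hf⟩, hgt⟩, rfl⟩
    · rintro _ ⟨g, ⟨⟨hg, hf⟩, hgt⟩, rfl⟩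
      exact ⟨⟨hf, hX g hgt⟩, g, ⟨hg, hgt⟩, rfl⟩
  have h3 := Submodule.finrank_sup_add_finrank_inf_eq (gradedPart J (t + 1))
    ((gradedPart I t).map μ)
  rw [h2, ← h1, (Submodule.equivMapOfInjective μ hinj _).finrank_eq.symm,
    (Submodule.equivMapOfInjective μ hinj _).finrank_eq.symm] at h3
  exact h3

/-- If multiplication by every variable sends `I` into `J`, then `I` and `J` agree in degrees
above those of the generators of `I`. -/
theorem eventually_gradedPart_le [Finite ι] {I J : Ideal (MvPolynomial ι ℂ)}
    (hJ : HomogeneousIdealProp J) (h : ∀ i, ∀ f ∈ I, X i * f ∈ J) :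
    ∀ᶠ t : ℕ in atTop, gradedPart I t ≤ gradedPart J t := by
  obtain ⟨S, rfl⟩ := (isNoetherian_def.1 (inferInstance : IsNoetherianRing (MvPolynomial ι ℂ))) I
  filter_upwards [eventually_gt_atTop (S.sup totalDegree)] with t ht
  have key : ∀ f ∈ Ideal.span (S : Set (MvPolynomial ι ℂ)), homogeneousComponent t f ∈ J := by
    intro f hf
    induction hf using Submodule.span_induction with
    | mem x hx =>
      rw [homogeneousComponent_eq_zero _ _ ((Finset.le_sup (f := totalDegree) hx).trans_lt ht)]
      exact J.zero_mem
    | zero => simp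
    | add x y _ _ hx hy => rw [map_add]; exact add_mem hx hy
    | smul r x hxI hx =>
      rw [smul_eq_mul]
      induction r using MvPolynomial.induction_on with
      | C a => rw [homogeneousComponent_C_mul]; exact J.mul_mem_left _ hx
      | add p q hp hq => rw [add_mul, map_add]; exact add_mem hp hq
      | mul_X p i _ =>
        rw [mul_assoc]
        exact hJ _ (J.mul_mem_left p (h i x hxI)) t
  rintro f ⟨hf, hft⟩
  have := key f hf
  rw [homogeneousComponent_eq_self hft] at this
  exact ⟨this, hft⟩

/-- **Hilbert–Serre** for a subquotient `I / J` of the polynomial ring that is annihilated by all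
variables outside `T`. -/
theorem exists_hilbertPolynomial_subquotient [Finite ι] (T : Finset ι) :
    ∀ I J : Ideal (MvPolynomial ι ℂ), HomogeneousIdealProp I → HomogeneousIdealProp J → J ≤ I →
      (∀ i ∉ T, ∀ f ∈ I, X i * f ∈ J) →
      ∃ P : Polynomial ℚ, ∀ᶠ t : ℕ in atTop, (Module.finrank ℂ (gradedPart I t) : ℚ) -
        Module.finrank ℂ (gradedPart J t) = P.eval (t : ℚ) := by
  classical
  induction T using Finset.induction_on with
  | empty =>
    intro I J hI hJ hJI h
    refine ⟨0, ?_⟩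
    filter_upwards [eventually_gradedPart_le hJ fun i => h i (by simp)] with t ht
    have : gradedPart I t = gradedPart J t :=
      le_antisymm ht fun f hf => ⟨hJI hf.1, hf.2⟩
    rw [this, sub_self, Polynomial.eval_zero]
  | insert i T hi ih =>
    intro I J hI hJ hJI h
    obtain ⟨P₁, hP₁⟩ := ih I (J ⊔ Ideal.span {X i} * I) hI (hI.sup_X_mul hJ i)
      (sup_le hJI Ideal.mul_le_right) (by
        intro k hk f hf
        by_cases hki : k = i
        · subst hki
          exact Ideal.mem_sup_right (Ideal.mem_span_singleton_mul.2 ⟨f, hf, rfl⟩)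
        · exact Ideal.mem_sup_left (h k (by simp [hki, hk]) f hf))
    obtain ⟨P₂, hP₂⟩ := ih (colonX I J i) J (hI.colonX hJ i) hJ
      (fun f hf => ⟨hJI hf, J.mul_mem_left _ hf⟩) (by
        intro k hk f hf
        by_cases hki : k = i
        · subst hki
          exact hf.2
        · exact h k (by simp [hki, hk]) f hf.1)
    refine eventually_eq_eval_of_difference
      (P := P₁.comp (Polynomial.X + 1) - P₂) ?_
    filter_upwards [hP₁, (tendsto_add_atTop_nat 1).eventually hP₁, hP₂] with t _ h1 h2
    have h3 := finrank_gradedPart_sup_X_mul hI hJ i t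
    have h4 : (Module.finrank ℂ (gradedPart (J ⊔ Ideal.span {X i} * I) (t + 1)) : ℚ) +
        Module.finrank ℂ (gradedPart (colonX I J i) t) =
      Module.finrank ℂ (gradedPart J (t + 1)) + Module.finrank ℂ (gradedPart I t) := by
      exact_mod_cast h3
    simp only [Polynomial.eval_sub, Polynomial.eval_comp, Polynomial.eval_add,
      Polynomial.eval_X, Polynomial.eval_one]
    push_cast at h1
    linarith

theorem homogeneousIdealProp_span {S : Set (MvPolynomial ι ℂ)}
    (hS : ∀ f ∈ S, ∃ t, f.IsHomogeneous t) : HomogeneousIdealProp (Ideal.span S) := by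
  classical
  intro f hf t
  induction hf using Submodule.span_induction generalizing t with
  | mem x hx =>
    obtain ⟨s, hs⟩ := hS x hx
    rw [homogeneousComponent_of_mem (m := t) hs]
    split_ifs
    · exact Ideal.subset_span hx
    · exact Ideal.zero_mem _
  | zero => simp
  | add x y _ _ hx hy => rw [map_add]; exact add_mem (hx t) (hy t)
  | smul r x _ hx =>
    rw [smul_eq_mul]
    induction r using MvPolynomial.induction_on generalizing t with
    | C a => rw [homogeneousComponent_C_mul]; exact Ideal.mul_mem_left _ _ (hx t)
    | add p q hp hq => rw [add_mul, map_add]; exact add_mem (hp t) (hq t)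
    | mul_X p i hp =>
      rw [mul_comm p, mul_assoc]
      cases t with
      | zero => rw [homogeneousComponent_zero_X_mul]; exact Submodule.zero_mem _
      | succ t => rw [homogeneousComponent_X_mul]; exact Ideal.mul_mem_left _ _ (hp t)

/-- **Hilbert–Serre** for the homogeneous coordinate ring of a set of points of projective space. -/
theorem exists_isHilbertPolynomial [Finite ι] (X : Set (ℙ ℂ (ι → ℂ))) :
    ∃ P : Polynomial ℚ, IsHilbertPolynomial X P := by
  classical
  have := Fintype.ofFinite ι
  set S : Set (MvPolynomial ι ℂ) :=
    {F | (∃ t, F.IsHomogeneous t) ∧ ∀ x ∈ X, eval x.rep F = 0} with hS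
  have hJ : HomogeneousIdealProp (Ideal.span S) := homogeneousIdealProp_span fun f hf => hf.1
  have hmem : ∀ F ∈ Ideal.span S, ∀ x ∈ X, eval x.rep F = 0 := by
    intro F hF x hx
    have : Ideal.span S ≤ RingHom.ker (eval x.rep) := Ideal.span_le.2 fun G hG => hG.2 x hx
    exact this hF
  obtain ⟨P, hP⟩ := exists_hilbertPolynomial_subquotient (Finset.univ : Finset ι) ⊤ (Ideal.span S)
    (fun _ _ _ => Submodule.mem_top) hJ le_top (by simp)
  refine ⟨P, ?_⟩
  unfold IsHilbertPolynomial
  filter_upwards [hP] with t ht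
  rw [← ht]
  have h1 : gradedPart (⊤ : Ideal (MvPolynomial ι ℂ)) t = homogeneousSubmodule ι ℂ t := by
    ext f
    simp [mem_gradedPart]
  have h2 : (vanishingForms X t).map (homogeneousSubmodule ι ℂ t).subtype =
      gradedPart (Ideal.span S) t := by
    ext f
    constructor
    · rintro ⟨⟨f, hf⟩, hfX, rfl⟩
      exact ⟨Ideal.subset_span ⟨⟨t, hf⟩, hfX⟩, hf⟩
    · rintro ⟨hf, hft⟩
      exact ⟨⟨f, hft⟩, hmem f hf, rfl⟩
  have h3 : Module.finrank ℂ (gradedPart (Ideal.span S) t) =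
      Module.finrank ℂ (vanishingForms X t) := by
    rw [← h2]
    exact (Submodule.equivMapOfInjective _ (Submodule.injective_subtype _) _).finrank_eq.symm
  have h4 := Submodule.finrank_quotient_add_finrank (vanishingForms X t)
  rw [h1, h3, ← h4, hilbertFunction]
  push_cast
  ring

end HilbertSerre

/-! ### Leading coefficients of Hilbert polynomials -/

theorem coeff_nonneg_of_eventually_nonneg {A : Polynomial ℚ} {k : ℕ} (hk : A.natDegree ≤ k)
    (h : ∀ᶠ t : ℕ in atTop, 0 ≤ A.eval (t : ℚ)) : 0 ≤ A.coeff k := by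
  rcases hk.lt_or_eq with hk | rfl
  · rw [Polynomial.coeff_eq_zero_of_natDegree_lt hk]
  by_contra! hlt
  rw [Polynomial.coeff_natDegree] at hlt
  rcases Nat.eq_zero_or_pos A.natDegree with h0 | h0
  · rw [Polynomial.eq_C_of_natDegree_eq_zero h0] at h hlt
    simp only [Polynomial.eval_C, Polynomial.leadingCoeff_C] at h hlt
    obtain ⟨t, ht⟩ := h.exists
    linarith
  · have := (A.tendsto_atBot_of_leadingCoeff_nonpos
      (Polynomial.natDegree_pos_iff_degree_pos.1 h0) hlt.le).comp
      (tendsto_natCast_atTop_atTop (R := ℚ))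
    obtain ⟨t, ht, ht'⟩ := (h.and (this.eventually (eventually_lt_atBot 0))).exists
    simp only [Function.comp_apply] at ht'
    linarith

theorem coeff_comp_X_add_C {P : Polynomial ℚ} {k : ℕ} (hk : P.natDegree ≤ k) (c : ℚ) :
    (P.comp (Polynomial.X + Polynomial.C c)).coeff k = P.coeff k := by
  have h1 : (P.comp (Polynomial.X + Polynomial.C c)).natDegree = P.natDegree := by
    rw [Polynomial.natDegree_comp, Polynomial.natDegree_X_add_C, mul_one]
  rcases hk.lt_or_eq with hk | rfl
  · rw [Polynomial.coeff_eq_zero_of_natDegree_lt hk,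
      Polynomial.coeff_eq_zero_of_natDegree_lt (h1 ▸ hk)]
  · have h2 := Polynomial.leadingCoeff_comp (p := P) (q := Polynomial.X + Polynomial.C c)
      (by simp)
    rw [Polynomial.leadingCoeff, h1] at h2
    rw [h2]
    simp

/-- Two polynomials that bound each other up to a shift of the variable have the same degree and
the same leading coefficient. -/
theorem natDegree_leadingCoeff_eq_of_squeeze {P Q : Polynomial ℚ} (c : ℕ)
    (h₁ : ∀ᶠ t : ℕ in atTop, P.eval (t : ℚ) ≤ Q.eval (t : ℚ))
    (h₂ : ∀ᶠ t : ℕ in atTop, Q.eval (t : ℚ) ≤ P.eval ((t + c : ℕ) : ℚ)) :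
    P.natDegree = Q.natDegree ∧ P.leadingCoeff = Q.leadingCoeff := by
  set k := max P.natDegree Q.natDegree with hk
  have hP : P.natDegree ≤ k := le_max_left _ _
  have hQ : Q.natDegree ≤ k := le_max_right _ _
  have hdeg : (P.comp (Polynomial.X + Polynomial.C (c : ℚ))).natDegree = P.natDegree := by
    rw [Polynomial.natDegree_comp, Polynomial.natDegree_X_add_C, mul_one]
  have e1 : 0 ≤ (Q - P).coeff k := by
    refine coeff_nonneg_of_eventually_nonneg
      ((Polynomial.natDegree_sub_le _ _).trans (max_le hQ hP)) ?_
    filter_upwards [h₁] with t ht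
    rw [Polynomial.eval_sub]
    linarith
  have e2 : 0 ≤ (P.comp (Polynomial.X + Polynomial.C (c : ℚ)) - Q).coeff k := by
    refine coeff_nonneg_of_eventually_nonneg
      ((Polynomial.natDegree_sub_le _ _).trans (max_le (hdeg.le.trans hP) hQ)) ?_
    filter_upwards [h₂] with t ht
    push_cast at ht
    simp only [Polynomial.eval_sub, Polynomial.eval_comp, Polynomial.eval_add, Polynomial.eval_X,
      Polynomial.eval_C]
    linarith
  rw [Polynomial.coeff_sub] at e1 e2
  rw [coeff_comp_X_add_C hP] at e2
  have e : P.coeff k = Q.coeff k := by linarith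
  have key : P.natDegree = Q.natDegree := by
    rcases lt_trichotomy P.natDegree Q.natDegree with h | h | h
    · rw [max_eq_right h.le] at hk
      rw [Polynomial.coeff_eq_zero_of_natDegree_lt (hk ▸ h), hk, Polynomial.coeff_natDegree] at e
      rw [Polynomial.leadingCoeff_eq_zero.1 e.symm] at h
      simp at h
    · exact h
    · rw [max_eq_left h.le] at hk
      rw [Polynomial.coeff_eq_zero_of_natDegree_lt (p := Q) (hk ▸ h), hk,
        Polynomial.coeff_natDegree] at e
      rw [Polynomial.leadingCoeff_eq_zero.1 e] at h
      simp at h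
  refine ⟨key, ?_⟩
  rw [← key, max_self] at hk
  rw [Polynomial.leadingCoeff, Polynomial.leadingCoeff, ← key, ← hk, e]

theorem natDegree_leadingCoeff_of_difference {S P : Polynomial ℚ} (hP : P ≠ 0)
    (h : ∀ x : ℚ, S.eval (x + 1) - S.eval x = P.eval x) :
    S.natDegree = P.natDegree + 1 ∧ ((P.natDegree : ℚ) + 1) * S.leadingCoeff = P.leadingCoeff := by
  have hD : P = Polynomial.taylor 1 S - S := by
    refine Polynomial.funext fun x => ?_
    rw [← h x, Polynomial.eval_sub, Polynomial.taylor_eval]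
  obtain ⟨m, hm⟩ : ∃ m, S.natDegree = m + 1 := by
    refine Nat.exists_eq_succ_of_ne_zero fun h0 => hP ?_
    rw [hD, Polynomial.eq_C_of_natDegree_eq_zero h0]
    simp
  have hle : P.natDegree ≤ m := by
    rw [Polynomial.natDegree_le_iff_coeff_eq_zero]
    intro N hN
    rw [hD, Polynomial.coeff_sub]
    have h1 : (Polynomial.taylor 1 S).natDegree = m + 1 := by rw [Polynomial.natDegree_taylor, hm]
    rcases (Nat.succ_le_of_lt hN).eq_or_lt with h2 | h2
    · have h3 : (Polynomial.taylor 1 S).leadingCoeff = S.leadingCoeff :=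
        Polynomial.leadingCoeff_taylor _ _
      rw [Polynomial.leadingCoeff, Polynomial.leadingCoeff, h1, hm] at h3
      rw [← h2, Nat.succ_eq_add_one, h3, sub_self]
    · rw [Polynomial.coeff_eq_zero_of_natDegree_lt (by omega),
        Polynomial.coeff_eq_zero_of_natDegree_lt (by omega), sub_self]
  have hcoeff : P.coeff m = (m + 1) * S.leadingCoeff := by
    have h1 : (Polynomial.hasseDeriv m S).natDegree ≤ 1 := by
      have := Polynomial.natDegree_hasseDeriv_le S m
      omega
    rw [hD, Polynomial.coeff_sub, Polynomial.taylor_coeff,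
      Polynomial.eval_eq_sum_range' (Nat.lt_succ_of_le h1), Finset.sum_range_succ,
      Finset.sum_range_one, Polynomial.hasseDeriv_coeff, Polynomial.hasseDeriv_coeff,
      Polynomial.leadingCoeff, hm]
    simp [add_comm 1 m]
  have hne : P.coeff m ≠ 0 := by
    rw [hcoeff]
    refine mul_ne_zero (by positivity) (Polynomial.leadingCoeff_ne_zero.2 ?_)
    rintro rfl
    simp at hm
  have hPm : P.natDegree = m := le_antisymm hle (Polynomial.le_natDegree_of_ne_zero hne)
  refine ⟨by rw [hm, hPm], ?_⟩
  rw [← P.coeff_natDegree, hPm, hcoeff]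

/-- The degree of a closed set with Hilbert polynomial `P`. -/
def normalizedLeadingCoeff (P : Polynomial ℚ) : ℚ := (P.natDegree.factorial : ℚ) * P.leadingCoeff

/-- Passing to a cone replaces the Hilbert function by its sums, which preserves the degree. -/
theorem exists_polynomial_sum {q : ℕ → ℕ} {P : Polynomial ℚ} (hP : P ≠ 0)
    (hq : ∀ t : ℕ, (q t : ℚ) = P.eval (t : ℚ)) :
    ∃ P' : Polynomial ℚ, P' ≠ 0 ∧
      (∀ t : ℕ, ((∑ s ∈ Finset.range (t + 1), q s : ℕ) : ℚ) = P'.eval (t : ℚ)) ∧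
      normalizedLeadingCoeff P' = normalizedLeadingCoeff P := by
  obtain ⟨S, hS⟩ := exists_eval_add_one_sub P
  obtain ⟨hdeg, hlead⟩ := natDegree_leadingCoeff_of_difference hP hS
  set S₁ := S.comp (Polynomial.X + Polynomial.C 1) with hS₁
  have hnd : S₁.natDegree = P.natDegree + 1 := by
    rw [hS₁, Polynomial.natDegree_comp, Polynomial.natDegree_X_add_C, mul_one, hdeg]
  have hlc : S₁.leadingCoeff = S.leadingCoeff := by
    rw [Polynomial.leadingCoeff, hnd, coeff_comp_X_add_C hdeg.le, ← hdeg, Polynomial.coeff_natDegree]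
  have hnd' : (S₁ - Polynomial.C (S.eval 0)).natDegree = P.natDegree + 1 := by
    rw [Polynomial.natDegree_sub_C, hnd]
  refine ⟨S₁ - Polynomial.C (S.eval 0), ?_, fun t => ?_, ?_⟩
  · intro h0
    rw [h0] at hnd'
    simp at hnd'
  · have : ∀ t : ℕ, ((∑ s ∈ Finset.range t, q s : ℕ) : ℚ) = S.eval (t : ℚ) - S.eval 0 := by
      intro t
      induction t with
      | zero => simp
      | succ t ih =>
        rw [Finset.sum_range_succ, Nat.cast_add, ih, hq, ← hS]
        push_cast
        ring
    rw [this, hS₁]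
    simp
  · have h1 : (S₁ - Polynomial.C (S.eval 0)).leadingCoeff = S.leadingCoeff := by
      rw [← hlc, Polynomial.leadingCoeff, Polynomial.leadingCoeff, hnd', hnd,
        Polynomial.coeff_sub, Polynomial.coeff_C_succ, sub_zero]
    rw [normalizedLeadingCoeff, normalizedLeadingCoeff, h1, hnd', Nat.factorial_succ, ← hlead]
    push_cast
    ring

theorem sum_antidiagonal_multichoose_succ (q : ℕ → ℕ) (k t : ℕ) :
    ∑ x ∈ Finset.HasAntidiagonal.antidiagonal t, q x.1 * Nat.multichoose (k + 1) x.2 =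
      ∑ s ∈ Finset.range (t + 1),
        ∑ x ∈ Finset.HasAntidiagonal.antidiagonal s, q x.1 * Nat.multichoose k x.2 := by
  induction t with
  | zero => simp
  | succ t ih =>
    rw [Finset.sum_range_succ, ← ih, Finset.Nat.sum_antidiagonal_succ',
      Finset.Nat.sum_antidiagonal_succ' (f := fun x => q x.1 * Nat.multichoose k x.2)]
    simp only [Nat.multichoose_zero_right, Nat.multichoose_succ_succ, mul_add,
      Finset.sum_add_distrib]
    ring

/-- Passing to a cone with `k`-dimensional vertex space preserves the degree. -/
theorem exists_polynomial_sum_multichoose {q : ℕ → ℕ} {P : Polynomial ℚ} (hP : P ≠ 0)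
    (hq : ∀ t : ℕ, (q t : ℚ) = P.eval (t : ℚ)) (k : ℕ) :
    ∃ P' : Polynomial ℚ, P' ≠ 0 ∧
      (∀ t : ℕ, ((∑ x ∈ Finset.HasAntidiagonal.antidiagonal t, q x.1 * Nat.multichoose k x.2 : ℕ) : ℚ) =
        P'.eval (t : ℚ)) ∧
      normalizedLeadingCoeff P' = normalizedLeadingCoeff P := by
  induction k with
  | zero =>
    refine ⟨P, hP, fun t => ?_, rfl⟩
    rw [← hq]
    cases t with
    | zero => simp
    | succ t => simp [Finset.Nat.sum_antidiagonal_succ']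
  | succ k ih =>
    obtain ⟨P₁, hP₁, h, hl⟩ := ih
    obtain ⟨P₂, hP₂, h', hl'⟩ := exists_polynomial_sum hP₁ h
    exact ⟨P₂, hP₂, fun t => by rw [sum_antidiagonal_multichoose_succ]; exact h' t, hl'.trans hl⟩

/-- The dimension of the forms of degree `c t` in `l + 1` variables. -/
theorem exists_polynomial_multichoose (l c : ℕ) (hc : c ≠ 0) :
    ∃ P : Polynomial ℚ, (∀ t : ℕ, (Nat.multichoose (l + 1) (t * c) : ℚ) = P.eval (t : ℚ)) ∧
      P.natDegree = l ∧ P.leadingCoeff = (c : ℚ) ^ l / l.factorial := by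
  have hc' : (c : ℚ) ≠ 0 := by exact_mod_cast hc
  have hl : (l.factorial : ℚ) ≠ 0 := by exact_mod_cast l.factorial_ne_zero
  have hlin : (Polynomial.C (c : ℚ) * Polynomial.X + Polynomial.C 1).natDegree = 1 :=
    Polynomial.natDegree_linear hc'
  refine ⟨Polynomial.C (l.factorial : ℚ)⁻¹ *
    (ascPochhammer ℚ l).comp (Polynomial.C (c : ℚ) * Polynomial.X + Polynomial.C 1), ?_, ?_, ?_⟩
  · intro t
    have h1 := ascPochhammer_nat_eq_natCast_ascFactorial ℚ (t * c + 1) l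
    rw [Nat.ascFactorial_eq_factorial_mul_choose] at h1
    have h2 : Nat.multichoose (l + 1) (t * c) = (t * c + l).choose l := by
      rw [Nat.multichoose_eq, show l + 1 + t * c - 1 = t * c + l by omega,
        ← Nat.choose_symm_add]
    simp only [Polynomial.eval_mul, Polynomial.eval_comp, Polynomial.eval_add, Polynomial.eval_C,
      Polynomial.eval_X]
    rw [show (c : ℚ) * t + 1 = ((t * c + 1 : ℕ) : ℚ) by push_cast; ring, h1, h2]
    push_cast
    field_simp
  · rw [Polynomial.natDegree_C_mul (inv_ne_zero hl), Polynomial.natDegree_comp, hlin,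
      ascPochhammer_natDegree, mul_one]
  · rw [Polynomial.leadingCoeff_mul, Polynomial.leadingCoeff_C,
      Polynomial.leadingCoeff_comp (by rw [hlin]; exact one_ne_zero),
      (monic_ascPochhammer ℚ l).leadingCoeff, Polynomial.leadingCoeff_linear hc',
      ascPochhammer_natDegree]
    field_simp

/-- The Segre–Veronese polynomial: the multinomial coefficient arises from the factorial of the sum
of the degrees `ℓᵢ` and the factorials in the leading coefficients of the factors. -/
theorem exists_polynomial_prod_multichoose {n : ℕ} (ℓ : Fin n → ℕ) :
    ∃ P : Polynomial ℚ, P ≠ 0 ∧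
      (∀ t : ℕ, ((∏ i, Nat.multichoose (ℓ i + 1) (t * (i + 1)) : ℕ) : ℚ) = P.eval (t : ℚ)) ∧
      normalizedLeadingCoeff P = (nNumber ℓ * mNumber ℓ : ℕ) := by
  choose P hP hdeg hlead using fun i : Fin n =>
    exists_polynomial_multichoose (ℓ i) ((i : ℕ) + 1) (Nat.succ_ne_zero _)
  have hne : ∀ i, P i ≠ 0 := by
    intro i h0
    have h1 := hlead i
    rw [h0, Polynomial.leadingCoeff_zero] at h1
    have : (((i : ℕ) + 1 : ℕ) : ℚ) ^ ℓ i / (ℓ i).factorial ≠ 0 := by positivity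
    exact this h1.symm
  refine ⟨∏ i, P i, Finset.prod_ne_zero_iff.2 fun i _ => hne i, fun t => ?_, ?_⟩
  · rw [Polynomial.eval_prod, Nat.cast_prod]
    exact Finset.prod_congr rfl fun i _ => hP i t
  · rw [normalizedLeadingCoeff, Polynomial.natDegree_prod _ _ fun i _ => hne i,
      Polynomial.leadingCoeff_prod, Finset.sum_congr rfl fun i _ => hdeg i,
      Finset.prod_congr rfl fun i _ => hlead i, Finset.prod_div_distrib, nNumber, mNumber,
      Nat.cast_mul, Nat.cast_div (Nat.prod_factorial_dvd_factorial_sum _ _)]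
    · push_cast
      ring
    · exact_mod_cast Finset.prod_ne_zero_iff.2 fun i _ => (ℓ i).factorial_ne_zero

/-! ### The multigraded Nullstellensatz and elimination -/

section Elimination

open MvPolynomial

variable {τ I : Type} [DecidableEq I]

/-- The weights on the variables `τ`, grouped by `grp : τ → I`, for which the weighted degree is the
multidegree. -/
def groupWeight (grp : τ → I) (t : τ) : I → ℕ := Pi.single (grp t) 1

/-- The multihomogeneous polynomials of multidegree `ε` with respect to the groups of variables
given by `grp`. -/
abbrev multiForms (grp : τ → I) (ε : I → ℕ) : Submodule ℂ (MvPolynomial τ ℂ) :=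
  weightedHomogeneousSubmodule ℂ (groupWeight grp) ε

theorem degree_eq_sum_weight [Finite τ] [Fintype I] (grp : τ → I) (α : τ →₀ ℕ) :
    α.degree = ∑ i, Finsupp.weight (groupWeight grp) α i := by
  classical
  have := Fintype.ofFinite τ
  simp only [Finsupp.weight_eq_sum, Finset.sum_apply, Pi.smul_apply, groupWeight]
  rw [Finset.sum_comm, Finsupp.degree_eq_sum]
  refine Finset.sum_congr rfl fun t _ => ?_
  rw [← Finset.smul_sum, Finset.sum_pi_single']
  simp

theorem multiForms_le_homogeneousSubmodule [Finite τ] [Fintype I] (grp : τ → I) (ε : I → ℕ) :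
    multiForms grp ε ≤ homogeneousSubmodule τ ℂ (∑ i, ε i) := by
  intro f hf
  rw [mem_homogeneousSubmodule]
  intro α hα
  have h1 := hf hα
  have h2 := degree_eq_sum_weight grp α
  rw [h1, Finsupp.degree_eq_weight_one] at h2
  exact h2

instance [Finite τ] [Finite I] (grp : τ → I) (ε : I → ℕ) :
    FiniteDimensional ℂ (multiForms grp ε) := by
  have := Fintype.ofFinite I
  exact Submodule.finiteDimensional_of_le (multiForms_le_homogeneousSubmodule grp ε)

theorem isWeightedHomogeneous_prod_X [Fintype I] {grp : τ → I} (s : I → τ)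
    (hs : ∀ i, grp (s i) = i) (ε : I → ℕ) :
    IsWeightedHomogeneous (groupWeight grp) (∏ i, (X (s i) : MvPolynomial τ ℂ) ^ ε i) ε := by
  have h1 := IsWeightedHomogeneous.prod (R := ℂ) Finset.univ (fun i => X (s i) ^ ε i)
    (fun i => ε i • groupWeight grp (s i)) (w := groupWeight grp)
    (fun i _ => (isWeightedHomogeneous_X ℂ _ (s i)).pow (ε i))
  have h2 : ∑ i, ε i • groupWeight grp (s i) = ε := by
    funext k
    simp [groupWeight, hs, Finset.sum_apply, Pi.single_apply]
  rwa [h2] at h1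

/-- A monomial of degree at least `K` in every group of variables is divisible by `K` of the
products that take one variable from each group. -/
theorem monomial_mem_pow_of_le_weight [Finite τ] [Fintype I] (grp : τ → I)
    {𝔠 : Ideal (MvPolynomial τ ℂ)}
    (h𝔠 : ∀ s : I → τ, (∀ i, grp (s i) = i) → ∏ i, X (s i) ∈ 𝔠) (K : ℕ) :
    ∀ α : τ →₀ ℕ, (∀ i, K ≤ Finsupp.weight (groupWeight grp) α i) →
      ∀ c : ℂ, monomial α c ∈ 𝔠 ^ K := by
  classical
  have := Fintype.ofFinite τ
  induction K with
  | zero => intro α _ c; simp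
  | succ K ih =>
    intro α hα c
    have h1 : ∀ i, ∃ t, grp t = i ∧ α t ≠ 0 := by
      intro i
      by_contra! hne
      have h2 := hα i
      rw [Finsupp.weight_eq_sum, Finset.sum_apply, Finset.sum_eq_zero] at h2
      · omega
      · intro t _
        by_cases ht : grp t = i
        · simp [hne t ht]
        · simp [groupWeight, Ne.symm ht]
    choose s hs hs' using h1
    set σ : τ →₀ ℕ := ∑ i, Finsupp.single (s i) 1 with hσ
    have hinj : ∀ i j, s i = s j → i = j := fun i j h => by rw [← hs i, h, hs j]
    have hσle : σ ≤ α := by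
      intro t
      rw [hσ, Finsupp.finsetSum_apply]
      by_cases ht : ∃ i, s i = t
      · obtain ⟨i, rfl⟩ := ht
        rw [Finset.sum_eq_single i]
        · rw [Finsupp.single_eq_same]
          exact Nat.one_le_iff_ne_zero.2 (hs' i)
        · intro j _ hj
          exact Finsupp.single_eq_of_ne fun h => hj (hinj _ _ h.symm)
        · simp
      · rw [Finset.sum_eq_zero]
        · exact Nat.zero_le _
        · intro i _
          exact Finsupp.single_eq_of_ne fun h => ht ⟨i, h.symm⟩
    have hw : Finsupp.weight (groupWeight grp) σ = 1 := by
      rw [hσ, map_sum]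
      funext k
      simp [Finsupp.weight_single, groupWeight, hs, Finset.sum_apply, Pi.single_apply]
    have hsum : α = (α - σ) + σ := (tsub_add_cancel_of_le hσle).symm
    have hrest : ∀ i, K ≤ Finsupp.weight (groupWeight grp) (α - σ) i := by
      intro i
      have h3 := hα i
      rw [hsum, map_add, hw, Pi.add_apply, Pi.one_apply] at h3
      omega
    have hmon : monomial α c = monomial (α - σ) c * ∏ i, X (s i) := by
      have : ∏ i, (X (s i) : MvPolynomial τ ℂ) = monomial σ 1 := by
        rw [hσ, monomial_sum_one]
        rfl
      rw [this, monomial_mul, mul_one, ← hsum]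
    rw [hmon, pow_succ]
    exact Ideal.mul_mem_mul (ih _ hrest c) (h𝔠 s hs)

/-- The part of multidegree `ε` of an ideal generated by multihomogeneous polynomials. -/
theorem weightedHomogeneousComponent_mem_span (grp : τ → I) {J : Type}
    (G : J → MvPolynomial τ ℂ) (δ : J → I → ℕ)
    (hG : ∀ j, IsWeightedHomogeneous (groupWeight grp) (G j) (δ j)) (ε : I → ℕ)
    {f : MvPolynomial τ ℂ} (hf : f ∈ Ideal.span (Set.range G)) :
    weightedHomogeneousComponent (groupWeight grp) ε f ∈
      Submodule.span ℂ {x | ∃ j e, e + δ j = ε ∧ ∃ v ∈ multiForms grp e, G j * v = x} := by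
  classical
  obtain ⟨c, rfl⟩ := Finsupp.mem_ideal_span_range_iff_exists_finsupp.1 hf
  rw [Finsupp.sum, map_sum]
  refine Submodule.sum_mem _ fun j _ => ?_
  induction c j using MvPolynomial.induction_on' with
  | add p q hp hq => rw [add_mul, map_add]; exact add_mem hp hq
  | monomial α a =>
    have h1 : monomial α a ∈ multiForms grp (Finsupp.weight (groupWeight grp) α) :=
      isWeightedHomogeneous_monomial _ _ _ rfl
    have h2 : monomial α a * G j ∈ multiForms grp (Finsupp.weight (groupWeight grp) α + δ j) :=
      IsWeightedHomogeneous.mul h1 (hG j)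
    rw [weightedHomogeneousComponent_of_mem h2]
    split_ifs with h
    · exact Submodule.subset_span ⟨j, _, h.symm, _, h1, mul_comm _ _⟩
    · exact Submodule.zero_mem _

/-- **Multigraded Nullstellensatz.** If multihomogeneous polynomials have no common zero in the
product of projective spaces, then their ideal contains all forms of large multidegree. -/
theorem exists_multiForms_le_span [Finite τ] [Finite I] (grp : τ → I) {J : Type}
    (G : J → MvPolynomial τ ℂ) (δ : J → I → ℕ)
    (hG : ∀ j, IsWeightedHomogeneous (groupWeight grp) (G j) (δ j))
    (h : ∀ c : τ → ℂ, (∀ j, eval c (G j) = 0) → ∃ i, ∀ t, grp t = i → c t = 0) :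
    ∃ K : ℕ, ∀ ε : I → ℕ, (∀ i, K ≤ ε i) → multiForms grp ε ≤
      Submodule.span ℂ {x | ∃ j e, e + δ j = ε ∧ ∃ v ∈ multiForms grp e, G j * v = x} := by
  classical
  have := Fintype.ofFinite I
  set 𝔠 : Ideal (MvPolynomial τ ℂ) :=
    Ideal.span {f | ∃ s : I → τ, (∀ i, grp (s i) = i) ∧ ∏ i, X (s i) = f} with h𝔠
  have hrad : 𝔠 ≤ (Ideal.span (Set.range G)).radical := by
    rw [← vanishingIdeal_zeroLocus_eq_radical (K := ℂ), h𝔠, Ideal.span_le]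
    rintro _ ⟨s, hs, rfl⟩ c hc
    obtain ⟨i, hi⟩ := h c fun j => by
      simpa [aeval_eq_eval] using hc (G j) (Ideal.subset_span ⟨j, rfl⟩)
    rw [map_prod]
    exact Finset.prod_eq_zero (Finset.mem_univ i) (by rw [aeval_X]; exact hi _ (hs i))
  have hmem : ∀ s : I → τ, (∀ i, grp (s i) = i) → ∏ i, X (s i) ∈ 𝔠 := fun s hs =>
    Ideal.subset_span ⟨s, hs, rfl⟩
  obtain ⟨K, hK⟩ := Ideal.exists_pow_le_of_le_radical_of_fg hrad (isNoetherian_def.1 inferInstance 𝔠)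
  refine ⟨K, fun ε hε f hf => ?_⟩
  have hfmem : f ∈ Ideal.span (Set.range G) := by
    rw [f.as_sum]
    refine Ideal.sum_mem _ fun α hα => hK ?_
    refine monomial_mem_pow_of_le_weight grp hmem K α ?_ _
    intro i
    rw [hf (mem_support_iff.1 hα)]
    exact hε i
  have := weightedHomogeneousComponent_mem_span grp G δ hG ε hfmem
  rwa [weightedHomogeneousComponent_eq_self hf] at this

/-- It is an open condition that vectors of a finite-dimensional space which depend linearly on the
coordinates span that space: some determinant is nonzero. -/
theorem isOpen_span_range_eq_top {ι : Type} [Finite ι] {V : Type} [AddCommGroup V] [Module ℂ V]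
    [FiniteDimensional ℂ V] {B : Type} (ψ : B → (ι → ℂ) →ₗ[ℂ] V) :
    @IsOpen _ (zariskiTopology ι)
      {x | Submodule.span ℂ (Set.range fun b => ψ b x.rep) = ⊤} := by
  classical
  have := Fintype.ofFinite ι
  let _ := zariskiTopology ι
  rw [isOpen_iff_forall_mem_open]
  intro x₀ hx₀
  obtain ⟨f, hf, hspan, hli⟩ :=
    Submodule.exists_fun_fin_finrank_span_eq ℂ (Set.range fun b => ψ b x₀.rep)
  choose b hb using hf
  set e := Module.Basis.mk hli (hspan.trans hx₀).ge with he
  set M : Matrix _ _ (MvPolynomial ι ℂ) := Matrix.of fun i j =>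
    ∑ k, C (e.repr (ψ (b j) (Pi.single k 1)) i) * X k with hM
  have hMx : ∀ x : ι → ℂ, eval x M.det = e.det fun j => ψ (b j) x := by
    intro x
    rw [RingHom.map_det, Module.Basis.det_apply]
    congr 1
    ext i j
    rw [RingHom.mapMatrix_apply, Matrix.map_apply, Module.Basis.toMatrix_apply, hM, Matrix.of_apply,
      map_sum]
    conv_rhs => rw [← Finset.univ_sum_single x, map_sum, map_sum, Finsupp.finsetSum_apply]
    refine Finset.sum_congr rfl fun k _ => ?_
    have : (Pi.single k (x k) : ι → ℂ) = x k • Pi.single k 1 := by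
      rw [← Pi.single_smul, smul_eq_mul, mul_one]
    rw [this, map_smul, map_smul, Finsupp.smul_apply, smul_eq_mul, map_mul, eval_C, eval_X,
      mul_comm]
  have hhom : M.det.IsHomogeneous (Fintype.card (Fin (Module.finrank ℂ
      (Submodule.span ℂ (Set.range fun b => ψ b x₀.rep))))) := by
    rw [Matrix.det_apply]
    refine IsHomogeneous.sum _ _ _ fun σ _ => ?_
    refine Submodule.smul_of_tower_mem (homogeneousSubmodule ι ℂ _) _ ?_
    have h1 := IsHomogeneous.prod Finset.univ (fun i => M (σ i) i) (fun _ => 1) fun i _ => by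
      rw [hM, Matrix.of_apply]
      exact IsHomogeneous.sum _ _ _ fun k _ => isHomogeneous_C_mul_X _ _
    simpa using h1
  refine ⟨{x | eval x.rep M.det ≠ 0}, fun x hx => ?_,
    TopologicalSpace.isOpen_generateFrom_of_mem ⟨_, _, hhom, rfl⟩, ?_⟩
  · have h2 : IsUnit (e.det fun j => ψ (b j) x.rep) := by
      rw [← hMx]
      exact isUnit_iff_ne_zero.2 hx
    have h3 := ((Module.Basis.is_basis_iff_det e).2 h2).2
    rw [Set.mem_ofPred_eq, eq_top_iff, ← h3]
    refine Submodule.span_mono ?_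
    rintro _ ⟨j, rfl⟩
    exact ⟨b j, rfl⟩
  · rw [Set.mem_ofPred_eq, hMx]
    have : (fun j => ψ (b j) x₀.rep) = e := by
      funext j
      rw [he, Module.Basis.mk_apply]
      exact hb j
    rw [this, Module.Basis.det_self]
    exact one_ne_zero

/-- **Main theorem of elimination theory**, for equations that are linear in the coordinates of the
base and multihomogeneous in the variables to be eliminated. -/
theorem isClosed_setOf_exists_zero {ι : Type} [Finite ι] [Finite τ] [Finite I] (grp : τ → I)
    {J : Type} (G : J → (ι → ℂ) →ₗ[ℂ] MvPolynomial τ ℂ) (δ : J → I → ℕ)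
    (hG : ∀ j a, IsWeightedHomogeneous (groupWeight grp) (G j a) (δ j)) :
    @IsClosed _ (zariskiTopology ι)
      {x | ∃ c : τ → ℂ, (∀ i, ∃ t, grp t = i ∧ c t ≠ 0) ∧ ∀ j, eval c (G j x.rep) = 0} := by
  classical
  have := Fintype.ofFinite I
  let _ := zariskiTopology ι
  rw [← isOpen_compl_iff, isOpen_iff_forall_mem_open]
  intro x₀ hx₀
  obtain ⟨K, hK⟩ := exists_multiForms_le_span grp (fun j => G j x₀.rep) δ (fun j => hG j _)
    (by
      intro c hc
      by_contra! hne
      exact hx₀ ⟨c, fun i => hne i, hc⟩)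
  set ε : I → ℕ := fun _ => K with hε
  let B : Type := {p : J × (I → ℕ) × MvPolynomial τ ℂ //
    p.2.1 + δ p.1 = ε ∧ p.2.2 ∈ multiForms grp p.2.1}
  let ψ : B → (ι → ℂ) →ₗ[ℂ] multiForms grp ε := fun p =>
    LinearMap.codRestrict _ ((LinearMap.mulRight ℂ p.1.2.2).comp (G p.1.1)) (by
      intro a
      have := IsWeightedHomogeneous.mul (hG p.1.1 a) p.2.2
      rw [add_comm, p.2.1] at this
      exact this)
  have hψ : ∀ (p : B) a, ((ψ p a : multiForms grp ε) : MvPolynomial τ ℂ) = G p.1.1 a * p.1.2.2 :=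
    fun _ _ => rfl
  refine ⟨_, ?_, isOpen_span_range_eq_top ψ, ?_⟩
  · rintro x hx ⟨c, hc, hc0⟩
    choose s hs hs' using hc
    have hmem : ∏ i, X (s i) ^ ε i ∈ multiForms grp ε := isWeightedHomogeneous_prod_X s hs ε
    have hker : (⊤ : Submodule ℂ (multiForms grp ε)) ≤
        LinearMap.ker ((aeval c).toLinearMap.comp (multiForms grp ε).subtype) := by
      rw [← (hx : Submodule.span ℂ _ = ⊤), Submodule.span_le]
      rintro _ ⟨p, rfl⟩
      simp [hψ, aeval_eq_eval, hc0]
    have h0 := hker (Submodule.mem_top (x := ⟨_, hmem⟩))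
    simp only [LinearMap.mem_ker, LinearMap.comp_apply, Submodule.subtype_apply,
      AlgHom.toLinearMap_apply, map_prod, map_pow, aeval_X] at h0
    exact Finset.prod_ne_zero_iff.2 (fun i _ => pow_ne_zero _ (hs' i)) h0
  · rw [Set.mem_ofPred_eq, eq_top_iff]
    have h1 : (multiForms grp ε) ≤ (Submodule.span ℂ
        (Set.range fun p => ψ p x₀.rep)).map (multiForms grp ε).subtype := by
      refine (hK ε fun _ => le_rfl).trans ?_
      rw [Submodule.map_span]
      refine Submodule.span_mono ?_
      rintro _ ⟨j, e, he, v, hv, rfl⟩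
      exact ⟨_, ⟨⟨(j, e, v), he, hv⟩, rfl⟩, rfl⟩
    rintro ⟨f, hf⟩ -
    obtain ⟨g, hg, hgf⟩ := h1 hf
    have : g = ⟨f, hf⟩ := Subtype.ext hgf
    exact this ▸ hg

end Elimination

/-! ### Descent of the factors of a polynomial with prescribed multiplicities -/

section Descent

open Polynomial

/-- A polynomial that becomes separable under a specialization preserving its degree is generically
separable, because the resultant with the derivative does not vanish. -/
theorem separable_map_of_separable_map {R k L : Type*} [CommRing R] [Field k] [CharZero k]
    [Field L] (φ : R →+* k) {ψ : R →+* L} (hψ : Function.Injective ψ) {f : R[X]}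
    (hφ : φ f.leadingCoeff ≠ 0) (h : (f.map φ).Separable) : (f.map ψ).Separable := by
  have hdom : IsDomain R := hψ.isDomain ψ
  have hchar : CharZero R := ⟨fun a b hab => by
    have h1 : φ a = φ b := by rw [hab]
    rwa [map_natCast, map_natCast, Nat.cast_inj] at h1⟩
  have h1 : (f.map φ).natDegree = f.natDegree := natDegree_map_of_leadingCoeff_ne_zero φ hφ
  have h2 : (f.map ψ).natDegree = f.natDegree := natDegree_map_eq_of_injective hψ f
  have h3 : (derivative (f.map φ)).natDegree = f.derivative.natDegree := by
    rw [natDegree_derivative, natDegree_derivative, h1]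
  have h4 : (derivative (f.map ψ)).natDegree = f.derivative.natDegree := by
    rw [derivative_map, natDegree_map_eq_of_injective hψ]
  have h5 : φ (resultant f f.derivative) ≠ 0 := by
    rw [← resultant_map_map, ← derivative_map, ← h3, ← h1]
    intro h0
    exact (resultant_eq_zero_iff.1 h0).2 h
  have h6 : resultant (f.map ψ) (derivative (f.map ψ)) ≠ 0 := by
    rw [h2, h4, derivative_map, resultant_map_map, map_ne_zero_iff ψ hψ]
    exact fun h0 => h5 (by rw [h0, map_zero])
  by_contra hsep
  refine h6 (resultant_eq_zero_iff.2 ⟨Or.inl ?_, hsep⟩)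
  intro h0
  have : f.map ψ = 0 := h0
  rw [Polynomial.map_eq_zero_iff hψ] at this
  rw [this] at hφ
  simp at hφ

/-- Over fields of characteristic zero, the polynomials formed by the roots of given multiplicity
are defined over the field of definition. -/
theorem exists_map_eq_of_map_eq_prod_pow {K L : Type*} [Field K] [CharZero K] [Field L]
    (i : K →+* L) {n : ℕ} : ∀ (g : Fin n → L[X]) (P : K[X]), (∀ k, (g k).Monic) →
      (∏ k, g k).Separable → P.map i = ∏ k, g k ^ ((k : ℕ) + 1) →
      ∀ k, ∃ G : K[X], G.map i = g k := by
  induction n with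
  | zero => intro _ _ _ _ _ k; exact k.elim0
  | succ n ih =>
    intro g P hg hsep hP
    have hPne : P ≠ 0 := by
      rintro rfl
      rw [Polynomial.map_zero] at hP
      exact (Finset.prod_ne_zero_iff.2 fun k _ => pow_ne_zero _ (hg k).ne_zero) hP.symm
    have hR : (∏ k, g k).Monic := monic_prod_of_monic _ _ fun k _ => hg k
    have hfac : P.map i = (∏ k, g k) * ∏ k : Fin n, g k.succ ^ ((k : ℕ) + 1) := by
      rw [hP, Fin.prod_univ_succ, Fin.prod_univ_succ, mul_assoc, ← Finset.prod_mul_distrib]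
      simp [pow_succ']
    obtain ⟨y, m, hy, hyP, hPy⟩ := exists_squarefree_dvd_pow_of_ne_zero hPne
    have hy0 : y ≠ 0 := hy.ne_zero
    have hysq : Squarefree (y.map i) :=
      (PerfectField.separable_iff_squarefree.2 hy).map.squarefree
    have hRy : (∏ k, g k) ∣ y.map i := by
      rw [← hsep.squarefree.dvd_pow_iff_dvd (Nat.succ_ne_zero m), ← Polynomial.map_pow]
      refine (Dvd.intro _ hfac.symm).trans (Polynomial.map_dvd i ?_)
      exact hPy.trans (pow_dvd_pow y (Nat.le_succ m))
    have hyR : y.map i ∣ ∏ k, g k := by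
      rw [← hysq.dvd_pow_iff_dvd (Nat.succ_ne_zero n)]
      refine (Polynomial.map_dvd i hyP).trans ?_
      rw [hP, ← Finset.prod_pow]
      exact Finset.prod_dvd_prod_of_dvd _ _ fun k _ => pow_dvd_pow _ k.2
    have hlc : y.leadingCoeff ≠ 0 := leadingCoeff_ne_zero.2 hy0
    set Y := y * C y.leadingCoeff⁻¹ with hY
    have hYu : IsUnit (C y.leadingCoeff⁻¹ : K[X]) := isUnit_C.2 (inv_ne_zero hlc).isUnit
    have hYR : Y.map i = ∏ k, g k := by
      refine eq_of_monic_of_associated ((monic_mul_leadingCoeff_inv hy0).map i) hR ?_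
      rw [hY, Polynomial.map_mul]
      refine Associated.trans ?_ (associated_of_dvd_dvd hyR hRy)
      exact associated_mul_unit_left _ _ (hYu.map (mapRingHom i))
    obtain ⟨P₁, hP₁⟩ : Y ∣ P := (hYu.mul_right_dvd).2 hyP
    have hP₁map : P₁.map i = ∏ k : Fin n, g k.succ ^ ((k : ℕ) + 1) := by
      have h1 : (∏ k, g k) * P₁.map i = (∏ k, g k) * ∏ k : Fin n, g k.succ ^ ((k : ℕ) + 1) := by
        rw [← hfac, hP₁, Polynomial.map_mul, hYR]
      exact mul_left_cancel₀ hR.ne_zero h1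
    have hsep' : (∏ k : Fin n, g k.succ).Separable := by
      rw [Fin.prod_univ_succ] at hsep
      exact hsep.of_mul_right
    have hsucc := ih (fun k => g k.succ) P₁ (fun k => hg _) hsep' hP₁map
    choose G hG using hsucc
    intro k
    refine Fin.cases ?_ (fun k => ⟨G k, hG k⟩) k
    have hD : (∏ k : Fin n, G k).map i = ∏ k : Fin n, g k.succ := by
      rw [Polynomial.map_prod]
      exact Finset.prod_congr rfl fun k _ => hG k
    have hDne : ∏ k : Fin n, g k.succ ≠ 0 := Finset.prod_ne_zero_iff.2 fun k _ => (hg _).ne_zero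
    obtain ⟨Z, hZ⟩ : (∏ k : Fin n, G k) ∣ Y := by
      rw [← Polynomial.map_dvd_map' i, hD, hYR, Fin.prod_univ_succ]
      exact dvd_mul_left _ _
    refine ⟨Z, mul_right_cancel₀ hDne ?_⟩
    rw [← Fin.prod_univ_succ, ← hYR, hZ, Polynomial.map_mul, hD, mul_comm]

end Descent

/-! ### Products of powers of binary forms -/

section CoefficientSpan

/-- The coefficients of a polynomial are linear combinations of its values at complex numbers:
a linear form that vanishes on the values vanishes on the coefficients. -/
theorem polynomial_coeff_mem_span_eval {R : Type*} [CommRing R] [Algebra ℂ R] (p : Polynomial R)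
    (k : ℕ) :
    p.coeff k ∈ Submodule.span ℂ (Set.range fun t : ℂ => p.eval (algebraMap ℂ R t)) := by
  by_contra hk
  obtain ⟨φ, hφ, hker⟩ := Submodule.exists_le_ker_of_notMem hk
  set pφ : Polynomial ℂ :=
    ∑ j ∈ Finset.range (p.natDegree + 1), Polynomial.monomial j (φ (p.coeff j)) with hpφ
  have h0 : pφ = 0 := by
    refine Polynomial.funext fun t => ?_
    have h1 : φ (p.eval (algebraMap ℂ R t)) = 0 := hker (Submodule.subset_span ⟨t, rfl⟩)
    rw [Polynomial.eval_eq_sum_range, map_sum] at h1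
    rw [hpφ, Polynomial.eval_finsetSum, Polynomial.eval_zero, ← h1]
    refine Finset.sum_congr rfl fun j _ => ?_
    rw [Polynomial.eval_monomial, ← map_pow, mul_comm (p.coeff j), ← Algebra.smul_def, map_smul,
      smul_eq_mul, mul_comm]
  apply hφ
  have h2 : pφ.coeff k = φ (p.coeff k) := by
    rw [hpφ, Polynomial.finsetSum_coeff]
    simp only [Polynomial.coeff_monomial, Finset.sum_ite_eq', Finset.mem_range]
    split_ifs with h
    · rfl
    · rw [Polynomial.coeff_eq_zero_of_natDegree_lt (by omega), map_zero]
  rw [← h2, h0, Polynomial.coeff_zero]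

theorem mvPolynomial_coeff_mem_span_eval {σ R : Type*} [CommRing R] [Algebra ℂ R]
    (p : MvPolynomial σ R) (m : σ →₀ ℕ) :
    p.coeff m ∈ Submodule.span ℂ
      (Set.range fun t : σ → ℂ => MvPolynomial.eval (fun i => algebraMap ℂ R (t i)) p) := by
  classical
  by_contra hm
  obtain ⟨φ, hφ, hker⟩ := Submodule.exists_le_ker_of_notMem hm
  set pφ : MvPolynomial σ ℂ :=
    ∑ j ∈ p.support, MvPolynomial.monomial j (φ (p.coeff j)) with hpφ
  have h0 : pφ = 0 := by
    refine MvPolynomial.funext fun t => ?_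
    have h1 : φ (MvPolynomial.eval (fun i => algebraMap ℂ R (t i)) p) = 0 :=
      hker (Submodule.subset_span ⟨t, rfl⟩)
    rw [MvPolynomial.eval_eq, map_sum] at h1
    rw [hpφ, map_sum, map_zero, ← h1]
    refine Finset.sum_congr rfl fun j _ => ?_
    simp_rw [← map_pow]
    rw [MvPolynomial.eval_monomial, ← map_prod, mul_comm (p.coeff j), ← Algebra.smul_def, map_smul,
      smul_eq_mul, mul_comm]
    rfl
  apply hφ
  have h2 : pφ.coeff m = φ (p.coeff m) := by
    rw [hpφ, MvPolynomial.coeff_sum]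
    simp only [MvPolynomial.coeff_monomial, Finset.sum_ite_eq']
    split_ifs with h
    · rfl
    · rw [MvPolynomial.notMem_support_iff.1 h, map_zero]
  rw [← h2, h0, MvPolynomial.coeff_zero]

end CoefficientSpan

section ProductForm

open MvPolynomial

/-- The binary form of degree `l` with coefficients `c`, evaluated at `(x, y)`. -/
def binaryForm {R : Type*} [CommRing R] {l : ℕ} (c : Fin (l + 1) → R) (x y : R) : R :=
  ∑ j, c j * (x ^ (l - j) * y ^ (j : ℕ))

theorem map_binaryForm {R S : Type*} [CommRing R] [CommRing S] (φ : R →+* S) {l : ℕ}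
    (c : Fin (l + 1) → R) (x y : R) :
    φ (binaryForm c x y) = binaryForm (fun j => φ (c j)) (φ x) (φ y) := by
  simp [binaryForm]

theorem binaryForm_zero_one {R : Type*} [CommRing R] {l : ℕ} (c : Fin (l + 1) → R) :
    binaryForm c 0 1 = c (Fin.last l) := by
  rw [binaryForm, Finset.sum_eq_single (Fin.last l)]
  · simp
  · intro j _ hj
    have : l - (j : ℕ) ≠ 0 := by
      have := Fin.val_lt_last hj
      omega
    simp [this]
  · simp

theorem coeff_binaryForm_one_X {R : Type*} [CommRing R] {l : ℕ} (c : Fin (l + 1) → R)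
    (j : Fin (l + 1)) :
    (binaryForm (fun j => Polynomial.C (c j)) 1 Polynomial.X).coeff j = c j := by
  simp [binaryForm, Polynomial.finsetSum_coeff, Polynomial.coeff_X_pow, Fin.val_inj]

theorem natDegree_binaryForm_one_X_le {R : Type*} [CommRing R] {l : ℕ} (c : Fin (l + 1) → R) :
    (binaryForm (fun j => Polynomial.C (c j)) 1 Polynomial.X).natDegree ≤ l := by
  refine Polynomial.natDegree_sum_le_of_forall_le _ _ fun j _ => ?_
  rw [one_pow, one_mul]
  exact (Polynomial.natDegree_C_mul_X_pow_le _ _).trans (Nat.lt_succ_iff.1 j.2)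

theorem binaryForm_coeff {R : Type*} [CommRing R] {l : ℕ} {p : Polynomial R}
    (hp : p.natDegree ≤ l) :
    binaryForm (fun j : Fin (l + 1) => Polynomial.C (p.coeff j)) 1 Polynomial.X = p := by
  conv_rhs => rw [p.as_sum_range_C_mul_X_pow' (Nat.lt_succ_of_le hp)]
  simp [binaryForm, Finset.sum_range]

variable {n : ℕ} (ℓ : Fin n → ℕ)

/-- The indices of the coefficients of `n` binary forms, of degrees `ℓ₁, …, ℓₙ`. -/
abbrev FactorIndex : Type := Σ i : Fin n, Fin (ℓ i + 1)

/-- The product `∏ fᵢ ^ i` for binary forms `fᵢ` of degree `ℓᵢ`, with coefficients `c`. -/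
def productForm {R : Type*} [CommRing R] (c : FactorIndex ℓ → R) (x y : R) : R :=
  ∏ i, binaryForm (fun j => c ⟨i, j⟩) x y ^ ((i : ℕ) + 1)

theorem map_productForm {R S : Type*} [CommRing R] [CommRing S] (φ : R →+* S)
    (c : FactorIndex ℓ → R) (x y : R) :
    φ (productForm ℓ c x y) = productForm ℓ (fun k => φ (c k)) (φ x) (φ y) := by
  simp [productForm, map_binaryForm]

theorem productForm_zero_one {R : Type*} [CommRing R] (c : FactorIndex ℓ → R) :
    productForm ℓ c 0 1 = ∏ i, c ⟨i, Fin.last _⟩ ^ ((i : ℕ) + 1) := by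
  simp [productForm, binaryForm_zero_one]

/-- The multidegree `(1, …, n)` of `∏ fᵢ ^ i` in the coefficients of `f₁, …, fₙ`. -/
def multVector (n : ℕ) : Fin n → ℕ := fun i => (i : ℕ) + 1

/-- The product `∏ fᵢ ^ i` for binary forms `fᵢ` with indeterminate coefficients, evaluated at
`(x, y)`. -/
def genericProduct (x y : ℂ) : MvPolynomial (FactorIndex ℓ) ℂ := productForm ℓ X (C x) (C y)

theorem isWeightedHomogeneous_genericProduct (x y : ℂ) :
    IsWeightedHomogeneous (groupWeight Sigma.fst) (genericProduct ℓ x y) (multVector n) := by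
  have h1 : ∀ i : Fin n, IsWeightedHomogeneous (groupWeight Sigma.fst)
      (binaryForm (fun j => (X ⟨i, j⟩ : MvPolynomial (FactorIndex ℓ) ℂ)) (C x) (C y))
      (Pi.single i 1 : Fin n → ℕ) := by
    intro i
    refine IsWeightedHomogeneous.sum _ _ _ fun j _ => ?_
    rw [← C_pow, ← C_pow, ← C_mul, mul_comm]
    exact (isWeightedHomogeneous_X ℂ _ (⟨i, j⟩ : FactorIndex ℓ)).C_mul _
  have h2 := IsWeightedHomogeneous.prod Finset.univ
    (fun i : Fin n => binaryForm (fun j => (X ⟨i, j⟩ : MvPolynomial (FactorIndex ℓ) ℂ))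
      (C x) (C y) ^ ((i : ℕ) + 1))
    (fun i => ((i : ℕ) + 1) • Pi.single i 1) fun i _ => (h1 i).pow _
  have h3 : ∑ i : Fin n, ((i : ℕ) + 1) • (Pi.single i 1 : Fin n → ℕ) = multVector n := by
    funext k
    simp [Finset.sum_apply, Pi.single_apply, multVector]
  rwa [h3] at h2

theorem exists_productForm_ne_zero {c : FactorIndex ℓ → ℂ} (hc : ∀ i, ∃ j, c ⟨i, j⟩ ≠ 0) :
    ∃ t : ℂ, productForm ℓ c 1 t ≠ 0 := by
  have h1 : ∀ i, binaryForm (fun j => Polynomial.C (c ⟨i, j⟩)) 1 Polynomial.X ≠ 0 := by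
    intro i h0
    obtain ⟨j, hj⟩ := hc i
    refine hj ?_
    have := coeff_binaryForm_one_X (fun j => c ⟨i, j⟩) j
    rw [h0, Polynomial.coeff_zero] at this
    exact this.symm
  have h2 : productForm ℓ (fun k => Polynomial.C (c k)) 1 Polynomial.X ≠ 0 :=
    Finset.prod_ne_zero_iff.2 fun i _ => pow_ne_zero _ (h1 i)
  by_contra! hall
  refine h2 (Polynomial.funext fun t => ?_)
  rw [Polynomial.eval_zero, ← hall t, ← Polynomial.coe_evalRingHom, map_productForm]
  simp

/-- The span of the coefficients of the generic product `∏ fᵢ ^ i`, spanned also by its values. -/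
def productSpan : Submodule ℂ (MvPolynomial (FactorIndex ℓ) ℂ) :=
  Submodule.span ℂ (Set.range fun s : ℂ × ℂ => genericProduct ℓ s.1 s.2)

theorem genericProduct_mem (x y : ℂ) : genericProduct ℓ x y ∈ productSpan ℓ :=
  Submodule.subset_span ⟨(x, y), rfl⟩

theorem productSpan_pow_le (t : ℕ) :
    productSpan ℓ ^ t ≤ multiForms Sigma.fst (t • multVector n) := by
  induction t with
  | zero =>
    rw [pow_zero, zero_smul, Submodule.one_le]
    exact isWeightedHomogeneous_one _ _
  | succ t ih =>
    rw [pow_succ, succ_nsmul]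
    refine (mul_le_mul' ih ?_).trans (weightedHomogeneousSubmodule_mul _ _ _)
    rw [productSpan, Submodule.span_le]
    rintro _ ⟨s, rfl⟩
    exact isWeightedHomogeneous_genericProduct ℓ _ _

/-- The multihomogeneous coordinate ring of the product of projective spaces is finite over the
ring generated by the coefficients of the product `∏ fᵢ ^ i`: this product vanishes only when some
`fᵢ` does. -/
theorem exists_multiForms_le_mul :
    ∃ m : ℕ, ∀ s : ℕ, multiForms Sigma.fst ((s + m) • multVector n) ≤
      productSpan ℓ ^ s * multiForms Sigma.fst (m • multVector n) := by
  obtain ⟨K, hK⟩ := exists_multiForms_le_span (Sigma.fst : FactorIndex ℓ → Fin n)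
    (fun s : ℂ × ℂ => genericProduct ℓ s.1 s.2) (fun _ => multVector n)
    (fun s => isWeightedHomogeneous_genericProduct ℓ s.1 s.2) (by
      intro c hc
      by_contra! hne
      obtain ⟨t, ht⟩ := exists_productForm_ne_zero ℓ (c := c) fun i => by
        obtain ⟨⟨i', j⟩, rfl, h⟩ := hne i
        exact ⟨j, h⟩
      refine ht ?_
      have := hc (1, t)
      simpa [genericProduct, map_productForm] using this)
  refine ⟨K, fun s => ?_⟩
  induction s with
  | zero => rw [pow_zero, one_mul, zero_add]
  | succ s ih =>
    refine (hK _ ?_).trans ?_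
    · intro i
      simp only [Pi.smul_apply, smul_eq_mul, multVector]
      nlinarith
    · rw [Submodule.span_le]
      rintro _ ⟨x, e, he, v, hv, rfl⟩
      have he' : e = (s + K) • multVector n := by
        have : (s + 1 + K) • multVector n = (s + K) • multVector n + multVector n := by
          rw [← succ_nsmul]
          congr 1
          omega
        rw [this] at he
        exact add_right_cancel he
      rw [pow_succ', mul_assoc]
      exact Submodule.mul_mem_mul (genericProduct_mem ℓ _ _) (ih (he' ▸ hv))

end ProductForm

/-! ### Birationality of the parametrization by factors -/

section Birational

open MvPolynomial

variable {n : ℕ} (ℓ : Fin n → ℕ)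

theorem mul_mem_productSpan_pow {s t : ℕ} {p q : MvPolynomial (FactorIndex ℓ) ℂ}
    (hp : p ∈ productSpan ℓ ^ s) (hq : q ∈ productSpan ℓ ^ t) : p * q ∈ productSpan ℓ ^ (s + t) := by
  rw [pow_add]
  exact Submodule.mul_mem_mul hp hq

theorem one_mem_productSpan_pow : (1 : MvPolynomial (FactorIndex ℓ) ℂ) ∈ productSpan ℓ ^ 0 :=
  Submodule.one_le.1 (pow_zero (productSpan ℓ)).ge

/-- The function field of the image of the parametrization: the quotients of polynomials of equal
degree in the coefficients of the product `∏ fᵢ ^ i`. -/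
def imageFunctionField : Subfield (FractionRing (MvPolynomial (FactorIndex ℓ) ℂ)) where
  carrier := {x | ∃ t, ∃ p ∈ productSpan ℓ ^ t, ∃ q ∈ productSpan ℓ ^ t, q ≠ 0 ∧
    x = algebraMap _ _ p / algebraMap _ _ q}
  zero_mem' := ⟨0, 0, Submodule.zero_mem _, 1, one_mem_productSpan_pow ℓ, one_ne_zero, by simp⟩
  one_mem' := ⟨0, 1, one_mem_productSpan_pow ℓ, 1, one_mem_productSpan_pow ℓ, one_ne_zero, by simp⟩
  mul_mem' := by
    rintro _ _ ⟨s, p, hp, q, hq, hq0, rfl⟩ ⟨t, p', hp', q', hq', hq0', rfl⟩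
    refine ⟨s + t, p * p', mul_mem_productSpan_pow ℓ hp hp', q * q',
      mul_mem_productSpan_pow ℓ hq hq', mul_ne_zero hq0 hq0', ?_⟩
    rw [map_mul, map_mul, div_mul_div_comm]
  add_mem' := by
    rintro _ _ ⟨s, p, hp, q, hq, hq0, rfl⟩ ⟨t, p', hp', q', hq', hq0', rfl⟩
    refine ⟨s + t, p * q' + q * p', add_mem (mul_mem_productSpan_pow ℓ hp hq')
      (mul_mem_productSpan_pow ℓ hq hp'), q * q',
      mul_mem_productSpan_pow ℓ hq hq', mul_ne_zero hq0 hq0', ?_⟩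
    have h1 := (map_ne_zero_iff _ (IsFractionRing.injective (MvPolynomial (FactorIndex ℓ) ℂ)
      (FractionRing (MvPolynomial (FactorIndex ℓ) ℂ)))).2 hq0
    have h2 := (map_ne_zero_iff _ (IsFractionRing.injective (MvPolynomial (FactorIndex ℓ) ℂ)
      (FractionRing (MvPolynomial (FactorIndex ℓ) ℂ)))).2 hq0'
    rw [map_add, map_mul, map_mul, map_mul, div_add_div _ _ h1 h2]
  neg_mem' := by
    rintro _ ⟨s, p, hp, q, hq, hq0, rfl⟩
    exact ⟨s, -p, neg_mem hp, q, hq, hq0, by rw [map_neg]; exact (neg_div _ _).symm⟩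
  inv_mem' := by
    rintro _ ⟨s, p, hp, q, hq, hq0, rfl⟩
    by_cases hp0 : p = 0
    · exact ⟨0, 0, Submodule.zero_mem _, 1, one_mem_productSpan_pow ℓ, one_ne_zero, by simp [hp0]⟩
    · exact ⟨s, q, hq, p, hp, hp0, by rw [inv_div]⟩

/-- The coefficients of `∏ fᵢ ^ i` as a polynomial in one variable. -/
theorem coeff_productForm_mem (k : ℕ) :
    (productForm ℓ (fun j => Polynomial.C (X j : MvPolynomial (FactorIndex ℓ) ℂ)) 1
      Polynomial.X).coeff k ∈ productSpan ℓ := by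
  refine (Submodule.span_le (p := productSpan ℓ)).2 ?_ (polynomial_coeff_mem_span_eval _ k)
  rintro _ ⟨t, rfl⟩
  refine Submodule.subset_span ⟨(1, t), ?_⟩
  change genericProduct ℓ 1 t = Polynomial.eval _ _
  rw [← Polynomial.coe_evalRingHom, map_productForm]
  simp [genericProduct, MvPolynomial.algebraMap_eq]

/-- The generic binary forms `fᵢ` are separable and pairwise coprime. -/
theorem separable_generic {L : Type*} [Field L] {ψ : MvPolynomial (FactorIndex ℓ) ℂ →+* L}
    (hψ : Function.Injective ψ) :
    ((∏ i, binaryForm (fun j => Polynomial.C (X ⟨i, j⟩ : MvPolynomial (FactorIndex ℓ) ℂ)) 1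
      Polynomial.X).map ψ).Separable := by
  classical
  set f : Fin n → Polynomial (MvPolynomial (FactorIndex ℓ) ℂ) := fun i =>
    binaryForm (fun j => Polynomial.C (X ⟨i, j⟩)) 1 Polynomial.X with hf
  have hlast : ∀ i, (f i).coeff (ℓ i) = X ⟨i, Fin.last _⟩ := fun i =>
    coeff_binaryForm_one_X (fun j => (X ⟨i, j⟩ : MvPolynomial (FactorIndex ℓ) ℂ)) (Fin.last _)
  have hdeg : ∀ i, (f i).natDegree = ℓ i := fun i =>
    le_antisymm (natDegree_binaryForm_one_X_le _)
      (Polynomial.le_natDegree_of_ne_zero (by rw [hlast]; exact X_ne_zero _))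
  -- specialize to a product of distinct linear factors
  set e := Fintype.equivFin (Σ i : Fin n, Fin (ℓ i)) with he
  set r : (Σ i : Fin n, Fin (ℓ i)) → ℂ := fun x => ((e x : ℕ) : ℂ) with hr
  have hrinj : Function.Injective r := fun x y hxy => by
    have : ((e x : ℕ) : ℂ) = ((e y : ℕ) : ℂ) := hxy
    exact e.injective (Fin.ext (by exact_mod_cast this))
  set g : Fin n → Polynomial ℂ := fun i => ∏ j, (Polynomial.X - Polynomial.C (r ⟨i, j⟩)) with hg
  have hgm : ∀ i, (g i).Monic := fun i => Polynomial.monic_prod_of_monic _ _ fun j _ =>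
    Polynomial.monic_X_sub_C _
  have hgdeg : ∀ i, (g i).natDegree = ℓ i := by
    intro i
    rw [hg, Polynomial.natDegree_prod_of_monic _ _ fun j _ => Polynomial.monic_X_sub_C _]
    simp
  set φ : MvPolynomial (FactorIndex ℓ) ℂ →+* ℂ := eval fun k => (g k.1).coeff (k.2 : ℕ) with hφ
  have hφf : ∀ i, (f i).map φ = g i := by
    intro i
    rw [hf, ← Polynomial.coe_mapRingHom, map_binaryForm]
    conv_rhs => rw [← binaryForm_coeff (hgdeg i).le]
    simp [hφ]
  have hne : φ (∏ i, f i).leadingCoeff ≠ 0 := by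
    rw [Polynomial.leadingCoeff_prod, map_prod]
    refine Finset.prod_ne_zero_iff.2 fun i _ => ?_
    rw [Polynomial.leadingCoeff, hdeg, hlast, hφ, eval_X]
    have h1 := (hgm i).coeff_natDegree
    rw [hgdeg] at h1
    simp [h1]
  refine separable_map_of_separable_map φ hψ hne ?_
  rw [Polynomial.map_prod]
  have h1 : ∏ i, (f i).map φ = ∏ x, (Polynomial.X - Polynomial.C (r x)) := by
      rw [Fintype.prod_sigma]
      exact Finset.prod_congr rfl fun i _ => hφf i
  change (∏ i, (f i).map φ).Separable
  rw [h1]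
  exact Polynomial.separable_prod_X_sub_C_iff.2 hrinj

/-- The factors of `∏ fᵢ ^ i` can be recovered rationally from the product. -/
theorem div_mem_imageFunctionField (k : FactorIndex ℓ) :
    (algebraMap (MvPolynomial (FactorIndex ℓ) ℂ)
        (FractionRing (MvPolynomial (FactorIndex ℓ) ℂ)) (X k)) /
      algebraMap (MvPolynomial (FactorIndex ℓ) ℂ) _ (X ⟨k.1, Fin.last _⟩) ∈ imageFunctionField ℓ := by
  set Q := MvPolynomial (FactorIndex ℓ) ℂ
  set L := FractionRing Q
  set ψ : Q →+* L := algebraMap Q L with hψ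
  have hinj : Function.Injective ψ := IsFractionRing.injective Q L
  set f : Fin n → Polynomial Q := fun i =>
    binaryForm (fun j => Polynomial.C (X ⟨i, j⟩)) 1 Polynomial.X with hf
  set u : Fin n → L := fun i => ψ (X ⟨i, Fin.last _⟩) with hu
  have hu0 : ∀ i, u i ≠ 0 := fun i => (map_ne_zero_iff ψ hinj).2 (X_ne_zero _)
  set g : Fin n → Polynomial L := fun i => Polynomial.C (u i)⁻¹ * (f i).map ψ with hg
  have hgcoeff : ∀ i (j : Fin (ℓ i + 1)), (g i).coeff j = ψ (X ⟨i, j⟩) / u i := by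
    intro i j
    have : (f i).coeff j = X ⟨i, j⟩ :=
      coeff_binaryForm_one_X (fun j => (X ⟨i, j⟩ : Q)) j
    rw [hg, Polynomial.coeff_C_mul, Polynomial.coeff_map, this, div_eq_inv_mul]
  have hgdeg : ∀ i, (g i).natDegree ≤ ℓ i := fun i =>
    (Polynomial.natDegree_C_mul_le _ _).trans ((Polynomial.natDegree_map_le).trans
      (natDegree_binaryForm_one_X_le _))
  have hgm : ∀ i, (g i).Monic := fun i => by
    refine Polynomial.monic_of_natDegree_le_of_coeff_eq_one (ℓ i) (hgdeg i) ?_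
    have := hgcoeff i (Fin.last _)
    rw [Fin.val_last] at this
    rw [this]
    exact div_self (hu0 i)
  have hsep : (∏ i, g i).Separable := by
    refine (separable_generic ℓ hinj).of_dvd ?_
    rw [hg, Finset.prod_mul_distrib, Polynomial.map_prod, ← map_prod]
    refine (IsUnit.mul_left_dvd ?_).2 dvd_rfl
    exact Polynomial.isUnit_C.2 (Finset.prod_ne_zero_iff.2 fun i _ => inv_ne_zero (hu0 i)).isUnit
  have hlead : ∏ i, (u i) ^ ((i : ℕ) + 1) = ψ (genericProduct ℓ 0 1) := by
    rw [genericProduct, C_0, C_1, productForm_zero_one, map_prod]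
    exact Finset.prod_congr rfl fun i _ => by rw [map_pow]
  have hprod : ∏ i, g i ^ ((i : ℕ) + 1) = Polynomial.C (ψ (genericProduct ℓ 0 1))⁻¹ *
      (productForm ℓ (fun j => Polynomial.C (X j : Q)) 1 Polynomial.X).map ψ := by
    rw [← hlead, productForm, Polynomial.map_prod, ← Finset.prod_inv_distrib, map_prod,
      ← Finset.prod_mul_distrib]
    refine Finset.prod_congr rfl fun i _ => ?_
    rw [hg, mul_pow, Polynomial.map_pow, ← map_pow, inv_pow]
  have hg0 : genericProduct ℓ 0 1 ≠ 0 := by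
    rw [genericProduct, C_0, C_1, productForm_zero_one]
    exact Finset.prod_ne_zero_iff.2 fun i _ => pow_ne_zero _ (X_ne_zero _)
  obtain ⟨P, hP⟩ : ∏ i, g i ^ ((i : ℕ) + 1) ∈ Polynomial.lifts (imageFunctionField ℓ).subtype := by
    rw [Polynomial.lifts_iff_coeff_lifts]
    intro k
    rw [hprod, Polynomial.coeff_C_mul, Polynomial.coeff_map, ← div_eq_inv_mul]
    refine ⟨⟨_, 1, _, ?_, _, ?_, hg0, rfl⟩, rfl⟩
    · rw [pow_one]; exact coeff_productForm_mem ℓ k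
    · rw [pow_one]; exact genericProduct_mem ℓ 0 1
  obtain ⟨G, hG⟩ := exists_map_eq_of_map_eq_prod_pow (imageFunctionField ℓ).subtype g P hgm hsep
    hP k.1
  have h1 := hgcoeff k.1 k.2
  rw [← hG, Polynomial.coeff_map] at h1
  rw [← h1]
  exact (G.coeff k.2).2

/-- Each form of multidegree `m (1, …, n)` becomes a polynomial in the coefficients of `∏ fᵢ ^ i`
after multiplication by such a polynomial. -/
theorem exists_mul_monomial_mem (m : ℕ) {α : FactorIndex ℓ →₀ ℕ}
    (hα : Finsupp.weight (groupWeight Sigma.fst) α = m • multVector n) :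
    ∃ t, ∃ q ∈ productSpan ℓ ^ t, q ≠ 0 ∧ q * monomial α 1 ∈ productSpan ℓ ^ (t + m) := by
  set Q := MvPolynomial (FactorIndex ℓ) ℂ
  set L := FractionRing Q
  set ψ : Q →+* L := algebraMap Q L with hψ
  have hinj : Function.Injective ψ := IsFractionRing.injective Q L
  have h1 : ∏ k : FactorIndex ℓ, (ψ (X k) / ψ (X ⟨k.1, Fin.last _⟩)) ^ α k ∈
      imageFunctionField ℓ :=
    prod_mem fun k _ => pow_mem (div_mem_imageFunctionField ℓ k) _
  obtain ⟨t, p, hp, q, hq, hq0, heq⟩ := h1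
  have hmon : ψ (monomial α 1) = ∏ k : FactorIndex ℓ, ψ (X k) ^ α k := by
    rw [monomial_eq, C_1, one_mul, Finsupp.prod_fintype _ _ (fun _ => pow_zero _), map_prod]
    simp
  have hden : ∏ k : FactorIndex ℓ, ψ (X ⟨k.1, Fin.last _⟩) ^ α k =
      ψ (genericProduct ℓ 0 1 ^ m) := by
    rw [genericProduct, C_0, C_1, productForm_zero_one, ← Finset.prod_pow, map_prod,
      Fintype.prod_sigma]
    refine Finset.prod_congr rfl fun i _ => ?_
    rw [← pow_mul, map_pow]
    refine (Finset.prod_pow_eq_pow_sum _ (fun j => α ⟨i, j⟩) (ψ (X ⟨i, Fin.last _⟩))).trans ?_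
    congr 1
    have := congrFun hα i
    rw [Finsupp.weight_eq_sum, Finset.sum_apply, Fintype.sum_sigma, Finset.sum_eq_single i] at this
    · simpa [groupWeight, multVector, mul_comm] using this
    · intro i' _ hi'
      exact Finset.sum_eq_zero fun j _ => by simp [groupWeight, Ne.symm hi']
    · simp
  refine ⟨t, q, hq, hq0, ?_⟩
  have hψq : ψ q ≠ 0 := (map_ne_zero_iff ψ hinj).2 hq0
  have hden0 : ∏ k : FactorIndex ℓ, ψ (X ⟨k.1, Fin.last _⟩) ^ α k ≠ 0 :=
    Finset.prod_ne_zero_iff.2 fun k _ => pow_ne_zero _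
      ((map_ne_zero_iff ψ hinj).2 (X_ne_zero _))
  have h2 : q * monomial α 1 = p * genericProduct ℓ 0 1 ^ m := by
    apply hinj
    simp_rw [div_pow] at heq
    rw [Finset.prod_div_distrib, div_eq_div_iff hden0 hψq, ← hmon, hden] at heq
    rw [map_mul, map_mul, mul_comm]
    exact heq
  rw [h2]
  exact mul_mem_productSpan_pow ℓ hp (Submodule.pow_mem_pow _ (genericProduct_mem ℓ 0 1) m)

/-- A common denominator for all forms of multidegree `m (1, …, n)`. -/
theorem exists_mul_multiForms_le (m : ℕ) :
    ∃ t, ∃ q ∈ productSpan ℓ ^ t, q ≠ 0 ∧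
      ∀ f ∈ multiForms Sigma.fst (m • multVector n), q * f ∈ productSpan ℓ ^ (t + m) := by
  classical
  have key : ∀ S : Finset (FactorIndex ℓ →₀ ℕ),
      (∀ α ∈ S, Finsupp.weight (groupWeight Sigma.fst) α = m • multVector n) →
      ∃ t, ∃ q ∈ productSpan ℓ ^ t, q ≠ 0 ∧
        ∀ α ∈ S, q * monomial α 1 ∈ productSpan ℓ ^ (t + m) := by
    intro S
    induction S using Finset.induction_on with
    | empty => exact fun _ => ⟨0, 1, one_mem_productSpan_pow ℓ, one_ne_zero, by simp⟩
    | insert α S hα ih =>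
      intro h
      obtain ⟨t, q, hq, hq0, hqS⟩ := ih fun β hβ => h β (Finset.mem_insert_of_mem hβ)
      obtain ⟨t', q', hq', hq0', hqα⟩ := exists_mul_monomial_mem ℓ m
        (h α (Finset.mem_insert_self _ _))
      refine ⟨t + t', q * q', mul_mem_productSpan_pow ℓ hq hq', mul_ne_zero hq0 hq0', ?_⟩
      intro β hβ
      rcases Finset.mem_insert.1 hβ with rfl | hβ
      · rw [mul_assoc, add_assoc]
        exact mul_mem_productSpan_pow ℓ hq hqα
      · rw [mul_comm q, mul_assoc, add_comm t, add_assoc]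
        exact mul_mem_productSpan_pow ℓ hq' (hqS β hβ)
  have hfin : {α : FactorIndex ℓ →₀ ℕ |
      Finsupp.weight (groupWeight Sigma.fst) α = m • multVector n}.Finite := by
    refine (Finsupp.finite_of_degree_le (∑ i, (m • multVector n) i)).subset fun α hα => ?_
    have hα' : Finsupp.weight (groupWeight Sigma.fst) α = m • multVector n := hα
    exact (degree_eq_sum_weight Sigma.fst α).le.trans (by rw [hα'])
  obtain ⟨t, q, hq, hq0, h⟩ := key hfin.toFinset fun α hα => hfin.mem_toFinset.1 hα
  refine ⟨t, q, hq, hq0, fun f hf => ?_⟩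
  rw [f.as_sum, Finset.mul_sum]
  refine Submodule.sum_mem _ fun α hα => ?_
  have h1 : monomial α (coeff α f) = coeff α f • monomial α 1 := by
    rw [smul_monomial, smul_eq_mul, mul_one]
  rw [h1, mul_smul_comm]
  exact Submodule.smul_mem _ _ (h α (hfin.mem_toFinset.2 (hf (mem_support_iff.1 hα))))

/-- Up to a shift, the coordinate ring of the image is as large as that of the product of
projective spaces that parametrizes it. -/
theorem exists_finrank_multiForms_le :
    ∃ c : ℕ, ∀ s : ℕ, Module.finrank ℂ (multiForms (Sigma.fst : FactorIndex ℓ → Fin n)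
        (s • multVector n)) ≤ Module.finrank ℂ ↥(productSpan ℓ ^ (s + c)) := by
  obtain ⟨m, hm⟩ := exists_multiForms_le_mul ℓ
  obtain ⟨t, q, hq, hq0, hqf⟩ := exists_mul_multiForms_le ℓ m
  have hfd : ∀ s, FiniteDimensional ℂ ↥(productSpan ℓ ^ s) := fun s =>
    Submodule.finiteDimensional_of_le (productSpan_pow_le ℓ s)
  have hg0 : genericProduct ℓ 0 1 ≠ 0 := by
    rw [genericProduct, C_0, C_1, productForm_zero_one]
    exact Finset.prod_ne_zero_iff.2 fun i _ => pow_ne_zero _ (X_ne_zero _)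
  refine ⟨m + t, fun s => ?_⟩
  set μ := LinearMap.mulLeft ℂ (q * genericProduct ℓ 0 1 ^ m) with hμ
  have hinj : Function.Injective μ := fun a b hab =>
    mul_left_cancel₀ (mul_ne_zero hq0 (pow_ne_zero _ hg0)) hab
  rw [(Submodule.equivMapOfInjective μ hinj _).finrank_eq]
  refine Submodule.finrank_mono ?_
  rintro _ ⟨f, hf, rfl⟩
  have h1 : genericProduct ℓ 0 1 ^ m * f ∈ multiForms Sigma.fst ((s + m) • multVector n) := by
    rw [add_comm, add_smul]
    exact ((isWeightedHomogeneous_genericProduct ℓ 0 1).pow m).mul hf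
  have h2 : ∀ g ∈ productSpan ℓ ^ s * multiForms Sigma.fst (m • multVector n),
      q * g ∈ productSpan ℓ ^ (s + (m + t)) := by
    intro g hg
    induction hg using Submodule.mul_induction_on' with
    | mem_mul_mem a ha b hb =>
      rw [mul_left_comm, add_comm m t]
      exact mul_mem_productSpan_pow ℓ ha (hqf b hb)
    | add a _ b _ ha hb => rw [mul_add]; exact add_mem ha hb
  rw [hμ, LinearMap.mulLeft_apply, mul_assoc]
  exact h2 _ (hm s h1)

end Birational

/-! ### Dimensions of multihomogeneous parts and of cones -/

section Dimensions

open MvPolynomial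

/-- The monomials of given multidegree are the tuples of monomials in the groups of variables. -/
theorem finrank_multiForms {n : ℕ} (ℓ : Fin n → ℕ) (ε : Fin n → ℕ) :
    Module.finrank ℂ (multiForms (Sigma.fst : FactorIndex ℓ → Fin n) ε) =
      ∏ i, Nat.multichoose (ℓ i + 1) (ε i) := by
  classical
  rw [multiForms, weightedHomogeneousSubmodule_eq_finsupp_supported]
  refine (Module.finrank_eq_nat_card_basis (basisRestrictSupport ℂ
    {α : FactorIndex ℓ →₀ ℕ | Finsupp.weight (groupWeight Sigma.fst) α = ε})).trans ?_
  have e : {α : FactorIndex ℓ →₀ ℕ | Finsupp.weight (groupWeight Sigma.fst) α = ε} ≃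
      Fintype.piFinset fun i : Fin n =>
        Finset.finsuppAntidiag (Finset.univ : Finset (Fin (ℓ i + 1))) (ε i) := by
    refine Equiv.subtypeEquiv Finsupp.sigmaFinsuppEquivPiFinsupp fun α => ?_
    rw [Fintype.mem_piFinset, Set.mem_ofPred_eq, funext_iff]
    refine forall_congr' fun i => ?_
    rw [Finset.mem_finsuppAntidiag, and_iff_left (Finset.subset_univ _), Finsupp.weight_eq_sum,
      Finset.sum_apply, Fintype.sum_sigma, Finset.sum_eq_single i]
    · simp only [groupWeight, Pi.smul_apply, Pi.single_eq_same, smul_eq_mul, mul_one]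
      rfl
    · intro i' _ hi'
      exact Finset.sum_eq_zero fun j _ => by simp [groupWeight, Ne.symm hi']
    · simp
  rw [Nat.card_congr e, Nat.card_eq_fintype_card, Fintype.card_coe, Fintype.card_piFinset]
  refine Finset.prod_congr rfl fun i _ => ?_
  rw [Finset.card_finsuppAntidiag_nat_eq_multichoose, Finset.card_univ, Fintype.card_fin]

variable {Q : Type} [CommRing Q] [Algebra ℂ Q] {κ : Type}

/-- The part of degree `t` of the coordinate ring of a cone: `B s` is the part of degree `s` of the
coordinate ring of the base, which is put in degree `s` by means of the variable `X none`, and the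
variables `X (some k)` are the coordinates along the vertex. -/
def conePart (B : ℕ → Submodule ℂ Q) (t : ℕ) : Submodule ℂ (MvPolynomial (Option κ) Q) :=
  Submodule.span ℂ {f | ∃ β : Option κ →₀ ℕ, β.degree = t ∧ ∃ x ∈ B (β none), monomial β x = f}

theorem finrank_conePart_eq_sum [Fintype κ] [DecidableEq κ] (B : ℕ → Submodule ℂ Q)
    [∀ s, FiniteDimensional ℂ (B s)] (t : ℕ) :
    Module.finrank ℂ (conePart (κ := κ) B t) =
      ∑ β ∈ Finset.finsuppAntidiag (Finset.univ : Finset (Option κ)) t,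
        Module.finrank ℂ (B (β none)) := by
  set T := Finset.finsuppAntidiag (Finset.univ : Finset (Option κ)) t with hT
  have hmemT : ∀ β : Option κ →₀ ℕ, β ∈ T ↔ β.degree = t := by
    intro β
    rw [hT, Finset.mem_finsuppAntidiag, and_iff_left (Finset.subset_univ _),
      Finsupp.degree_eq_sum]
  let mon : (β : T) → Q →ₗ[ℂ] MvPolynomial (Option κ) Q := fun β =>
    (monomial (R := Q) β.1).restrictScalars ℂ
  let Λ : ((β : T) → B (β.1 none)) →ₗ[ℂ] MvPolynomial (Option κ) Q :=
    ∑ β : T, (mon β).comp ((B (β.1 none)).subtype.comp (LinearMap.proj β))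
  have hΛ : ∀ x, Λ x = ∑ β : T, monomial β.1 (x β : Q) := by
    intro x
    simp [Λ, mon]
  have hinj : Function.Injective Λ := by
    rw [← LinearMap.ker_eq_bot, LinearMap.ker_eq_bot']
    intro x hx
    funext β
    have h1 : coeff β.1 (Λ x) = (x β : Q) := by
      rw [hΛ, coeff_sum, Finset.sum_eq_single β]
      · rw [coeff_monomial, if_pos rfl]
      · intro γ _ hγ
        rw [coeff_monomial, if_neg fun h => hγ (Subtype.ext h)]
      · simp
    rw [hx, coeff_zero] at h1
    exact Subtype.ext h1.symm
  have hrange : LinearMap.range Λ = conePart B t := by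
    apply le_antisymm
    · rintro _ ⟨x, rfl⟩
      rw [hΛ]
      exact Submodule.sum_mem _ fun β _ =>
        Submodule.subset_span ⟨β.1, (hmemT _).1 β.2, x β, (x β).2, rfl⟩
    · rw [conePart, Submodule.span_le]
      rintro _ ⟨β, hβ, x, hx, rfl⟩
      refine ⟨Pi.single ⟨β, (hmemT β).2 hβ⟩ ⟨x, hx⟩, ?_⟩
      rw [hΛ, Finset.sum_eq_single ⟨β, (hmemT β).2 hβ⟩]
      · simp
      · intro γ _ hγ
        simp [hγ]
      · simp
  rw [← hrange, LinearMap.finrank_range_of_inj hinj, Module.finrank_pi_fintype,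
    ← Finset.sum_coe_sort T (fun β => Module.finrank ℂ (B (β none)))]

theorem sum_finsuppAntidiag_option [Fintype κ] [DecidableEq κ] (a : ℕ → ℕ) (t : ℕ) :
    ∑ β ∈ Finset.finsuppAntidiag (Finset.univ : Finset (Option κ)) t, a (β none) =
      ∑ x ∈ Finset.HasAntidiagonal.antidiagonal t,
        a x.1 * Nat.multichoose (Fintype.card κ) x.2 := by
  have h : ∀ x : ℕ × ℕ, a x.1 * Nat.multichoose (Fintype.card κ) x.2 =
      ∑ _γ ∈ Finset.finsuppAntidiag (Finset.univ : Finset κ) x.2, a x.1 := by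
    intro x
    rw [Finset.sum_const, Finset.card_finsuppAntidiag_nat_eq_multichoose, Finset.card_univ,
      smul_eq_mul, mul_comm]
  simp_rw [h]
  rw [Finset.sum_sigma']
  refine Finset.sum_bij'
    (fun β _ => (⟨(β none, ∑ k, β (some k)), β.some⟩ : Σ _ : ℕ × ℕ, κ →₀ ℕ))
    (fun y _ => y.2.optionElim y.1.1) ?_ ?_ ?_ ?_ ?_
  · intro β hβ
    have h1 : β none + ∑ k, β (some k) = t := by simpa [Fintype.sum_option] using hβ
    simp only [Finset.mem_sigma, Finset.HasAntidiagonal.mem_antidiagonal,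
      Finset.mem_finsuppAntidiag, Finset.subset_univ, and_true]
    exact ⟨h1, rfl⟩
  · rintro ⟨⟨i, j⟩, γ⟩ hy
    simp only [Finset.mem_sigma, Finset.HasAntidiagonal.mem_antidiagonal, Finset.mem_finsuppAntidiag,
      Finset.subset_univ, and_true] at hy
    simp [Fintype.sum_option, hy.2, hy.1]
  · intro β _
    ext o
    cases o <;> simp
  · rintro ⟨⟨i, j⟩, γ⟩ hy
    simp only [Finset.mem_sigma, Finset.HasAntidiagonal.mem_antidiagonal, Finset.mem_finsuppAntidiag,
      Finset.subset_univ, and_true] at hy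
    simp [hy.2]
  · intro β _
    rfl

theorem finrank_conePart [Fintype κ] (B : ℕ → Submodule ℂ Q)
    [∀ s, FiniteDimensional ℂ (B s)] (t : ℕ) :
    Module.finrank ℂ (conePart (κ := κ) B t) =
      ∑ x ∈ Finset.HasAntidiagonal.antidiagonal t,
        Module.finrank ℂ (B x.1) * Nat.multichoose (Fintype.card κ) x.2 := by
  classical
  rw [finrank_conePart_eq_sum, sum_finsuppAntidiag_option (fun s => Module.finrank ℂ (B s))]

/-- The coordinate ring of a cone is generated in degree one if that of the base is. -/
theorem conePart_one_pow (P : Submodule ℂ Q) (t : ℕ) :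
    conePart (κ := κ) (fun s => P ^ s) 1 ^ t = conePart (fun s => P ^ s) t := by
  classical
  induction t with
  | zero =>
    rw [pow_zero]
    apply le_antisymm
    · rw [Submodule.one_le]
      exact Submodule.subset_span ⟨0, by simp, 1,
        by rw [Finsupp.zero_apply]; exact Submodule.one_le.1 (pow_zero P).ge, rfl⟩
    · rw [conePart, Submodule.span_le]
      rintro _ ⟨β, hβ, x, hx, rfl⟩
      have hβ0 : β = 0 := (Finsupp.degree_eq_zero_iff β).1 hβ
      subst hβ0
      rw [Finsupp.zero_apply, pow_zero, Submodule.mem_one] at hx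
      obtain ⟨c, rfl⟩ := hx
      exact Submodule.mem_one.2 ⟨c, rfl⟩
  | succ t ih =>
    rw [pow_succ, ih]
    apply le_antisymm
    · rw [conePart, conePart, Submodule.span_mul_span, Submodule.span_le]
      rintro _ ⟨_, ⟨β, hβ, x, hx, rfl⟩, _, ⟨γ, hγ, y, hy, rfl⟩, rfl⟩
      refine Submodule.subset_span ⟨β + γ, by rw [map_add, hβ, hγ], x * y, ?_, ?_⟩
      · rw [Finsupp.add_apply]
        exact (pow_add P _ _).ge (Submodule.mul_mem_mul hx hy)
      · exact monomial_mul.symm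
    · rw [conePart, Submodule.span_le]
      rintro _ ⟨β, hβ, x, hx, rfl⟩
      have hsub : ∀ o, β o ≠ 0 → (β - Finsupp.single o 1) + Finsupp.single o 1 = β := fun o ho =>
        tsub_add_cancel_of_le (Finsupp.single_le_iff.2 (Nat.one_le_iff_ne_zero.2 ho))
      have hdeg : ∀ o, β o ≠ 0 → (β - Finsupp.single o 1).degree = t := by
        intro o ho
        have := congrArg Finsupp.degree (hsub o ho)
        rw [map_add, hβ, Finsupp.degree_single] at this
        omega
      by_cases h0 : β none = 0
      · obtain ⟨o, ho⟩ : ∃ o, β o ≠ 0 := by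
          by_contra! hall
          have : β = 0 := Finsupp.ext hall
          rw [this, map_zero] at hβ
          omega
        have hon : none ≠ o := by
          rintro rfl
          exact ho h0
        have h1 : monomial β x = monomial (β - Finsupp.single o 1) x *
            monomial (Finsupp.single o 1) 1 := by
          rw [monomial_mul, hsub o ho, mul_one]
        rw [h1]
        refine Submodule.mul_mem_mul (Submodule.subset_span ⟨_, hdeg o ho, x, ?_, rfl⟩)
          (Submodule.subset_span ⟨_, Finsupp.degree_single _ _, 1, ?_, rfl⟩)
        · rwa [Finsupp.tsub_apply, Finsupp.single_eq_of_ne hon, tsub_zero]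
        · rw [Finsupp.single_eq_of_ne hon]
          exact Submodule.one_le.1 (pow_zero P).ge
      · obtain ⟨s, hs⟩ := Nat.exists_eq_succ_of_ne_zero h0
        rw [hs, Nat.succ_eq_add_one, pow_succ] at hx
        induction hx using Submodule.mul_induction_on' with
        | mem_mul_mem a ha b hb =>
          have h1 : monomial β (a * b) = monomial (β - Finsupp.single none 1) a *
              monomial (Finsupp.single none 1) b := by
            rw [monomial_mul, hsub none h0]
          rw [h1]
          refine Submodule.mul_mem_mul (Submodule.subset_span ⟨_, hdeg none h0, a, ?_, rfl⟩)
            (Submodule.subset_span ⟨_, Finsupp.degree_single _ _, b, ?_, rfl⟩)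
          · rwa [Finsupp.tsub_apply, Finsupp.single_eq_same, hs]
          · rw [Finsupp.single_eq_same]
            exact (pow_one P).ge hb
        | add a _ b _ ha hb => rw [map_add]; exact add_mem ha hb

end Dimensions

section HilbertFunction

open MvPolynomial

/-- The Hilbert function of a set parametrized by polynomials `Φ`. -/
theorem hilbertFunction_eq_finrank_span_pow {ι : Type} {S : Type} [CommRing S]
    [Algebra ℂ S] (X : Set (ℙ ℂ (ι → ℂ))) (Φ : ι → S) (t : ℕ)
    (h : ∀ F : MvPolynomial ι ℂ, F.IsHomogeneous t →
      ((∀ x ∈ X, eval x.rep F = 0) ↔ aeval Φ F = 0)) :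
    hilbertFunction X t = Module.finrank ℂ ↥(Submodule.span ℂ (Set.range Φ) ^ t) := by
  set E := (aeval Φ : MvPolynomial ι ℂ →ₐ[ℂ] S).toLinearMap.domRestrict
    (homogeneousSubmodule ι ℂ t) with hE
  have hker : LinearMap.ker E = vanishingForms X t := by
    ext ⟨F, hF⟩
    exact (h F hF).symm
  have hrange : LinearMap.range E = Submodule.span ℂ (Set.range Φ) ^ t := by
    rw [hE, LinearMap.range_domRestrict, ← homogeneousSubmodule_one_pow, Submodule.map_pow,
      homogeneousSubmodule_one_eq_span_X, Submodule.map_span, ← Set.range_comp]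
    congr 3
    funext i
    simp
  rw [hilbertFunction, ← hker, (LinearMap.quotKerEquivRange E).finrank_eq, hrange]

theorem vanishingForms_zariskiClosure {ι : Type} (X : Set (ℙ ℂ (ι → ℂ))) (t : ℕ) :
    vanishingForms (zariskiClosure X) t = vanishingForms X t := by
  let _ := zariskiTopology ι
  ext ⟨F, hF⟩
  refine ⟨fun h x hx => h x (subset_closure hx), fun h => ?_⟩
  have hclosed : IsClosed {x : ℙ ℂ (ι → ℂ) | eval x.rep F = 0} := by
    rw [← isOpen_compl_iff]
    exact TopologicalSpace.isOpen_generateFrom_of_mem ⟨t, F, hF, rfl⟩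
  exact fun x hx => closure_minimal (fun y hy => h y hy) hclosed hx

/-- Forms vanish on a set if and only if they vanish on its closure. -/
theorem hilbertFunction_zariskiClosure {ι : Type} (X : Set (ℙ ℂ (ι → ℂ))) (t : ℕ) :
    hilbertFunction (zariskiClosure X) t = hilbertFunction X t := by
  rw [hilbertFunction, hilbertFunction, vanishingForms_zariskiClosure]

end HilbertFunction

/-! ### Binary forms and their linear factors -/

section LinearFactors

open MvPolynomial

theorem eval_smul_of_isHomogeneous {σ : Type*} {F : MvPolynomial σ ℂ} {t : ℕ}
    (hF : F.IsHomogeneous t) (c : ℂ) (x : σ → ℂ) : eval (c • x) F = c ^ t * eval x F := by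
  rw [eval_eq, eval_eq, Finset.mul_sum]
  refine Finset.sum_congr rfl fun α hα => ?_
  have h1 := hF.degree_eq_sum_deg_support hα
  simp only [Pi.smul_apply, smul_eq_mul, mul_pow, Finset.prod_mul_distrib]
  rw [Finset.prod_pow_eq_pow_sum, ← h1]
  ring

/-- Binary forms of equal degree are determined by their dehomogenizations. -/
theorem eq_of_eval_one_eq {l : ℕ} {F G : MvPolynomial (Fin 2) ℂ} (hF : F.IsHomogeneous l)
    (hG : G.IsHomogeneous l) (h : ∀ t : ℂ, eval ![1, t] F = eval ![1, t] G) : F = G := by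
  have h1 : X 0 * (F - G) = 0 := by
    refine funext fun s => ?_
    rw [map_mul, eval_X, map_zero]
    by_cases hs : s 0 = 0
    · rw [hs, zero_mul]
    · have h2 : s = s 0 • ![1, s 1 / s 0] := by
        ext i
        fin_cases i
        · simp
        · simp [mul_div_cancel₀ _ hs]
      rw [h2, eval_smul_of_isHomogeneous (hF.sub hG), map_sub, h, sub_self, mul_zero, mul_zero]
  exact sub_eq_zero.1 ((mul_eq_zero.1 h1).resolve_left (X_ne_zero _))

theorem isHomogeneous_binaryForm {σ R : Type*} [CommRing R] {l : ℕ} (c : Fin (l + 1) → R)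
    {x y : MvPolynomial σ R} (hx : x.IsHomogeneous 1) (hy : y.IsHomogeneous 1) :
    (binaryForm (fun j => C (c j)) x y).IsHomogeneous l := by
  refine IsHomogeneous.sum _ _ _ fun j _ => IsHomogeneous.C_mul ?_ _
  have h1 := (hx.pow (l - j)).mul (hy.pow (j : ℕ))
  have h2 : 1 * (l - (j : ℕ)) + 1 * (j : ℕ) = l := by
    have := j.2
    omega
  rwa [h2] at h1

theorem isHomogeneous_C_mul_X_add (u v : ℂ) :
    (C u * X 0 + C v * X 1 : MvPolynomial (Fin 2) ℂ).IsHomogeneous 1 :=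
  (isHomogeneous_C_mul_X _ _).add (isHomogeneous_C_mul_X _ _)

/-- A product of linear forms is a binary form. -/
theorem exists_binaryForm_eq_prod {l : ℕ} (u v : Fin l → ℂ) :
    ∃ c : Fin (l + 1) → ℂ, ∀ x y : ℂ, binaryForm c x y = ∏ j, (u j * x + v j * y) := by
  set p : Polynomial ℂ := ∏ j, (Polynomial.C (u j) + Polynomial.C (v j) * Polynomial.X) with hp
  have hdeg : p.natDegree ≤ l := by
    refine (Polynomial.natDegree_prod_le _ _).trans ?_
    refine (Finset.sum_le_sum fun j _ => (?_ : _ ≤ 1)).trans (by simp)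
    rw [add_comm]
    exact Polynomial.natDegree_linear_le
  have key : binaryForm (fun j : Fin (l + 1) => C (p.coeff j)) (X 0) (X 1) =
      ∏ j, (C (u j) * X 0 + C (v j) * X 1 : MvPolynomial (Fin 2) ℂ) := by
    refine eq_of_eval_one_eq (isHomogeneous_binaryForm _ (isHomogeneous_X _ _)
      (isHomogeneous_X _ _)) ?_ fun t => ?_
    · have := IsHomogeneous.prod Finset.univ
        (fun j => (C (u j) * X 0 + C (v j) * X 1 : MvPolynomial (Fin 2) ℂ)) (fun _ => 1)
        fun j _ => isHomogeneous_C_mul_X_add _ _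
      simpa using this
    · have h1 := congrArg (Polynomial.eval t) (binaryForm_coeff hdeg)
      rw [← Polynomial.coe_evalRingHom, map_binaryForm] at h1
      rw [map_binaryForm, map_prod]
      simp only [Polynomial.coe_evalRingHom, Polynomial.eval_C, Polynomial.eval_one,
        Polynomial.eval_X] at h1
      simp only [eval_C, eval_X, Matrix.cons_val_zero, Matrix.cons_val_one, map_add, map_mul]
      rw [h1, hp, Polynomial.eval_prod]
      simp
  refine ⟨fun j => p.coeff j, fun x y => ?_⟩
  have h2 := congrArg (eval ![x, y]) key
  rw [map_binaryForm, map_prod] at h2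
  simpa using h2

/-- A nonzero binary form over the complex numbers is a product of linear forms. -/
theorem exists_prod_eq_binaryForm {l : ℕ} {c : Fin (l + 1) → ℂ} (hc : c ≠ 0) :
    ∃ (u v : Fin l → ℂ) (e : ℂ), (∀ j, u j ≠ 0 ∨ v j ≠ 0) ∧
      ∀ x y : ℂ, binaryForm c x y = e * ∏ j, (u j * x + v j * y) := by
  set p : Polynomial ℂ := binaryForm (fun j => Polynomial.C (c j)) 1 Polynomial.X with hp
  have hdeg : p.natDegree ≤ l := natDegree_binaryForm_one_X_le c
  have hroots : p.roots.card = p.natDegree := IsAlgClosed.card_roots_eq_natDegree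
  -- the roots at infinity contribute the linear form `x`
  set M : List (ℂ × ℂ) := p.roots.toList.map (fun r => (-r, 1)) ++
    List.replicate (l - p.natDegree) (1, 0) with hM
  have hlen : M.length = l := by
    rw [hM, List.length_append, List.length_map, Multiset.length_toList, List.length_replicate,
      hroots]
    omega
  have hMne : ∀ m ∈ M, m.1 ≠ 0 ∨ m.2 ≠ 0 := by
    intro m hm
    rw [hM, List.mem_append] at hm
    rcases hm with hm | hm
    · obtain ⟨r, _, rfl⟩ := List.mem_map.1 hm
      exact Or.inr one_ne_zero
    · rw [List.eq_of_mem_replicate hm]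
      exact Or.inl one_ne_zero
  have hprod : ∀ t : ℂ, binaryForm c 1 t =
      p.leadingCoeff * (M.map fun m => m.1 * 1 + m.2 * t).prod := by
    intro t
    have h1 : p.eval t = binaryForm c 1 t := by
      rw [hp, ← Polynomial.coe_evalRingHom, map_binaryForm]
      simp
    have h2 := congrArg (Polynomial.eval t)
      ((IsAlgClosed.splits p).eq_prod_roots)
    rw [h1, Polynomial.eval_mul, Polynomial.eval_C, Polynomial.eval_multiset_prod,
      Multiset.map_map] at h2
    rw [h2, hM, List.map_append, List.prod_append, List.map_map, List.map_replicate,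
      List.prod_replicate, ← Multiset.prod_coe, ← Multiset.map_coe, Multiset.coe_toList]
    simp only [Function.comp_def, Polynomial.eval_sub, Polynomial.eval_X, Polynomial.eval_C,
      mul_one, one_mul, zero_mul, add_zero, one_pow]
    congr 2
    refine Multiset.map_congr rfl fun r _ => ?_
    ring
  clear_value M
  subst hlen
  refine ⟨fun j => (M.get j).1, fun j => (M.get j).2, p.leadingCoeff,
    fun j => hMne _ (List.get_mem _ _), ?_⟩
  have hget : ∀ x y : ℂ, (M.map fun m => m.1 * x + m.2 * y).prod =
      ∏ j, ((M.get j).1 * x + (M.get j).2 * y) := by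
    intro x y
    conv_lhs => rw [← List.ofFn_get M, List.map_ofFn, List.prod_ofFn]
    rfl
  have key : binaryForm (fun j => C (c j)) (X 0) (X 1) = C p.leadingCoeff *
      ∏ j, (C (M.get j).1 * X 0 + C (M.get j).2 * X 1 : MvPolynomial (Fin 2) ℂ) := by
    refine eq_of_eval_one_eq (isHomogeneous_binaryForm _ (isHomogeneous_X _ _)
      (isHomogeneous_X _ _)) (IsHomogeneous.C_mul ?_ _) fun t => ?_
    · have := IsHomogeneous.prod Finset.univ
        (fun j => (C (M.get j).1 * X 0 + C (M.get j).2 * X 1 : MvPolynomial (Fin 2) ℂ))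
        (fun _ => 1) fun j _ => isHomogeneous_C_mul_X_add _ _
      simpa using this
    · have h3 := hprod t
      rw [hget] at h3
      rw [map_binaryForm, map_mul, map_prod]
      simpa using h3
  intro x y
  have h4 := congrArg (eval ![x, y]) key
  rw [map_binaryForm, map_mul, map_prod] at h4
  simpa using h4

variable {n : ℕ} (ℓ : Fin n → ℕ)

/-- The indices of the points of a divisor of type `ℓ`. -/
abbrev RootIndex : Type := Σ i : Fin n, Fin (ℓ i)

/-- The product of the linear forms `u k * x + v k * y`, with the multiplicities prescribed by the
type `ℓ`. -/
def linearProduct {R : Type*} [CommRing R] (u v : RootIndex ℓ → R) (x y : R) : R :=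
  ∏ k, (u k * x + v k * y) ^ ((k.1 : ℕ) + 1)

theorem map_linearProduct {R S : Type*} [CommRing R] [CommRing S] (φ : R →+* S)
    (u v : RootIndex ℓ → R) (x y : R) :
    φ (linearProduct ℓ u v x y) =
      linearProduct ℓ (fun k => φ (u k)) (fun k => φ (v k)) (φ x) (φ y) := by
  simp [linearProduct]

theorem sum_multiplicity_eq_weight : ∑ k : RootIndex ℓ, ((k.1 : ℕ) + 1) = weight ℓ := by
  simp [Fintype.sum_sigma, weight, mul_comm]

theorem isHomogeneous_linearProduct {σ : Type*} (u v : RootIndex ℓ → ℂ) {x y : MvPolynomial σ ℂ}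
    (hx : x.IsHomogeneous 1) (hy : y.IsHomogeneous 1) :
    (linearProduct ℓ (fun k => C (u k)) (fun k => C (v k)) x y).IsHomogeneous (weight ℓ) := by
  have := IsHomogeneous.prod Finset.univ
    (fun k : RootIndex ℓ => (C (u k) * x + C (v k) * y) ^ ((k.1 : ℕ) + 1))
    (fun k => 1 * ((k.1 : ℕ) + 1)) fun k _ => ((hx.C_mul _).add (hy.C_mul _)).pow _
  simp only [one_mul, sum_multiplicity_eq_weight] at this
  exact this

theorem linearProduct_one_X_ne_zero {u v : RootIndex ℓ → ℂ} (h : ∀ k, u k ≠ 0 ∨ v k ≠ 0)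
    {x₀ y₀ x₁ y₁ : ℂ} (hxy : x₀ * y₁ - y₀ * x₁ ≠ 0) :
    linearProduct ℓ (fun k => Polynomial.C (u k)) (fun k => Polynomial.C (v k))
      (Polynomial.C x₀ + Polynomial.X * Polynomial.C x₁)
      (Polynomial.C y₀ + Polynomial.X * Polynomial.C y₁) ≠ 0 := by
  refine Finset.prod_ne_zero_iff.2 fun k _ => pow_ne_zero _ fun h0 => ?_
  have e0 := congrArg (fun p => Polynomial.coeff p 0) h0
  have e1 := congrArg (fun p => Polynomial.coeff p 1) h0
  simp only [Polynomial.coeff_add, Polynomial.coeff_C_mul, Polynomial.coeff_C_zero,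
    Polynomial.coeff_X_mul_zero, add_zero, Polynomial.coeff_zero, Polynomial.coeff_C_succ,
    zero_add, Polynomial.coeff_X_mul] at e0 e1
  rcases h k with h | h
  · exact mul_ne_zero h hxy (by linear_combination y₁ * e0 - y₀ * e1)
  · exact mul_ne_zero h hxy (by linear_combination x₀ * e1 - x₁ * e0)

theorem rootMultiplicity_linear {u v t : ℂ} (h : u ≠ 0 ∨ v ≠ 0) :
    (Polynomial.C u + Polynomial.X * Polynomial.C v).rootMultiplicity t =
      if u + t * v = 0 then 1 else 0 := by
  by_cases hv : v = 0
  · subst hv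
    have hu : u ≠ 0 := by simpa using h
    simp [hu]
  · split_ifs with ht
    · have : (Polynomial.C u + Polynomial.X * Polynomial.C v) =
          Polynomial.C v * (Polynomial.X - Polynomial.C t) := by
        rw [eq_neg_of_add_eq_zero_left ht, mul_sub, ← Polynomial.C_mul, Polynomial.C_neg,
          mul_comm t v]
        ring
      rw [this, Polynomial.rootMultiplicity_mul, Polynomial.rootMultiplicity_C,
        Polynomial.rootMultiplicity_X_sub_C_self]
      exact mul_ne_zero (Polynomial.C_ne_zero.2 hv) (Polynomial.X_sub_C_ne_zero t)
    · refine Polynomial.rootMultiplicity_eq_zero fun h0 => ht ?_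
      rwa [Polynomial.IsRoot.def, Polynomial.eval_add, Polynomial.eval_C, Polynomial.eval_mul,
        Polynomial.eval_X, Polynomial.eval_C] at h0

/-- The multiplicities of the roots of a product of linear forms along a parametrized line. -/
theorem rootMultiplicity_linearProduct {u v : RootIndex ℓ → ℂ} (h : ∀ k, u k ≠ 0 ∨ v k ≠ 0)
    {x₀ y₀ x₁ y₁ : ℂ} (hxy : x₀ * y₁ - y₀ * x₁ ≠ 0) (t : ℂ) :
    (linearProduct ℓ (fun k => Polynomial.C (u k)) (fun k => Polynomial.C (v k))
      (Polynomial.C x₀ + Polynomial.X * Polynomial.C x₁)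
      (Polynomial.C y₀ + Polynomial.X * Polynomial.C y₁)).rootMultiplicity t =
    ∑ k, if u k * (x₀ + t * x₁) + v k * (y₀ + t * y₁) = 0 then (k.1 : ℕ) + 1 else 0 := by
  have hne := linearProduct_one_X_ne_zero ℓ h hxy
  rw [linearProduct] at hne
  rw [← Polynomial.count_roots, linearProduct, Polynomial.roots_prod _ _ hne,
    Multiset.count_bind, Finset.sum_map_val]
  refine Finset.sum_congr rfl fun k _ => ?_
  have h1 : Polynomial.C (u k) * (Polynomial.C x₀ + Polynomial.X * Polynomial.C x₁) +
      Polynomial.C (v k) * (Polynomial.C y₀ + Polynomial.X * Polynomial.C y₁) =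
      Polynomial.C (u k * x₀ + v k * y₀) + Polynomial.X * Polynomial.C (u k * x₁ + v k * y₁) := by
    simp only [Polynomial.C_add, Polynomial.C_mul]
    ring
  have h2 : u k * x₀ + v k * y₀ ≠ 0 ∨ u k * x₁ + v k * y₁ ≠ 0 := by
    by_contra! hcon
    obtain ⟨e0, e1⟩ := hcon
    rcases h k with h | h
    · exact mul_ne_zero h hxy (by linear_combination y₁ * e0 - y₀ * e1)
    · exact mul_ne_zero h hxy (by linear_combination x₀ * e1 - x₁ * e0)
  rw [h1, Polynomial.roots_pow, Multiset.count_nsmul, Polynomial.count_roots,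
    rootMultiplicity_linear h2]
  have h3 : u k * x₀ + v k * y₀ + t * (u k * x₁ + v k * y₁) =
      u k * (x₀ + t * x₁) + v k * (y₀ + t * y₁) := by ring
  rw [h3]
  split_ifs <;> simp

theorem exists_linearProduct_ne_zero {u v : RootIndex ℓ → ℂ} (h : ∀ k, u k ≠ 0 ∨ v k ≠ 0) :
    ∃ t : ℂ, linearProduct ℓ u v 1 t ≠ 0 := by
  by_contra! hall
  refine linearProduct_one_X_ne_zero ℓ h (x₀ := 1) (y₀ := 0) (x₁ := 0) (y₁ := 1) (by simp)
    (Polynomial.funext fun t => ?_)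
  rw [← Polynomial.coe_evalRingHom, map_linearProduct]
  simpa using hall t

/-- If a product of pairwise independent linear forms is also a product of linear forms indexed in
the same way, then these are pairwise independent as well: each of the distinct zeros belongs to a
factor of its own. -/
theorem pairwise_independent_of_linearProduct_eq {u v u' v' : RootIndex ℓ → ℂ} {c c' : ℂ}
    (hc' : c' ≠ 0) (h : ∀ k l, k ≠ l → u k * v l - v k * u l ≠ 0)
    (h' : ∀ k, u' k ≠ 0 ∨ v' k ≠ 0)
    (heq : ∀ x y, c * linearProduct ℓ u v x y = c' * linearProduct ℓ u' v' x y) :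
    ∀ k l, k ≠ l → u' k * v' l - v' k * u' l ≠ 0 := by
  classical
  have hzero : ∀ k, ∃ k', u' k' * (-v k) + v' k' * u k = 0 := by
    intro k
    have h1 : linearProduct ℓ u v (-v k) (u k) = 0 :=
      Finset.prod_eq_zero (Finset.mem_univ k) (by rw [pow_eq_zero_iff (Nat.succ_ne_zero _)]; ring)
    have h2 := heq (-v k) (u k)
    rw [h1, mul_zero] at h2
    have h3 := (mul_eq_zero.1 h2.symm).resolve_left hc'
    obtain ⟨k', _, hk'⟩ := Finset.prod_eq_zero_iff.1 h3
    exact ⟨k', pow_eq_zero_iff (Nat.succ_ne_zero _) |>.1 hk'⟩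
  choose σ hσ using hzero
  -- a linear form cannot vanish at two distinct points
  have hinj : Function.Injective σ := by
    intro k l hkl
    by_contra hne
    have e1 := hσ k
    have e2 := hσ l
    rw [← hkl] at e2
    have hd := h k l hne
    rcases h' (σ k) with h0 | h0
    · exact mul_ne_zero h0 hd (by linear_combination u l * e1 - u k * e2)
    · exact mul_ne_zero h0 hd (by linear_combination v l * e1 - v k * e2)
  have hsurj := Finite.surjective_of_injective hinj
  intro k' l' hne hd
  obtain ⟨k, rfl⟩ := hsurj k'
  obtain ⟨l, rfl⟩ := hsurj l'
  have hkl : k ≠ l := fun h => hne (by rw [h])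
  have e1 := hσ k
  have e2 := hσ l
  have hd0 := h k l hkl
  -- `σ l` is proportional to `σ k`, so it vanishes at the zeros of both
  rcases h' (σ k) with h0 | h0
  · have e3 : u' (σ k) * (u' (σ l) * (-v k) + v' (σ l) * u k) = 0 := by
      linear_combination u' (σ l) * e1 + u k * hd
    have e4 := (mul_eq_zero.1 e3).resolve_left h0
    rcases h' (σ l) with h0 | h0
    · exact mul_ne_zero h0 hd0 (by linear_combination u l * e4 - u k * e2)
    · exact mul_ne_zero h0 hd0 (by linear_combination v l * e4 - v k * e2)
  · have e3 : v' (σ k) * (u' (σ l) * (-v k) + v' (σ l) * u k) = 0 := by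
      linear_combination v' (σ l) * e1 + v k * hd
    have e4 := (mul_eq_zero.1 e3).resolve_left h0
    rcases h' (σ l) with h0 | h0
    · exact mul_ne_zero h0 hd0 (by linear_combination u l * e4 - u k * e2)
    · exact mul_ne_zero h0 hd0 (by linear_combination v l * e4 - v k * e2)

end LinearFactors

/-! ### The divisor cut out on a line, in coordinates -/

section LineCoordinates

open MvPolynomial

/-- The form with given coefficients, as a linear function of them. -/
def formLinear (d : ℕ) : (Exponent d → ℂ) →ₗ[ℂ] MvPolynomial (Fin 3) ℂ :=
  ∑ m : Exponent d, (monomial (m : Fin 3 →₀ ℕ)).comp (LinearMap.proj m)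

theorem formLinear_apply {d : ℕ} (a : Exponent d → ℂ) : formLinear d a = form a := by
  simp [formLinear, form]

theorem degree_exponent {d : ℕ} (m : Exponent d) : (m : Fin 3 →₀ ℕ).degree = d := by
  rw [Finsupp.degree_eq_sum]
  exact (Finset.mem_finsuppAntidiag.1 m.2).1

theorem isHomogeneous_form {d : ℕ} (a : Exponent d → ℂ) : (form a).IsHomogeneous d :=
  IsHomogeneous.sum _ _ _ fun m _ => isHomogeneous_monomial _ (degree_exponent m)

theorem eval_restrictTo (f : MvPolynomial (Fin 3) ℂ) (p q : Fin 3 → ℂ) (t : ℂ) :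
    (restrictTo f p q).eval t = eval (p + t • q) f := by
  rw [restrictTo]
  induction f using MvPolynomial.induction_on with
  | C a => simp
  | add f g hf hg => simp only [map_add, Polynomial.eval_add, hf, hg]
  | mul_X f i hf =>
    rw [map_mul, map_mul, Polynomial.eval_mul, hf, aeval_X, eval_X, Polynomial.eval_add,
      Polynomial.eval_mul, Polynomial.eval_C, Polynomial.eval_C, Polynomial.eval_X]
    rfl

/-- Coordinates adapted to a line. -/
theorem exists_basis_mem_iff {L : Submodule ℂ (Fin 3 → ℂ)} (hL : Module.finrank ℂ L = 2) :
    ∃ b : Module.Basis (Fin 3) ℂ (Fin 3 → ℂ), ∀ x, x ∈ L ↔ b.repr x 2 = 0 := by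
  let e := Module.finBasisOfFinrankEq ℂ L hL
  obtain ⟨r, hr⟩ : ∃ r, r ∉ L := by
    by_contra! h
    have : L = ⊤ := by rw [eq_top_iff]; exact fun x _ => h x
    rw [this, finrank_top] at hL
    simp at hL
  have hspan : Submodule.span ℂ (Set.range fun i => (e i : Fin 3 → ℂ)) = L := by
    have := congrArg (Submodule.map L.subtype) e.span_eq
    rw [Submodule.map_span, ← Set.range_comp, Submodule.map_top, Submodule.range_subtype] at this
    exact this
  have hli : LinearIndependent ℂ (Fin.snoc (fun i => (e i : Fin 3 → ℂ)) r : Fin 3 → Fin 3 → ℂ) := by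
    rw [linearIndependent_finSnoc]
    refine ⟨e.linearIndependent.map' L.subtype (Submodule.ker_subtype L), ?_⟩
    rwa [hspan]
  let b := basisOfLinearIndependentOfCardEqFinrank hli (by simp)
  have hb0 : b 0 = e 0 := by
    simp only [b, coe_basisOfLinearIndependentOfCardEqFinrank]; rfl
  have hb1 : b 1 = e 1 := by
    simp only [b, coe_basisOfLinearIndependentOfCardEqFinrank]; rfl
  have hb2 : b 2 = r := by
    simp only [b, coe_basisOfLinearIndependentOfCardEqFinrank]; rfl
  refine ⟨b, fun x => ?_⟩
  have hx := b.sum_repr x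
  rw [Fin.sum_univ_three, hb0, hb1, hb2] at hx
  have hmem : b.repr x 0 • (e 0 : Fin 3 → ℂ) + b.repr x 1 • (e 1 : Fin 3 → ℂ) ∈ L :=
    L.add_mem (L.smul_mem _ (e 0).2) (L.smul_mem _ (e 1).2)
  constructor
  · intro h
    by_contra h2
    rw [← hx, L.add_mem_iff_right hmem] at h
    exact hr ((L.smul_mem_iff h2).1 h)
  · intro h
    rw [← hx, h, zero_smul, add_zero]
    exact hmem

variable (b : Module.Basis (Fin 3) ℂ (Fin 3 → ℂ))

/-- The point with coordinates `(x, y)` of the line through the first two basis vectors. -/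
def linePoint (x y : ℂ) : Fin 3 → ℂ := x • b 0 + y • b 1

theorem repr_linePoint_zero (x y : ℂ) : b.repr (linePoint b x y) 0 = x := by
  simp [linePoint]

theorem repr_linePoint_one (x y : ℂ) : b.repr (linePoint b x y) 1 = y := by
  simp [linePoint]

theorem repr_linePoint_two (x y : ℂ) : b.repr (linePoint b x y) 2 = 0 := by
  simp [linePoint]

theorem linePoint_repr {x : Fin 3 → ℂ} (hx : b.repr x 2 = 0) :
    linePoint b (b.repr x 0) (b.repr x 1) = x := by
  have h := b.sum_repr x
  rwa [Fin.sum_univ_three, hx, zero_smul, add_zero] at h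

theorem linePoint_add_smul (x₀ y₀ x₁ y₁ t : ℂ) :
    linePoint b x₀ y₀ + t • linePoint b x₁ y₁ = linePoint b (x₀ + t * x₁) (y₀ + t * y₁) := by
  simp only [linePoint, add_smul, mul_smul, smul_add]
  abel

theorem smul_linePoint (c x y : ℂ) : c • linePoint b x y = linePoint b (c * x) (c * y) := by
  simp only [linePoint, mul_smul, smul_add]

theorem linePoint_ne_zero {x y : ℂ} (h : x ≠ 0 ∨ y ≠ 0) : linePoint b x y ≠ 0 := by
  intro h0
  have h1 := repr_linePoint_zero b x y
  have h2 := repr_linePoint_one b x y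
  simp only [h0, map_zero, Finsupp.coe_zero, Pi.zero_apply] at h1 h2
  rcases h with h | h
  · exact h h1.symm
  · exact h h2.symm

theorem exists_smul_linePoint {x₀ y₀ x₁ y₁ : ℂ} (h₀ : x₀ ≠ 0 ∨ y₀ ≠ 0)
    (h : x₀ * y₁ - y₀ * x₁ = 0) : ∃ c : ℂ, c • linePoint b x₀ y₀ = linePoint b x₁ y₁ := by
  rcases h₀ with h₀ | h₀
  · refine ⟨x₁ / x₀, ?_⟩
    rw [smul_linePoint]
    congr 1
    · field_simp
    · field_simp
      linear_combination -h
  · refine ⟨y₁ / y₀, ?_⟩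
    rw [smul_linePoint]
    congr 1
    · field_simp
      linear_combination h
    · field_simp

/-- The restriction of a ternary form to the line through the first two basis vectors. -/
def lineForm (f : MvPolynomial (Fin 3) ℂ) : MvPolynomial (Fin 2) ℂ :=
  aeval (fun i => C (b 0 i) * X 0 + C (b 1 i) * X 1) f

theorem eval_lineForm (f : MvPolynomial (Fin 3) ℂ) (s : Fin 2 → ℂ) :
    eval s (lineForm b f) = eval (linePoint b (s 0) (s 1)) f := by
  rw [lineForm]
  induction f using MvPolynomial.induction_on with
  | C a => simp
  | add f g hf hg => simp only [map_add, hf, hg]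
  | mul_X f i hf =>
    rw [map_mul, map_mul, map_mul, hf, aeval_X, eval_X]
    simp [linePoint, mul_comm]

theorem isHomogeneous_lineForm {f : MvPolynomial (Fin 3) ℂ} {d : ℕ} (hf : f.IsHomogeneous d) :
    (lineForm b f).IsHomogeneous d := by
  have := hf.aeval (fun i => C (b 0 i) * X 0 + C (b 1 i) * X 1 : Fin 3 → MvPolynomial (Fin 2) ℂ)
    (n := 1) fun i => isHomogeneous_C_mul_X_add _ _
  rwa [one_mul] at this

variable {n : ℕ} (ℓ : Fin n → ℕ)

theorem restrictTo_eq_linearProduct {f : MvPolynomial (Fin 3) ℂ} {u v : RootIndex ℓ → ℂ} {c : ℂ}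
    (hf : ∀ x y, eval (linePoint b x y) f = c * linearProduct ℓ u v x y) (x₀ y₀ x₁ y₁ : ℂ) :
    restrictTo f (linePoint b x₀ y₀) (linePoint b x₁ y₁) = Polynomial.C c *
      linearProduct ℓ (fun k => Polynomial.C (u k)) (fun k => Polynomial.C (v k))
        (Polynomial.C x₀ + Polynomial.X * Polynomial.C x₁)
        (Polynomial.C y₀ + Polynomial.X * Polynomial.C y₁) := by
  refine Polynomial.funext fun t => ?_
  rw [eval_restrictTo, linePoint_add_smul, hf, Polynomial.eval_mul, Polynomial.eval_C,
    ← Polynomial.coe_evalRingHom, map_linearProduct]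
  simp only [Polynomial.coe_evalRingHom, Polynomial.eval_C, Polynomial.eval_add,
    Polynomial.eval_mul, Polynomial.eval_X]

/-- Polynomials in one variable over the complex numbers whose roots have the same multiplicities
are proportional. -/
theorem exists_eq_C_mul_of_rootMultiplicity {p q : Polynomial ℂ} (hp : p ≠ 0) (hq : q ≠ 0)
    (h : ∀ t, p.rootMultiplicity t = q.rootMultiplicity t) :
    ∃ c : ℂ, c ≠ 0 ∧ p = Polynomial.C c * q := by
  classical
  have hroots : p.roots = q.roots := by
    ext t
    rw [Polynomial.count_roots, Polynomial.count_roots, h]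
  have h1 := (IsAlgClosed.splits p).eq_prod_roots
  have h2 := (IsAlgClosed.splits q).eq_prod_roots
  have hp0 := Polynomial.leadingCoeff_ne_zero.2 hp
  have hq0 := Polynomial.leadingCoeff_ne_zero.2 hq
  refine ⟨p.leadingCoeff / q.leadingCoeff, div_ne_zero hp0 hq0, ?_⟩
  rw [← hroots] at h2
  have h3 : Polynomial.C (p.leadingCoeff / q.leadingCoeff) * q =
      Polynomial.C (p.leadingCoeff / q.leadingCoeff) * (Polynomial.C q.leadingCoeff *
        (p.roots.map fun a => Polynomial.X - Polynomial.C a).prod) := congrArg _ h2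
  rw [h3, ← mul_assoc, ← Polynomial.C_mul, div_mul_cancel₀ _ hq0]
  exact h1

theorem rootMultiplicity_restrictTo (f : MvPolynomial (Fin 3) ℂ) (p q : Fin 3 → ℂ) (t : ℂ) :
    (restrictTo f p q).rootMultiplicity t = (restrictTo f (p + t • q) q).rootMultiplicity 0 := by
  rw [Polynomial.rootMultiplicity_eq_rootMultiplicity]
  congr 1
  refine Polynomial.funext fun s => ?_
  simp only [Polynomial.eval_comp, eval_restrictTo, Polynomial.eval_add, Polynomial.eval_X,
    Polynomial.eval_C, add_smul, add_assoc]
  rw [add_comm (s • q)]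

variable {L : Submodule ℂ (Fin 3 → ℂ)}

theorem linePoint_mem (hb : ∀ x, x ∈ L ↔ b.repr x 2 = 0) (x y : ℂ) : linePoint b x y ∈ L :=
  (hb _).2 (repr_linePoint_two b x y)

/-- Points of the line coincide when their homogeneous coordinates are proportional. -/
theorem mk_linePoint_eq_mk_iff {x₀ y₀ x₁ y₁ : ℂ} {p q : L} (hp : p ≠ 0) (hq : q ≠ 0)
    (hp' : (p : Fin 3 → ℂ) = linePoint b x₀ y₀) (hq' : (q : Fin 3 → ℂ) = linePoint b x₁ y₁) :
    Projectivization.mk ℂ p hp = Projectivization.mk ℂ q hq ↔ x₀ * y₁ - y₀ * x₁ = 0 := by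
  rw [Projectivization.mk_eq_mk_iff']
  constructor
  · rintro ⟨c, hc⟩
    have h := congrArg (fun r : L => (r : Fin 3 → ℂ)) hc
    simp only [Submodule.coe_smul] at h
    rw [hp', hq', smul_linePoint] at h
    have h0 := repr_linePoint_zero b x₀ y₀
    have h1 := repr_linePoint_one b x₀ y₀
    rw [← h, repr_linePoint_zero] at h0
    rw [← h, repr_linePoint_one] at h1
    rw [← h0, ← h1]
    ring
  · intro h
    have hne : x₁ ≠ 0 ∨ y₁ ≠ 0 := by
      by_contra! hcon
      refine hq (Subtype.ext ?_)
      rw [hq', hcon.1, hcon.2]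
      simp [linePoint]
    obtain ⟨c, hc⟩ := exists_smul_linePoint b hne (x₁ := x₀) (y₁ := y₀) (by linear_combination -h)
    exact ⟨c, Subtype.ext (by rw [Submodule.coe_smul, hp', hq', hc])⟩

/-- A form cuts out a divisor of type `ℓ` on the line exactly when its restriction to the line is
a product of pairwise independent linear forms with multiplicities prescribed by `ℓ`. -/
theorem exists_divisor_iff_exists_linearProduct (hb : ∀ x, x ∈ L ↔ b.repr x 2 = 0)
    {f : MvPolynomial (Fin 3) ℂ} (hf : f.IsHomogeneous (weight ℓ)) :
    (∃ D : ℙ ℂ L →₀ ℕ, IsIntersectionDivisor f L D ∧ IsOfType ℓ D) ↔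
      ∃ (u v : RootIndex ℓ → ℂ) (c : ℂ), (∀ k, u k ≠ 0 ∨ v k ≠ 0) ∧
        (∀ k l, k ≠ l → u k * v l - v k * u l ≠ 0) ∧ c ≠ 0 ∧
        ∀ x y, eval (linePoint b x y) f = c * linearProduct ℓ u v x y := by
  classical
  constructor
  · rintro ⟨D, ⟨⟨x, hxL, hx⟩, hD⟩, P, hP, hDP⟩
    -- the point `P k` is the zero of the linear form with these coefficients
    set u : RootIndex ℓ → ℂ := fun k => b.repr (P k).rep 1 with hu
    set v : RootIndex ℓ → ℂ := fun k => -b.repr (P k).rep 0 with hv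
    have hrep : ∀ k, ((P k).rep : Fin 3 → ℂ) = linePoint b (-v k) (u k) := by
      intro k
      rw [hu, hv]
      simp only [neg_neg]
      exact (linePoint_repr b ((hb _).1 (P k).rep.2)).symm
    have huv : ∀ k, u k ≠ 0 ∨ v k ≠ 0 := by
      intro k
      by_contra! hcon
      refine (P k).rep_nonzero (Subtype.ext ?_)
      rw [hrep, hcon.1, hcon.2]
      simp [linePoint]
    have hPk : ∀ k x y (p : L) (hp : p ≠ 0), (p : Fin 3 → ℂ) = linePoint b x y →
        (P k = Projectivization.mk ℂ p hp ↔ u k * x + v k * y = 0) := by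
      intro k x y p hp hpxy
      conv_lhs => rw [← (P k).mk_rep]
      rw [mk_linePoint_eq_mk_iff b (P k).rep_nonzero hp (hrep k) hpxy]
      constructor <;> intro h <;> linear_combination -h
    have hr0 : restrictTo f (linePoint b 1 0) (linePoint b 0 1) ≠ 0 := by
      intro h0
      have h1 : lineForm b f = 0 := by
        refine eq_of_eval_one_eq (isHomogeneous_lineForm b hf) (isHomogeneous_zero _ _ _) fun t => ?_
        have h2 := eval_restrictTo f (linePoint b 1 0) (linePoint b 0 1) t
        rw [h0, linePoint_add_smul] at h2
        rw [eval_lineForm, map_zero]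
        simpa using h2.symm
      have h3 := eval_lineForm b f ![b.repr x 0, b.repr x 1]
      rw [h1] at h3
      simp only [Matrix.cons_val_zero, Matrix.cons_val_one] at h3
      rw [linePoint_repr b ((hb x).1 hxL), map_zero] at h3
      exact hx h3.symm
    obtain ⟨c, hc, hrc⟩ := exists_eq_C_mul_of_rootMultiplicity hr0
      (linearProduct_one_X_ne_zero ℓ huv (x₀ := 1) (y₀ := 0) (x₁ := 0) (y₁ := 1) (by simp))
      (by
        intro t
        have hp : (⟨linePoint b 1 t, linePoint_mem b hb _ _⟩ : L) ≠ 0 := fun h =>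
          linePoint_ne_zero b (Or.inl one_ne_zero) (congrArg Subtype.val h)
        have h1 := hD ⟨linePoint b 1 t, linePoint_mem b hb _ _⟩
          ⟨linePoint b 0 1, linePoint_mem b hb _ _⟩ hp (by
            rw [Submodule.mem_span_singleton]
            rintro ⟨e, he⟩
            have he' := congrArg (fun r : L => (r : Fin 3 → ℂ)) he
            simp only [Submodule.coe_smul] at he'
            rw [smul_linePoint] at he'
            have e0 := repr_linePoint_zero b 0 1
            have e1 := repr_linePoint_one b 0 1
            rw [← he', repr_linePoint_zero] at e0
            rw [← he', repr_linePoint_one] at e1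
            rw [mul_one] at e0
            rw [e0, zero_mul] at e1
            exact zero_ne_one e1)
        rw [rootMultiplicity_restrictTo, linePoint_add_smul,
          rootMultiplicity_linearProduct ℓ huv (by simp)]
        simp only [mul_zero, add_zero, mul_one, zero_add]
        rw [← h1, hDP, Finsupp.finsetSum_apply]
        refine Finset.sum_congr rfl fun k _ => ?_
        rw [Finsupp.single_apply]
        refine if_congr ?_ rfl rfl
        rw [hPk k 1 t _ hp rfl, mul_one])
    refine ⟨u, v, c, huv, ?_, hc, ?_⟩
    · intro k l hkl h0
      refine hkl (hP ?_)
      rw [← (P l).mk_rep, hPk k _ _ _ (P l).rep_nonzero (hrep l)]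
      linear_combination -h0
    · have key : lineForm b f =
          C c * linearProduct ℓ (fun k => C (u k)) (fun k => C (v k)) (X 0) (X 1) := by
        refine eq_of_eval_one_eq (isHomogeneous_lineForm b hf)
          ((isHomogeneous_linearProduct ℓ u v (isHomogeneous_X _ _)
            (isHomogeneous_X _ _)).C_mul c) fun t => ?_
        have h2 := eval_restrictTo f (linePoint b 1 0) (linePoint b 0 1) t
        rw [hrc, linePoint_add_smul, Polynomial.eval_mul, ← Polynomial.coe_evalRingHom,
          map_linearProduct] at h2
        rw [eval_lineForm, map_mul, map_linearProduct]
        simpa using h2.symm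
      intro x y
      have h4 := congrArg (eval ![x, y]) key
      rw [eval_lineForm, map_mul, map_linearProduct] at h4
      simpa using h4
  · rintro ⟨u, v, c, huv, hwedge, hc, hfc⟩
    have hne : ∀ k, (⟨linePoint b (-v k) (u k), linePoint_mem b hb _ _⟩ : L) ≠ 0 := fun k h =>
      linePoint_ne_zero b ((huv k).symm.imp_left neg_ne_zero.2) (congrArg Subtype.val h)
    refine ⟨∑ k : RootIndex ℓ, Finsupp.single (Projectivization.mk ℂ _ (hne k)) ((k.1 : ℕ) + 1),
      ⟨?_, ?_⟩, fun k => Projectivization.mk ℂ _ (hne k), ?_, rfl⟩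
    · obtain ⟨t, ht⟩ := exists_linearProduct_ne_zero ℓ huv
      refine ⟨linePoint b 1 t, linePoint_mem b hb _ _, ?_⟩
      rw [hfc]
      exact mul_ne_zero hc ht
    · intro p q hp hq
      have hp' := (linePoint_repr b ((hb _).1 p.2)).symm
      have hq' := (linePoint_repr b ((hb _).1 q.2)).symm
      have hdet : b.repr p 0 * b.repr q 1 - b.repr p 1 * b.repr q 0 ≠ 0 := by
        intro h0
        have hpne : b.repr p 0 ≠ 0 ∨ b.repr p 1 ≠ 0 := by
          by_contra! hcon
          refine hp (Subtype.ext ?_)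
          rw [hp', hcon.1, hcon.2]
          simp [linePoint]
        obtain ⟨e, he⟩ := exists_smul_linePoint b hpne h0
        refine hq (Submodule.mem_span_singleton.2 ⟨e, Subtype.ext ?_⟩)
        rw [Submodule.coe_smul, hp', hq', he]
      have h1 := restrictTo_eq_linearProduct b ℓ hfc (b.repr p 0) (b.repr p 1)
        (b.repr q 0) (b.repr q 1)
      rw [← hp', ← hq'] at h1
      rw [h1, Polynomial.rootMultiplicity_mul
        (mul_ne_zero (Polynomial.C_ne_zero.2 hc) (linearProduct_one_X_ne_zero ℓ huv hdet)),
        Polynomial.rootMultiplicity_C, zero_add, rootMultiplicity_linearProduct ℓ huv hdet,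
        Finsupp.finsetSum_apply]
      refine Finset.sum_congr rfl fun k _ => ?_
      rw [Finsupp.single_apply]
      refine if_congr ?_ rfl rfl
      rw [mk_linePoint_eq_mk_iff b (hne k) hp rfl hp']
      simp only [zero_mul, add_zero]
      constructor <;> intro h <;> linear_combination -h
    · intro k l hkl
      by_contra hne'
      rw [mk_linePoint_eq_mk_iff b (hne k) (hne l) rfl rfl] at hkl
      exact hwedge k l hne' (by linear_combination hkl)

end LineCoordinates

/-! ### Local closedness -/

section LocallyClosed

open MvPolynomial

theorem isWeightedHomogeneous_of_isHomogeneous {τ : Type} [Finite τ] {F : MvPolynomial τ ℂ}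
    {t : ℕ} (hF : F.IsHomogeneous t) :
    IsWeightedHomogeneous (groupWeight fun _ : τ => ()) F (fun _ => t) := by
  intro α hα
  funext i
  have h1 := hF hα
  have h2 := degree_eq_sum_weight (fun _ : τ => ()) α
  rw [Finsupp.degree_eq_weight_one] at h2
  rw [show Finsupp.weight (fun _ => 1) α = t from h1] at h2
  simpa using h2.symm

/-- Smoothness is an open condition on plane curves. -/
theorem isOpen_setOf_isSmoothCurve (d : ℕ) :
    @IsOpen _ (zariskiTopology (Exponent d)) {x : CurveSpace d | IsSmoothCurve x.equation} := by
  have := isClosed_setOf_exists_zero (fun _ : Fin 3 => ()) (J := Option (Fin 3))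
    (fun j => j.elim (formLinear d) fun i => (pderiv i).toLinearMap.comp (formLinear d))
    (fun j _ => j.elim d fun _ => d - 1) (by
      rintro (_ | i) a
      · exact isWeightedHomogeneous_of_isHomogeneous (formLinear_apply a ▸ isHomogeneous_form a)
      · refine isWeightedHomogeneous_of_isHomogeneous ?_
        simp only [Option.elim_some, LinearMap.comp_apply, formLinear_apply]
        exact (isHomogeneous_form a).pderiv)
  let _ := zariskiTopology (Exponent d)
  rw [← isOpen_compl_iff] at this
  convert this using 1
  ext x
  simp only [Set.mem_ofPred_eq, Set.mem_compl_iff, IsSmoothCurve, CurveSpace.equation]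
  constructor
  · rintro h ⟨p, hp, hp0⟩
    obtain ⟨i, -, hi⟩ := hp ()
    have h0 := hp0 none
    obtain ⟨k, hk⟩ := h p (fun h => hi (by rw [h]; rfl)) (by simpa [formLinear_apply] using h0)
    exact hk (by simpa [formLinear_apply] using hp0 (some k))
  · intro h p hp hp0
    by_contra! hall
    refine h ⟨p, fun _ => ?_, ?_⟩
    · obtain ⟨i, hi⟩ := Function.ne_iff.1 hp
      exact ⟨i, trivial, hi⟩
    · rintro (_ | i)
      · simpa [formLinear_apply] using hp0
      · simpa [formLinear_apply] using hall i

variable {d : ℕ} (b : Module.Basis (Fin 3) ℂ (Fin 3 → ℂ))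

/-- The value at a point of the line, as a linear function of the coefficients of the form. -/
def lineValue (s : ℂ × ℂ) : (Exponent d → ℂ) →ₗ[ℂ] ℂ :=
  (aeval (linePoint b s.1 s.2)).toLinearMap.comp (formLinear d)

theorem lineValue_apply (s : ℂ × ℂ) (a : Exponent d → ℂ) :
    lineValue b s a = eval (linePoint b s.1 s.2) (form a) := by
  simp [lineValue, formLinear_apply, aeval_eq_eval]

theorem isOpen_setOf_exists_lineValue_ne_zero :
    @IsOpen _ (zariskiTopology (Exponent d))
      {x : CurveSpace d | ∃ s : ℂ × ℂ, lineValue b s x.rep ≠ 0} := by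
  convert isOpen_span_range_eq_top (fun s : ℂ × ℂ => lineValue (d := d) b s) using 1
  ext x
  simp only [Set.mem_ofPred_eq]
  constructor
  · rintro ⟨s, hs⟩
    rw [eq_top_iff]
    rintro z -
    have : z = (z / lineValue b s x.rep) • lineValue b s x.rep := by
      rw [smul_eq_mul, div_mul_cancel₀ _ hs]
    rw [this]
    exact Submodule.smul_mem _ _ (Submodule.subset_span ⟨s, rfl⟩)
  · intro h
    by_contra! hall
    have h1 : Submodule.span ℂ (Set.range fun s : ℂ × ℂ => lineValue b s x.rep) ≤ ⊥ := by
      rw [Submodule.span_le]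
      rintro _ ⟨s, rfl⟩
      exact hall s
    rw [h] at h1
    exact one_ne_zero ((Submodule.mem_bot ℂ).1 (h1 (Submodule.mem_top (x := (1 : ℂ)))))

variable {n : ℕ} (ℓ : Fin n → ℕ)

/-- The product of linear forms with indeterminate coefficients, at a given point. -/
def genericLinearProduct (s : ℂ × ℂ) : MvPolynomial (RootIndex ℓ × Fin 2) ℂ :=
  linearProduct ℓ (fun k => X (k, 0)) (fun k => X (k, 1)) (C s.1) (C s.2)

theorem eval_genericLinearProduct (s : ℂ × ℂ) (c : RootIndex ℓ × Fin 2 → ℂ) :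
    eval c (genericLinearProduct ℓ s) =
      linearProduct ℓ (fun k => c (k, 0)) (fun k => c (k, 1)) s.1 s.2 := by
  rw [genericLinearProduct, map_linearProduct]
  simp

theorem isWeightedHomogeneous_genericLinearProduct (s : ℂ × ℂ) :
    IsWeightedHomogeneous (groupWeight Prod.fst) (genericLinearProduct ℓ s)
      (fun k => (k.1 : ℕ) + 1) := by
  have h1 : ∀ k : RootIndex ℓ, IsWeightedHomogeneous (groupWeight Prod.fst)
      (X (k, 0) * C s.1 + X (k, 1) * C s.2 : MvPolynomial (RootIndex ℓ × Fin 2) ℂ)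
      (Pi.single k 1 : RootIndex ℓ → ℕ) := by
    intro k
    rw [mul_comm, mul_comm (X (k, 1))]
    exact ((isWeightedHomogeneous_X ℂ _ (k, 0)).C_mul _).add
      ((isWeightedHomogeneous_X ℂ _ (k, 1)).C_mul _)
  have h2 := IsWeightedHomogeneous.prod Finset.univ
    (fun k : RootIndex ℓ => (X (k, 0) * C s.1 + X (k, 1) * C s.2 :
      MvPolynomial (RootIndex ℓ × Fin 2) ℂ) ^ ((k.1 : ℕ) + 1))
    (fun k => ((k.1 : ℕ) + 1) • Pi.single k 1) fun k _ => (h1 k).pow _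
  have h3 : ∑ k : RootIndex ℓ, ((k.1 : ℕ) + 1) • (Pi.single k 1 : RootIndex ℓ → ℕ) =
      fun k => (k.1 : ℕ) + 1 := by
    funext k
    simp [Finset.sum_apply, Pi.single_apply]
  rwa [h3] at h2

/-- The restriction to the line of the form with coefficients `a` is linearly dependent with the
product of the linear forms `u k * x + v k * y`. Proportionality is expressed by the values, through
equations that are linear in `a`. -/
def IsProportional (a : Exponent d → ℂ) (u v : RootIndex ℓ → ℂ) : Prop :=
  ∀ s t : ℂ × ℂ, lineValue b s a * linearProduct ℓ u v t.1 t.2 =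
    lineValue b t a * linearProduct ℓ u v s.1 s.2

/-- The curves whose equation restricts on the line to a multiple, possibly zero, of a product of
linear forms with multiplicities `ℓ`; these linear forms may coincide. -/
def degenerateLocus (d : ℕ) : Set (CurveSpace d) :=
  {x | ∃ u v : RootIndex ℓ → ℂ, (∀ k, u k ≠ 0 ∨ v k ≠ 0) ∧ IsProportional b ℓ x.rep u v}

/-- The equation, multihomogeneous in `u` and `v`, that expresses proportionality. -/
def proportionalityEquation (p : (ℂ × ℂ) × (ℂ × ℂ)) :
    (Exponent d → ℂ) →ₗ[ℂ] MvPolynomial (RootIndex ℓ × Fin 2) ℂ :=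
  (lineValue b p.1).smulRight (genericLinearProduct ℓ p.2) -
    (lineValue b p.2).smulRight (genericLinearProduct ℓ p.1)

theorem isWeightedHomogeneous_proportionalityEquation (p : (ℂ × ℂ) × (ℂ × ℂ))
    (a : Exponent d → ℂ) :
    IsWeightedHomogeneous (groupWeight Prod.fst) (proportionalityEquation b ℓ p a)
      (fun k => (k.1 : ℕ) + 1) :=
  Submodule.sub_mem (weightedHomogeneousSubmodule ℂ _ _)
    (Submodule.smul_mem _ _ (isWeightedHomogeneous_genericLinearProduct ℓ _))
    (Submodule.smul_mem _ _ (isWeightedHomogeneous_genericLinearProduct ℓ _))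

theorem forall_proportionalityEquation_iff (a : Exponent d → ℂ) (c : RootIndex ℓ × Fin 2 → ℂ) :
    (∀ p, eval c (proportionalityEquation b ℓ p a) = 0) ↔
      IsProportional b ℓ a (fun k => c (k, 0)) (fun k => c (k, 1)) := by
  simp only [proportionalityEquation, LinearMap.sub_apply, LinearMap.smulRight_apply, map_sub,
    smul_eval, eval_genericLinearProduct, sub_eq_zero, IsProportional, Prod.forall]

theorem exists_pair_iff (k : RootIndex ℓ) (c : RootIndex ℓ × Fin 2 → ℂ) :
    (∃ t : RootIndex ℓ × Fin 2, t.1 = k ∧ c t ≠ 0) ↔ (c (k, 0) ≠ 0 ∨ c (k, 1) ≠ 0) := by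
  constructor
  · rintro ⟨⟨_, i⟩, rfl, h⟩
    fin_cases i
    · exact Or.inl h
    · exact Or.inr h
  · rintro (h | h)
    · exact ⟨_, rfl, h⟩
    · exact ⟨_, rfl, h⟩

theorem isClosed_degenerateLocus :
    @IsClosed _ (zariskiTopology (Exponent d)) (degenerateLocus b ℓ d) := by
  have := isClosed_setOf_exists_zero (Prod.fst : RootIndex ℓ × Fin 2 → RootIndex ℓ)
    (proportionalityEquation b ℓ) (fun _ k => (k.1 : ℕ) + 1)
    (isWeightedHomogeneous_proportionalityEquation (d := d) b ℓ)
  convert this using 1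
  ext x
  simp only [degenerateLocus, Set.mem_ofPred_eq, exists_pair_iff,
    forall_proportionalityEquation_iff]
  constructor
  · rintro ⟨u, v, huv, h⟩
    exact ⟨fun p => ![u p.1, v p.1] p.2, huv, h⟩
  · rintro ⟨c, hc, h⟩
    exact ⟨_, _, hc, h⟩

/-- The curves in the degenerate locus for which two given linear forms can be chosen
proportional. -/
def collisionLocus (d : ℕ) (k l : RootIndex ℓ) : Set (CurveSpace d) :=
  {x | ∃ u v : RootIndex ℓ → ℂ, (∀ k, u k ≠ 0 ∨ v k ≠ 0) ∧ IsProportional b ℓ x.rep u v ∧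
    u k * v l - v k * u l = 0}

/-- The equation `u k * v l - v k * u l = 0` is multiplied by each of the coefficients of the curve,
in order to be linear in them. -/
theorem isClosed_collisionLocus (k l : RootIndex ℓ) :
    @IsClosed _ (zariskiTopology (Exponent d)) (collisionLocus b ℓ d k l) := by
  classical
  set W : MvPolynomial (RootIndex ℓ × Fin 2) ℂ :=
    X (k, 0) * X (l, 1) - X (k, 1) * X (l, 0) with hW
  have hWhom : IsWeightedHomogeneous (groupWeight Prod.fst) W (Pi.single k 1 + Pi.single l 1) :=
    Submodule.sub_mem (weightedHomogeneousSubmodule ℂ _ _)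
      ((isWeightedHomogeneous_X ℂ _ (k, 0)).mul (isWeightedHomogeneous_X ℂ _ (l, 1)))
      ((isWeightedHomogeneous_X ℂ _ (k, 1)).mul (isWeightedHomogeneous_X ℂ _ (l, 0)))
  have := isClosed_setOf_exists_zero (Prod.fst : RootIndex ℓ × Fin 2 → RootIndex ℓ)
    (Sum.elim (proportionalityEquation b ℓ) fun m : Exponent d =>
      (LinearMap.proj m : (Exponent d → ℂ) →ₗ[ℂ] ℂ).smulRight W)
    (Sum.elim (fun _ k => (k.1 : ℕ) + 1) fun _ => Pi.single k 1 + Pi.single l 1) (by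
      rintro (p | m) a
      · exact isWeightedHomogeneous_proportionalityEquation b ℓ p a
      · exact Submodule.smul_mem (weightedHomogeneousSubmodule ℂ _ _) _ hWhom)
  convert this using 1
  ext x
  simp only [collisionLocus, Set.mem_ofPred_eq, exists_pair_iff, Sum.forall, Sum.elim_inl,
    Sum.elim_inr, forall_proportionalityEquation_iff, LinearMap.smulRight_apply,
    LinearMap.proj_apply, smul_eval, mul_eq_zero]
  constructor
  · rintro ⟨u, v, huv, h, h0⟩
    refine ⟨fun p => ![u p.1, v p.1] p.2, huv, h, fun m => Or.inr ?_⟩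
    simpa [hW] using h0
  · rintro ⟨c, hc, h, h0⟩
    refine ⟨_, _, hc, h, ?_⟩
    obtain ⟨m, hm⟩ := Function.ne_iff.1 x.rep_nonzero
    -- the representative has a nonzero coordinate, which cancels
    simpa [hW] using (h0 m).resolve_left hm

variable {b ℓ}

/-- If the curve does not contain the line, its restriction is a nonzero multiple of the product. -/
theorem IsProportional.exists_eq {a : Exponent d → ℂ} {u v : RootIndex ℓ → ℂ}
    (huv : ∀ k, u k ≠ 0 ∨ v k ≠ 0) (h : IsProportional b ℓ a u v)
    (ha : ∃ s, lineValue b s a ≠ 0) :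
    ∃ c : ℂ, c ≠ 0 ∧ ∀ x y, lineValue b (x, y) a = c * linearProduct ℓ u v x y := by
  obtain ⟨t, ht⟩ := exists_linearProduct_ne_zero ℓ huv
  have heq : ∀ s : ℂ × ℂ, lineValue b s a =
      lineValue b (1, t) a / linearProduct ℓ u v 1 t * linearProduct ℓ u v s.1 s.2 := by
    intro s
    have := h s (1, t)
    field_simp
    exact this
  refine ⟨_, ?_, fun x y => heq (x, y)⟩
  intro h0
  obtain ⟨s, hs⟩ := ha
  rw [heq s, h0, zero_mul] at hs
  exact hs rfl

theorem isProportional_of_eq {a : Exponent d → ℂ} {u v : RootIndex ℓ → ℂ} {c : ℂ}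
    (h : ∀ x y, lineValue b (x, y) a = c * linearProduct ℓ u v x y) :
    IsProportional b ℓ a u v := by
  rintro ⟨x, y⟩ ⟨x', y'⟩
  rw [h, h]
  ring

variable (b ℓ)

/-- The open set that cuts out the smooth locus inside the degenerate locus: the smooth curves that
do not contain the line and for which no two of the linear forms coincide. -/
def genericLocus (d : ℕ) : Set (CurveSpace d) :=
  {x | IsSmoothCurve x.equation} ∩ {x | ∃ s : ℂ × ℂ, lineValue b s x.rep ≠ 0} ∩
    ⋂ p : {p : RootIndex ℓ × RootIndex ℓ // p.1 ≠ p.2}, (collisionLocus b ℓ d p.1.1 p.1.2)ᶜ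

theorem isOpen_genericLocus (d : ℕ) :
    @IsOpen _ (zariskiTopology (Exponent d)) (genericLocus b ℓ d) := by
  let _ := zariskiTopology (Exponent d)
  exact ((isOpen_setOf_isSmoothCurve d).inter (isOpen_setOf_exists_lineValue_ne_zero b)).inter
    (isOpen_iInter_of_finite fun p => (isClosed_collisionLocus b ℓ _ _).isOpen_compl)

theorem smoothLocus_eq_inter {L : Submodule ℂ (Fin 3 → ℂ)} (hb : ∀ x, x ∈ L ↔ b.repr x 2 = 0) :
    smoothLocus (weight ℓ) L ℓ = genericLocus b ℓ (weight ℓ) ∩ degenerateLocus b ℓ (weight ℓ) := by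
  ext x
  rw [smoothLocus, Set.mem_ofPred_eq, exists_divisor_iff_exists_linearProduct b ℓ hb
    (f := x.equation) (isHomogeneous_form x.rep)]
  simp only [genericLocus, Set.mem_inter_iff, Set.mem_ofPred_eq, Set.mem_iInter,
    Set.mem_compl_iff, Subtype.forall, Prod.forall]
  constructor
  · rintro ⟨hsm, u, v, c, huv, hwedge, hc, h⟩
    have h' : ∀ x' y', lineValue b (x', y') x.rep = c * linearProduct ℓ u v x' y' := by
      intro x' y'
      rw [lineValue_apply]
      exact h x' y'
    have hne : ∃ s, lineValue b s x.rep ≠ 0 := by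
      obtain ⟨t, ht⟩ := exists_linearProduct_ne_zero ℓ huv
      exact ⟨(1, t), by rw [h']; exact mul_ne_zero hc ht⟩
    refine ⟨⟨⟨hsm, by simpa using hne⟩, ?_⟩, u, v, huv, isProportional_of_eq h'⟩
    rintro k l hkl ⟨u', v', huv', hprop, h0⟩
    obtain ⟨c', hc', h''⟩ := hprop.exists_eq huv' hne
    exact pairwise_independent_of_linearProduct_eq ℓ hc' hwedge huv'
      (fun x' y' => by rw [← h', ← h'']) k l hkl h0
  · rintro ⟨⟨⟨hsm, hne⟩, hcol⟩, u, v, huv, hprop⟩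
    obtain ⟨c, hc, h⟩ := hprop.exists_eq huv (by simpa using hne)
    refine ⟨hsm, u, v, c, huv, ?_, hc, fun x' y' => ?_⟩
    · intro k l hkl h0
      exact hcol k l hkl ⟨u, v, huv, hprop, h0⟩
    · rw [← h, lineValue_apply]
      rfl

end LocallyClosed

/-! ### A parametrization of the curves that meet the line in a degenerate divisor -/

section Parametrization

open MvPolynomial

/-- The monomials of degree `d` that are divisible by the third variable. -/
abbrev ResidualIndex (d : ℕ) : Type := {m : Exponent d // (m : Fin 3 →₀ ℕ) 2 ≠ 0}

variable (b : Module.Basis (Fin 3) ℂ (Fin 3 → ℂ)) {n : ℕ} (ℓ : Fin n → ℕ)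
variable {R S : Type*} [CommRing R] [Algebra ℂ R] [CommRing S] [Algebra ℂ S]

/-- The linear form that computes the `j`-th coordinate with respect to `b`. -/
def coordinateForm (R : Type*) [CommRing R] [Algebra ℂ R] (j : Fin 3) : MvPolynomial (Fin 3) R :=
  ∑ i, C (algebraMap ℂ R (b.repr (Pi.single i 1) j)) * X i

theorem map_coordinateForm (φ : R →ₐ[ℂ] S) (j : Fin 3) :
    map φ.toRingHom (coordinateForm b R j) = coordinateForm b S j := by
  simp [coordinateForm]

theorem eval_coordinateForm (j : Fin 3) (x : Fin 3 → ℂ) :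
    eval (fun i => algebraMap ℂ R (x i)) (coordinateForm b R j) = algebraMap ℂ R (b.repr x j) := by
  have h : x = ∑ i, x i • (Pi.single i 1 : Fin 3 → ℂ) := by
    funext k
    simp [Finset.sum_apply, Pi.single_apply]
  conv_rhs => rw [h]
  simp [coordinateForm, Finsupp.finsetSum_apply, mul_comm]

theorem isHomogeneous_coordinateForm (j : Fin 3) : (coordinateForm b R j).IsHomogeneous 1 :=
  IsHomogeneous.sum _ _ _ fun _ _ => isHomogeneous_C_mul_X _ _

variable {ℓ} {d : ℕ}

/-- The ternary form that restricts to a multiple of `∏ fᵢ ^ i` on the line, where the binary form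
`fᵢ` has coefficients `c ⟨i, _⟩`. The multiple is `z none`, and the other `z` are the coefficients
of the monomials, in the coordinates given by `b`, that vanish on the line. -/
def parametrizedForm (d : ℕ) (c : FactorIndex ℓ → R) (z : Option (ResidualIndex d) → R) :
    MvPolynomial (Fin 3) R :=
  C (z none) * productForm ℓ (fun k => C (c k)) (coordinateForm b R 0) (coordinateForm b R 1) +
    ∑ m : ResidualIndex d, C (z (some m)) *
      ∏ j, coordinateForm b R j ^ ((m : Exponent d) : Fin 3 →₀ ℕ) j

theorem map_parametrizedForm (φ : R →ₐ[ℂ] S) (c : FactorIndex ℓ → R)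
    (z : Option (ResidualIndex d) → R) :
    map φ.toRingHom (parametrizedForm b d c z) =
      parametrizedForm b d (fun k => φ (c k)) (fun o => φ (z o)) := by
  simp only [parametrizedForm, map_add, map_mul, map_productForm, map_C, map_sum, map_prod,
    map_pow, map_coordinateForm]
  rfl

theorem eval_parametrizedForm (c : FactorIndex ℓ → R) (z : Option (ResidualIndex d) → R)
    (x : Fin 3 → ℂ) :
    eval (fun i => algebraMap ℂ R (x i)) (parametrizedForm b d c z) =
      z none * productForm ℓ c (algebraMap ℂ R (b.repr x 0)) (algebraMap ℂ R (b.repr x 1)) +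
        ∑ m : ResidualIndex d,
          algebraMap ℂ R (∏ j, b.repr x j ^ ((m : Exponent d) : Fin 3 →₀ ℕ) j) * z (some m) := by
  simp only [parametrizedForm, map_add, map_mul, map_productForm, eval_C, map_sum, map_prod,
    map_pow, eval_coordinateForm]
  congr 1
  exact Finset.sum_congr rfl fun m _ => mul_comm _ _

theorem isHomogeneous_parametrizedForm (c : FactorIndex ℓ → R)
    (z : Option (ResidualIndex (weight ℓ)) → R) :
    (parametrizedForm b (weight ℓ) c z).IsHomogeneous (weight ℓ) := by
  refine (IsHomogeneous.C_mul ?_ _).add (IsHomogeneous.sum _ _ _ fun m _ =>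
    IsHomogeneous.C_mul ?_ _)
  · have := IsHomogeneous.prod Finset.univ (fun i : Fin n =>
      binaryForm (fun j => C (c ⟨i, j⟩)) (coordinateForm b R 0) (coordinateForm b R 1) ^
        ((i : ℕ) + 1)) (fun i => ℓ i * ((i : ℕ) + 1)) fun i _ =>
      (isHomogeneous_binaryForm _ (isHomogeneous_coordinateForm b 0)
        (isHomogeneous_coordinateForm b 1)).pow _
    have h2 : ∑ i, ℓ i * ((i : ℕ) + 1) = weight ℓ := by simp [weight, mul_comm]
    rwa [h2] at this
  · have := IsHomogeneous.prod Finset.univ (fun j : Fin 3 =>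
      coordinateForm b R j ^ ((m : Exponent (weight ℓ)) : Fin 3 →₀ ℕ) j)
      (fun j => 1 * ((m : Exponent (weight ℓ)) : Fin 3 →₀ ℕ) j) fun j _ =>
      (isHomogeneous_coordinateForm b j).pow _
    have h2 : ∑ j, 1 * ((m : Exponent (weight ℓ)) : Fin 3 →₀ ℕ) j = weight ℓ := by
      simp only [one_mul]
      rw [← Finsupp.degree_eq_sum, degree_exponent]
    rwa [h2] at this

theorem eval_eq_sum_exponent {R : Type*} [CommRing R] {F : MvPolynomial (Fin 3) R}
    (hF : F.IsHomogeneous d) (x : Fin 3 → R) :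
    eval x F = ∑ m : Exponent d, F.coeff (m : Fin 3 →₀ ℕ) * ∏ j, x j ^ (m : Fin 3 →₀ ℕ) j := by
  rw [eval_eq', Finset.sum_coe_sort (Finset.finsuppAntidiag Finset.univ d)
    (fun m => F.coeff m * ∏ j, x j ^ m j)]
  refine Finset.sum_subset (fun m hm => ?_) fun m _ hm => ?_
  · rw [Finset.mem_finsuppAntidiag]
    refine ⟨?_, Finset.subset_univ _⟩
    have := hF (mem_support_iff.1 hm)
    rw [← this, Finsupp.weight_eq_sum]
    simp
  · rw [notMem_support_iff.1 hm, zero_mul]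

/-- The monomials that are not divisible by the third variable are the restriction to `w = 0`. -/
theorem eval_eq_eval_add_sum {R : Type*} [CommRing R] {F : MvPolynomial (Fin 3) R}
    (hF : F.IsHomogeneous d) (x : Fin 3 → R) :
    eval x F = eval ![x 0, x 1, 0] F + ∑ m : ResidualIndex d,
      (∏ j, x j ^ ((m : Exponent d) : Fin 3 →₀ ℕ) j) * F.coeff ((m : Exponent d) : Fin 3 →₀ ℕ) := by
  have split : ∀ f : Exponent d → R, ∑ m, f m = (∑ m : ResidualIndex d, f m) +
      ∑ m : {m : Exponent d // ¬ (m : Fin 3 →₀ ℕ) 2 ≠ 0}, f m := fun f =>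
    (Fintype.sum_subtype_add_sum_subtype (fun m : Exponent d => (m : Fin 3 →₀ ℕ) 2 ≠ 0) f).symm
  have hzero : ∑ m : ResidualIndex d, coeff (m.1 : Fin 3 →₀ ℕ) F *
      ∏ j, (![x 0, x 1, 0] : Fin 3 → R) j ^ (m.1 : Fin 3 →₀ ℕ) j = 0 := by
    refine Finset.sum_eq_zero fun m _ => ?_
    rw [Finset.prod_eq_zero (Finset.mem_univ 2), mul_zero]
    exact zero_pow m.2
  rw [eval_eq_sum_exponent hF, eval_eq_sum_exponent hF, split, split, hzero, zero_add, add_comm]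
  refine congrArg₂ (· + ·) (Finset.sum_congr rfl fun m _ => ?_)
    (Finset.sum_congr rfl fun m _ => mul_comm _ _)
  have hm := not_not.1 m.2
  simp [Fin.prod_univ_three, hm]

theorem form_coeff {F : MvPolynomial (Fin 3) ℂ} (hF : F.IsHomogeneous d) :
    form (fun m : Exponent d => F.coeff (m : Fin 3 →₀ ℕ)) = F := by
  refine MvPolynomial.funext fun x => ?_
  rw [eval_eq_sum_exponent hF, form, map_sum]
  refine Finset.sum_congr rfl fun m _ => ?_
  rw [eval_monomial, Finsupp.prod_fintype _ _ fun _ => pow_zero _]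

theorem coeff_form (a : Exponent d → ℂ) (m : Exponent d) :
    (form a).coeff (m : Fin 3 →₀ ℕ) = a m := by
  classical
  simp [form, coeff_sum, coeff_monomial, Subtype.ext_iff.symm]

/-- The coefficients of the parametrized form. -/
def parametrization (c : FactorIndex ℓ → R) (z : Option (ResidualIndex (weight ℓ)) → R)
    (m : Exponent (weight ℓ)) : R :=
  (parametrizedForm b (weight ℓ) c z).coeff (m : Fin 3 →₀ ℕ)

theorem map_parametrization (φ : R →ₐ[ℂ] S) (c : FactorIndex ℓ → R)
    (z : Option (ResidualIndex (weight ℓ)) → R) (m : Exponent (weight ℓ)) :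
    φ (parametrization b c z m) =
      parametrization b (fun k => φ (c k)) (fun o => φ (z o)) m := by
  rw [parametrization, parametrization, ← map_parametrizedForm, coeff_map]
  rfl

theorem eval_parametrizedForm_mem_span (c : FactorIndex ℓ → R)
    (z : Option (ResidualIndex (weight ℓ)) → R) (x : Fin 3 → ℂ) :
    eval (fun i => algebraMap ℂ R (x i)) (parametrizedForm b (weight ℓ) c z) ∈
      Submodule.span ℂ (Set.range (parametrization b c z)) := by
  rw [eval_eq_sum_exponent (isHomogeneous_parametrizedForm b c z)]
  refine Submodule.sum_mem _ fun m _ => ?_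
  simp only [← map_pow, ← map_prod]
  rw [mul_comm, ← Algebra.smul_def]
  exact Submodule.smul_mem _ _ (Submodule.subset_span ⟨m, rfl⟩)

theorem lineValue_parametrization (c : FactorIndex ℓ → ℂ)
    (z : Option (ResidualIndex (weight ℓ)) → ℂ) (x y : ℂ) :
    lineValue b (x, y) (parametrization b c z) = z none * productForm ℓ c x y := by
  have h1 := eval_parametrizedForm b c z (linePoint b x y)
  simp only [Algebra.algebraMap_self, RingHom.id_apply, repr_linePoint_zero,
    repr_linePoint_one] at h1
  rw [lineValue_apply]
  unfold parametrization
  rw [form_coeff (isHomogeneous_parametrizedForm b c z), h1, add_eq_left]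
  refine Finset.sum_eq_zero fun m _ => ?_
  rw [Finset.prod_eq_zero (Finset.mem_univ 2), zero_mul]
  rw [repr_linePoint_two, zero_pow m.2]

/-- Every form that restricts to a product of linear forms on the line is parametrized. -/
theorem exists_parametrization_eq {a : Exponent (weight ℓ) → ℂ} {u v : RootIndex ℓ → ℂ} {e : ℂ}
    (h : ∀ x y, lineValue b (x, y) a = e * linearProduct ℓ u v x y) :
    ∃ (c : FactorIndex ℓ → ℂ) (z : Option (ResidualIndex (weight ℓ)) → ℂ),
      parametrization b c z = a := by
  choose c hc using fun i : Fin n => exists_binaryForm_eq_prod (fun j : Fin (ℓ i) => u ⟨i, j⟩)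
    (fun j => v ⟨i, j⟩)
  have hprod : ∀ x y : ℂ, productForm ℓ (fun k : FactorIndex ℓ => c k.1 k.2) x y =
      linearProduct ℓ u v x y := by
    intro x y
    rw [productForm, linearProduct, Fintype.prod_sigma]
    refine Finset.prod_congr rfl fun i _ => ?_
    exact (congrArg (· ^ ((i : ℕ) + 1)) (hc i x y)).trans (Finset.prod_pow _ _ _).symm
  -- the form in the coordinates given by `b`
  set F : MvPolynomial (Fin 3) ℂ := aeval (fun i => ∑ j, C (b j i) * X j) (form a) with hF
  have hFhom : F.IsHomogeneous (weight ℓ) := by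
    have := (isHomogeneous_form a).aeval
      (fun i => ∑ j, C (b j i) * X j : Fin 3 → MvPolynomial (Fin 3) ℂ) (n := 1)
      fun i => IsHomogeneous.sum _ _ _ fun j _ => isHomogeneous_C_mul_X _ _
    rwa [one_mul] at this
  have hFeval : ∀ t : Fin 3 → ℂ, eval t F = eval (∑ j, t j • b j) (form a) := by
    intro t
    rw [hF]
    generalize form a = f
    induction f using MvPolynomial.induction_on with
    | C a => simp
    | add f g hf hg => simp only [map_add, hf, hg]
    | mul_X f i hf =>
      rw [map_mul, map_mul, map_mul, hf, aeval_X, eval_X]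
      simp [mul_comm, Finset.sum_apply]
  let z : Option (ResidualIndex (weight ℓ)) → ℂ := fun o => o.elim e fun m => F.coeff m.1.1
  refine ⟨fun k => c k.1 k.2, z, ?_⟩
  have hform : parametrizedForm b (weight ℓ) (fun k : FactorIndex ℓ => c k.1 k.2) z = form a := by
    refine MvPolynomial.funext fun x => ?_
    have h1 := eval_parametrizedForm b (fun k : FactorIndex ℓ => c k.1 k.2) z x
    simp only [Algebra.algebraMap_self, RingHom.id_apply] at h1
    rw [h1, hprod, show z none = e from rfl, ← h]
    have hx : eval x (form a) = eval (fun j => b.repr x j) F := by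
      rw [hFeval, b.sum_repr]
    have hline : lineValue b (b.repr x 0, b.repr x 1) a =
        eval ![b.repr x 0, b.repr x 1, 0] F := by
      rw [hFeval, lineValue_apply, linePoint, Fin.sum_univ_three]
      simp
    rw [hx, hline]
    exact (eval_eq_eval_add_sum hFhom _).symm
  funext m
  rw [parametrization, hform, coeff_form]

end Parametrization

section GenericParametrization

open MvPolynomial

variable (b : Module.Basis (Fin 3) ℂ (Fin 3 → ℂ)) {n : ℕ} (ℓ : Fin n → ℕ)

/-- The ring of functions on the space of parameters: polynomials in the coefficients of the binary
forms `fᵢ` and in the coordinates `z`. -/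
abbrev ParameterRing : Type :=
  MvPolynomial (Option (ResidualIndex (weight ℓ))) (MvPolynomial (FactorIndex ℓ) ℂ)

/-- The parametrization with indeterminate parameters. -/
def genericParametrization : Exponent (weight ℓ) → ParameterRing ℓ :=
  parametrization b (fun k => C (X k)) X

theorem eval_generic_parametrizedForm (x : Fin 3 → ℂ) :
    eval (fun i => algebraMap ℂ (ParameterRing ℓ) (x i))
      (parametrizedForm b (weight ℓ) (fun k => C (X k)) X) =
    monomial (Finsupp.single none 1) (genericProduct ℓ (b.repr x 0) (b.repr x 1)) +
      ∑ m : ResidualIndex (weight ℓ),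
        (∏ j, b.repr x j ^ ((m : Exponent (weight ℓ)) : Fin 3 →₀ ℕ) j) •
          (X (some m) : ParameterRing ℓ) := by
  rw [eval_parametrizedForm]
  refine congrArg₂ (· + ·) ?_ (Finset.sum_congr rfl fun m _ => (Algebra.smul_def _ _).symm)
  · have h1 : productForm ℓ (fun k => (C (X k) : ParameterRing ℓ))
        (algebraMap ℂ _ (b.repr x 0)) (algebraMap ℂ _ (b.repr x 1)) =
        C (genericProduct ℓ (b.repr x 0) (b.repr x 1)) := by
      rw [genericProduct, map_productForm]
      rfl
    rw [h1, mul_comm, X, C_mul_monomial, mul_one]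

/-- The linear span of the coordinates of the parametrization is the degree one part of the
coordinate ring of a cone over the variety of products `∏ fᵢ ^ i`. -/
theorem span_range_genericParametrization :
    Submodule.span ℂ (Set.range (genericParametrization b ℓ)) =
      conePart (κ := ResidualIndex (weight ℓ)) (fun s => productSpan ℓ ^ s) 1 := by
  apply le_antisymm
  · rw [Submodule.span_le]
    rintro _ ⟨m, rfl⟩
    refine Submodule.span_le.2 ?_ (mvPolynomial_coeff_mem_span_eval _ _)
    rintro _ ⟨x, rfl⟩
    rw [SetLike.mem_coe]
    simp only
    rw [eval_generic_parametrizedForm]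
    refine add_mem (Submodule.subset_span ⟨_, Finsupp.degree_single _ _, _, ?_, rfl⟩)
      (Submodule.sum_mem _ fun m _ => Submodule.smul_mem _ _
        (Submodule.subset_span ⟨Finsupp.single (some m) 1, Finsupp.degree_single _ _, 1, ?_, rfl⟩))
    · rw [Finsupp.single_eq_same]
      exact (pow_one (productSpan ℓ)).ge (genericProduct_mem ℓ _ _)
    · rw [Finsupp.single_eq_of_ne (by simp)]
      exact Submodule.one_le.1 (pow_zero (productSpan ℓ)).ge
  · have hmem : ∀ t : Fin 3 → ℂ,
        monomial (Finsupp.single none 1) (genericProduct ℓ (t 0) (t 1)) +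
          ∑ m : ResidualIndex (weight ℓ),
            (∏ j, t j ^ ((m : Exponent (weight ℓ)) : Fin 3 →₀ ℕ) j) •
              (X (some m) : ParameterRing ℓ) ∈
        Submodule.span ℂ (Set.range (genericParametrization b ℓ)) := by
      intro t
      have h1 := eval_parametrizedForm_mem_span b (fun k => (C (X k) : ParameterRing ℓ)) X
        (b.equivFun.symm t)
      rw [eval_generic_parametrizedForm] at h1
      simp only [← Module.Basis.equivFun_apply, LinearEquiv.apply_symm_apply] at h1
      exact h1
    have hline : ∀ x y : ℂ, monomial (Finsupp.single none 1) (genericProduct ℓ x y) ∈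
        Submodule.span ℂ (Set.range (genericParametrization b ℓ)) := by
      intro x y
      have h1 := hmem ![x, y, 0]
      rw [Finset.sum_eq_zero, add_zero] at h1
      · exact h1
      · intro m _
        rw [Finset.prod_eq_zero (Finset.mem_univ 2), zero_smul]
        exact zero_pow m.2
    have hvar : ∀ m : ResidualIndex (weight ℓ), (X (some m) : ParameterRing ℓ) ∈
        Submodule.span ℂ (Set.range (genericParametrization b ℓ)) := by
      classical
      intro m
      -- subtract the value at a point of the line, then extract a coefficient
      set p : MvPolynomial (Fin 3) (ParameterRing ℓ) :=
        ∑ m : ResidualIndex (weight ℓ), monomial ((m : Exponent (weight ℓ)) : Fin 3 →₀ ℕ)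
          (X (some m) : ParameterRing ℓ) with hp
      have hcoeff : p.coeff ((m : Exponent (weight ℓ)) : Fin 3 →₀ ℕ) = X (some m) := by
        simp [hp, coeff_sum, coeff_monomial, Subtype.ext_iff.symm]
      rw [← hcoeff]
      refine Submodule.span_le.2 ?_ (mvPolynomial_coeff_mem_span_eval p _)
      rintro _ ⟨t, rfl⟩
      have h1 := Submodule.sub_mem _ (hmem t) (hline (t 0) (t 1))
      rw [add_sub_cancel_left] at h1
      rw [SetLike.mem_coe]
      convert h1 using 1
      simp only [hp, map_sum, eval_monomial]
      refine Finset.sum_congr rfl fun m _ => ?_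
      rw [Finsupp.prod_fintype _ _ fun _ => pow_zero _, Algebra.smul_def, mul_comm, map_prod]
      simp only [map_pow]
    rw [conePart, Submodule.span_le]
    rintro _ ⟨β, hβ, x, hx, rfl⟩
    obtain ⟨o, rfl⟩ : ∃ o, β = Finsupp.single o 1 := by
      exact (Finsupp.sum_eq_one_iff β).1 hβ
    rcases o with _ | m
    · rw [Finsupp.single_eq_same, pow_one] at hx
      induction hx using Submodule.span_induction with
      | mem x hx =>
        obtain ⟨s, rfl⟩ := hx
        exact hline _ _
      | zero => rw [map_zero]; exact Submodule.zero_mem _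
      | add x y _ _ hx hy => rw [map_add]; exact Submodule.add_mem _ hx hy
      | smul c x _ hx =>
        rw [← smul_monomial]
        exact Submodule.smul_mem _ c hx
    · rw [Finsupp.single_eq_of_ne (by simp), pow_zero, Submodule.mem_one] at hx
      obtain ⟨c, rfl⟩ := hx
      have h1 : (monomial (Finsupp.single (some m) 1) (algebraMap ℂ _ c) : ParameterRing ℓ) =
          c • X (some m) := by
        rw [X, smul_monomial, Algebra.smul_def, mul_one]
      rw [SetLike.mem_coe, h1]
      exact Submodule.smul_mem _ c (hvar m)

/-- Evaluation of functions of the parameters. -/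
def evalParameters (c : FactorIndex ℓ → ℂ) (z : Option (ResidualIndex (weight ℓ)) → ℂ) :
    ParameterRing ℓ →ₐ[ℂ] ℂ :=
  (aeval z : MvPolynomial (Option (ResidualIndex (weight ℓ))) ℂ →ₐ[ℂ] ℂ).comp
    (mapAlgHom (aeval c))

theorem eq_zero_of_evalParameters {G : ParameterRing ℓ} (h : ∀ c z, evalParameters ℓ c z G = 0) :
    G = 0 := by
  refine MvPolynomial.ext _ _ fun β => ?_
  rw [coeff_zero]
  refine MvPolynomial.funext fun c => ?_
  have h1 : mapAlgHom (σ := Option (ResidualIndex (weight ℓ))) (aeval c) G =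
      (0 : MvPolynomial _ ℂ) := by
    refine MvPolynomial.funext fun z => ?_
    rw [map_zero]
    exact h c z
  have h2 := congrArg (coeff β) h1
  rw [coeff_zero] at h2
  rw [map_zero, ← h2]
  exact (coeff_map (aeval c : MvPolynomial (FactorIndex ℓ) ℂ →ₐ[ℂ] ℂ).toRingHom G β).symm

theorem evalParameters_genericParametrization (c : FactorIndex ℓ → ℂ)
    (z : Option (ResidualIndex (weight ℓ)) → ℂ) (m : Exponent (weight ℓ)) :
    evalParameters ℓ c z (genericParametrization b ℓ m) = parametrization b c z m := by
  rw [genericParametrization, map_parametrization]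
  congr 1
  · funext k
    simp [evalParameters]
  · funext o
    simp [evalParameters]

theorem evalParameters_aeval (c : FactorIndex ℓ → ℂ)
    (z : Option (ResidualIndex (weight ℓ)) → ℂ) (F : MvPolynomial (Exponent (weight ℓ)) ℂ) :
    evalParameters ℓ c z (aeval (genericParametrization b ℓ) F) =
      eval (parametrization b c z) F := by
  rw [← AlgHom.comp_apply, comp_aeval]
  simp only [evalParameters_genericParametrization]
  rfl

/-- The basic open sets form a basis of the Zariski topology. -/
theorem exists_basic_open_subset {ι : Type} {U : Set (ℙ ℂ (ι → ℂ))}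
    (hU : @IsOpen _ (zariskiTopology ι) U) {x : ℙ ℂ (ι → ℂ)} (hx : x ∈ U) :
    ∃ (t : ℕ) (D : MvPolynomial ι ℂ), D.IsHomogeneous t ∧ eval x.rep D ≠ 0 ∧
      ∀ y : ℙ ℂ (ι → ℂ), eval y.rep D ≠ 0 → y ∈ U := by
  have h : TopologicalSpace.GenerateOpen _ U := hU
  clear hU
  induction h with
  | basic U hU =>
    obtain ⟨t, F, hF, rfl⟩ := hU
    exact ⟨t, F, hF, hx, fun y hy => hy⟩
  | univ => exact ⟨0, 1, isHomogeneous_one _ _, by simp, fun _ _ => trivial⟩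
  | inter U V _ _ ihU ihV =>
    obtain ⟨t, D, hD, hDx, hDU⟩ := ihU hx.1
    obtain ⟨t', D', hD', hDx', hDU'⟩ := ihV hx.2
    refine ⟨_, _, hD.mul hD', by rw [map_mul]; exact mul_ne_zero hDx hDx', fun y hy => ?_⟩
    rw [map_mul] at hy
    exact ⟨hDU y (left_ne_zero_of_mul hy), hDU' y (right_ne_zero_of_mul hy)⟩
  | sUnion 𝒰 _ ih =>
    obtain ⟨U, hU, hxU⟩ := hx
    obtain ⟨t, D, hD, hDx, hDU⟩ := ih U hU hxU
    exact ⟨t, D, hD, hDx, fun y hy => ⟨U, hU, hDU y hy⟩⟩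

theorem exists_rep_mk_eq_smul {ι : Type} {a : ι → ℂ} (ha : a ≠ 0) :
    ∃ e : ℂ, e ≠ 0 ∧ (Projectivization.mk ℂ a ha).rep = e • a := by
  obtain ⟨e, he⟩ := Projectivization.exists_smul_eq_mk_rep ℂ a ha
  exact ⟨e, e.ne_zero, he.symm⟩

/-- The parametrized curves lie in the degenerate locus: each `fᵢ` is a product of linear forms. -/
theorem exists_isProportional_parametrization {c : FactorIndex ℓ → ℂ}
    {z : Option (ResidualIndex (weight ℓ)) → ℂ}
    (h : ∃ s, lineValue b s (parametrization b c z) ≠ 0) :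
    ∃ u v : RootIndex ℓ → ℂ, (∀ k, u k ≠ 0 ∨ v k ≠ 0) ∧
      IsProportional b ℓ (parametrization b c z) u v := by
  obtain ⟨⟨x, y⟩, hs⟩ := h
  rw [lineValue_parametrization] at hs
  have hc : ∀ i, (fun j => c ⟨i, j⟩ : Fin (ℓ i + 1) → ℂ) ≠ 0 := by
    intro i h0
    refine hs ?_
    rw [productForm, Finset.prod_eq_zero (Finset.mem_univ i), mul_zero]
    rw [h0, pow_eq_zero_iff (Nat.succ_ne_zero _)]
    simp [binaryForm]
  choose u v e huv hprod using fun i => exists_prod_eq_binaryForm (hc i)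
  refine ⟨fun k => u k.1 k.2, fun k => v k.1 k.2, fun k => huv k.1 k.2,
    isProportional_of_eq (c := z none * ∏ i, e i ^ ((i : ℕ) + 1)) fun x y => ?_⟩
  rw [lineValue_parametrization, mul_assoc]
  congr 1
  rw [productForm, linearProduct, Fintype.prod_sigma, ← Finset.prod_mul_distrib]
  refine Finset.prod_congr rfl fun i _ => ?_
  refine (congrArg (· ^ ((i : ℕ) + 1)) (hprod i x y)).trans ((mul_pow _ _ _).trans ?_)
  exact congrArg (e i ^ ((i : ℕ) + 1) * ·) (Finset.prod_pow _ _ _).symm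

theorem IsProportional.smul {d : ℕ} {a : Exponent d → ℂ} {u v : RootIndex ℓ → ℂ}
    (h : IsProportional b ℓ a u v) (e : ℂ) : IsProportional b ℓ (e • a) u v := by
  intro s t
  simp only [map_smul, smul_eq_mul, mul_assoc]
  rw [h s t]

/-- If the smooth locus is nonempty, a form in the coefficients vanishes on it if and only if it
vanishes identically in the parameters. -/
theorem forall_eval_eq_zero_iff {L : Submodule ℂ (Fin 3 → ℂ)} (hb : ∀ x, x ∈ L ↔ b.repr x 2 = 0)
    (hne : (smoothLocus (weight ℓ) L ℓ).Nonempty) {t : ℕ}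
    {F : MvPolynomial (Exponent (weight ℓ)) ℂ} (hF : F.IsHomogeneous t) :
    (∀ x ∈ smoothLocus (weight ℓ) L ℓ, eval x.rep F = 0) ↔
      aeval (genericParametrization b ℓ) F = 0 := by
  rw [smoothLocus_eq_inter b ℓ hb] at hne ⊢
  have hpar : ∀ x ∈ genericLocus b ℓ (weight ℓ) ∩ degenerateLocus b ℓ (weight ℓ),
      ∃ c z, parametrization b c z = x.rep := by
    rintro x ⟨⟨⟨_, hx⟩, _⟩, u, v, huv, hprop⟩
    obtain ⟨e, _, he⟩ := hprop.exists_eq huv hx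
    exact exists_parametrization_eq b he
  constructor
  · intro h
    obtain ⟨x₀, hx₀⟩ := hne
    obtain ⟨t', D, hD, hDx, hDU⟩ := exists_basic_open_subset (isOpen_genericLocus b ℓ _) hx₀.1
    obtain ⟨m, hm⟩ := Function.ne_iff.1 x₀.rep_nonzero
    rw [Pi.zero_apply] at hm
    obtain ⟨c₀, z₀, h₀⟩ := hpar x₀ hx₀
    -- where `X m * D` does not vanish, the parameters define a point of the smooth locus; the
    -- factor `X m` ensures that the parametrized coefficients are not all zero
    have hprod : aeval (genericParametrization b ℓ) F *
        aeval (genericParametrization b ℓ) (X m * D) = 0 := by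
      refine eq_zero_of_evalParameters ℓ fun c z => ?_
      rw [map_mul, evalParameters_aeval, evalParameters_aeval]
      by_contra hcon
      have hF0 := left_ne_zero_of_mul hcon
      have hXD := right_ne_zero_of_mul hcon
      rw [map_mul, eval_X] at hXD
      set a := parametrization b c z with ha
      have ha0 : a ≠ 0 := fun h0 => left_ne_zero_of_mul hXD (by rw [h0, Pi.zero_apply])
      obtain ⟨e, he, hrep⟩ := exists_rep_mk_eq_smul ha0
      have hyU : Projectivization.mk ℂ a ha0 ∈ genericLocus b ℓ (weight ℓ) := by
        refine hDU _ ?_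
        rw [hrep, eval_smul_of_isHomogeneous hD]
        exact mul_ne_zero (pow_ne_zero _ he) (right_ne_zero_of_mul hXD)
      obtain ⟨s, hs⟩ := hyU.1.2
      rw [hrep, map_smul, smul_eq_mul] at hs
      obtain ⟨u, v, huv, hprop⟩ := exists_isProportional_parametrization b ℓ (c := c) (z := z)
        ⟨s, right_ne_zero_of_mul hs⟩
      have hy := h _ ⟨hyU, u, v, huv, by rw [hrep]; exact hprop.smul b ℓ e⟩
      rw [hrep, eval_smul_of_isHomogeneous hF] at hy
      exact hF0 ((mul_eq_zero.1 hy).resolve_left (pow_ne_zero _ he))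
    refine (mul_eq_zero.1 hprod).resolve_right fun h0 => ?_
    have h1 := evalParameters_aeval b ℓ c₀ z₀ (X m * D)
    rw [h0, map_zero, h₀, map_mul, eval_X] at h1
    exact mul_ne_zero hm hDx h1.symm
  · intro h x hx
    obtain ⟨c, z, hcz⟩ := hpar x hx
    rw [← hcz, ← evalParameters_aeval, h, map_zero]

end GenericParametrization

/-! ### Existence of smooth curves with prescribed intersection -/

section Existence

open MvPolynomial

variable {n : ℕ} (ℓ : Fin n → ℕ)

theorem linearProduct_mul (u v : RootIndex ℓ → ℂ) (e x y : ℂ) :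
    linearProduct ℓ u v (e * x) (e * y) = e ^ weight ℓ * linearProduct ℓ u v x y := by
  rw [← sum_multiplicity_eq_weight, ← Finset.prod_pow_eq_pow_sum, linearProduct, linearProduct,
    ← Finset.prod_mul_distrib]
  refine Finset.prod_congr rfl fun k _ => ?_
  rw [← mul_pow]
  ring

/-- The derivative of a form along a vector. -/
theorem eval_derivative_restrictTo (f : MvPolynomial (Fin 3) ℂ) (p q : Fin 3 → ℂ) :
    (restrictTo f p q).derivative.eval 0 = ∑ i, q i * eval p (pderiv i f) := by
  have h0 : ∀ g, (restrictTo g p q).eval 0 = eval p g := fun g => by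
    rw [eval_restrictTo, zero_smul, add_zero]
  induction f using MvPolynomial.induction_on with
  | C a => simp [restrictTo]
  | add f g hf hg =>
    rw [restrictTo, map_add, Polynomial.derivative_add, Polynomial.eval_add]
    simp only [map_add, mul_add, Finset.sum_add_distrib]
    rw [← hf, ← hg]
    rfl
  | mul_X f i hf =>
    have h1 : restrictTo (f * X i) p q =
        restrictTo f p q * (Polynomial.C (p i) + Polynomial.X * Polynomial.C (q i)) := by
      simp only [restrictTo, map_mul, aeval_X]
    have h2 : (Polynomial.C (p i) + Polynomial.X * Polynomial.C (q i)).derivative =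
        Polynomial.C (q i) := by
      rw [Polynomial.derivative_add, Polynomial.derivative_C, zero_add, Polynomial.derivative_mul,
        Polynomial.derivative_X, Polynomial.derivative_C, mul_zero, add_zero, one_mul]
    rw [h1, Polynomial.derivative_mul, h2, Polynomial.eval_add, Polynomial.eval_mul,
      Polynomial.eval_mul, Polynomial.eval_C, hf, h0]
    simp only [Derivation.leibniz, smul_eq_mul, pderiv_X, map_add, map_mul, eval_X, mul_add,
      Finset.sum_add_distrib, Finset.sum_mul]
    rw [add_comm]
    congr 1
    · rw [Finset.sum_eq_single i]
      · rw [Pi.single_eq_same, map_one, mul_one, mul_comm]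
      · intro j _ hj
        rw [Pi.single_eq_of_ne hj.symm, map_zero, mul_zero, mul_zero]
      · exact fun h => absurd (Finset.mem_univ i) h
    · simp only [Polynomial.eval_add, Polynomial.eval_C, Polynomial.eval_mul, Polynomial.eval_X,
        zero_mul, add_zero]
      exact Finset.sum_congr rfl fun j _ => by ring

/-- A multiplier `c` for which the curve `P(u, v) + w u ^ (d - 1) + c w ^ d = 0` is smooth, where
`γ(v) = P(1, v)`. At a singular point `(1 : v : w)`, the derivative along `v` shows that `v` is a
critical point of `γ`, and the equation together with the derivative along `w` shows that
`w = -γ(v) d / (d - 1)` and `1 + c d w ^ (d - 1) = 0`. This excludes finitely many values of `c`. The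
value `0` is excluded because of the points with `u = 0`, and `-1` because of the case `d = 1`. -/
theorem exists_good_multiplier {γ : Polynomial ℂ} (hγ : Polynomial.derivative γ ≠ 0) (d : ℕ) :
    ∃ c : ℂ, c ≠ 0 ∧ c ≠ -1 ∧ ∀ v, γ.derivative.eval v = 0 →
      1 + c * (d * (-(γ.eval v * d / (d - 1))) ^ (d - 1)) ≠ 0 := by
  obtain ⟨c, hc⟩ := Set.Infinite.exists_notMem_finset (Set.infinite_univ (α := ℂ))
    ({0, -1} ∪ γ.derivative.roots.toFinset.image fun v =>
      -1 / (d * (-(γ.eval v * d / (d - 1))) ^ (d - 1)))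
  obtain ⟨-, hc⟩ := hc
  simp only [Finset.mem_union, Finset.mem_insert, Finset.mem_singleton, Finset.mem_image,
    Multiset.mem_toFinset, not_or, not_exists, not_and] at hc
  refine ⟨c, hc.1.1, hc.1.2, fun v hv h => hc.2 v ?_ ?_⟩
  · rw [Polynomial.mem_roots hγ]
    exact hv
  · have hne : (d * (-(γ.eval v * d / (d - 1))) ^ (d - 1) : ℂ) ≠ 0 := by
      intro h0
      rw [h0, mul_zero, add_zero] at h
      exact one_ne_zero h
    rw [div_eq_iff hne]
    linear_combination -h

theorem IsSmoothCurve.smul {f : MvPolynomial (Fin 3) ℂ} (hf : IsSmoothCurve f) {e : ℂ}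
    (he : e ≠ 0) : IsSmoothCurve (e • f) := by
  intro p hp hp0
  rw [smul_eval, mul_eq_zero] at hp0
  obtain ⟨i, hi⟩ := hf p hp (hp0.resolve_left he)
  refine ⟨i, ?_⟩
  rw [Derivation.map_smul, smul_eval]
  exact mul_ne_zero he hi

variable (b : Module.Basis (Fin 3) ℂ (Fin 3 → ℂ))

theorem add_smul_basis_repr (p : Fin 3 → ℂ) (t : ℂ) (i j : Fin 3) :
    b.repr (p + t • b i) j = b.repr p j + t * if i = j then 1 else 0 := by
  simp [Finsupp.single_apply]

/-- A smooth curve with given restriction to the line: `P(u, v) + w u ^ (d - 1) + c w ^ d = 0` for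
general `c`, where `P(0, 1) = 1`. There is no singular point with `u = 0`. -/
theorem exists_isSmoothCurve_eval_linePoint {t : RootIndex ℓ → ℂ} :
    ∃ f : MvPolynomial (Fin 3) ℂ, f.IsHomogeneous (weight ℓ) ∧ IsSmoothCurve f ∧
      ∀ x y, eval (linePoint b x y) f = linearProduct ℓ t (fun _ => 1) x y := by
  set d := weight ℓ with hd
  -- in degree zero there are no points, and the form is constant
  rcases Nat.eq_zero_or_pos d with hd0 | hdpos
  · have hempty : IsEmpty (RootIndex ℓ) := by
      by_contra hne
      rw [not_isEmpty_iff] at hne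
      have h1 := sum_multiplicity_eq_weight ℓ
      rw [← hd, hd0, Finset.sum_eq_zero_iff] at h1
      exact Nat.succ_ne_zero _ (h1 hne.some (Finset.mem_univ _))
    refine ⟨1, hd0 ▸ isHomogeneous_one _ _, fun p _ h => ?_, fun x y => ?_⟩
    · rw [map_one] at h
      exact absurd h one_ne_zero
    · simp [linearProduct]
  have hne : Nonempty (RootIndex ℓ) := by
    by_contra hempty
    rw [not_nonempty_iff] at hempty
    have h1 := sum_multiplicity_eq_weight ℓ
    rw [Finset.univ_eq_empty, Finset.sum_empty] at h1
    omega
  set γ : Polynomial ℂ := linearProduct ℓ (fun k => Polynomial.C (t k)) (fun _ => 1) 1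
    Polynomial.X with hγdef
  have hγeval : ∀ s, γ.eval s = linearProduct ℓ t (fun _ => 1) 1 s := by
    intro s
    rw [hγdef, ← Polynomial.coe_evalRingHom, map_linearProduct]
    simp
  have hγ : Polynomial.derivative γ ≠ 0 := by
    intro h0
    obtain ⟨k⟩ := hne
    have h1 := Polynomial.eq_C_of_natDegree_eq_zero
      (Polynomial.derivative_eq_zero.1 h0)
    have h2 : γ.eval (-t k) = 0 := by
      rw [hγeval]
      exact Finset.prod_eq_zero (Finset.mem_univ k)
        (by rw [pow_eq_zero_iff (Nat.succ_ne_zero _)]; ring)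
    obtain ⟨s, hs⟩ := exists_linearProduct_ne_zero ℓ (u := t) (v := fun _ => 1)
      fun _ => Or.inr one_ne_zero
    rw [h1, Polynomial.eval_C] at h2
    rw [← hγeval, h1, h2, Polynomial.C_0, Polynomial.eval_zero] at hs
    exact hs rfl
  obtain ⟨c, hc0, hc1, hc⟩ := exists_good_multiplier hγ d
  set f : MvPolynomial (Fin 3) ℂ :=
    linearProduct ℓ (fun k => C (t k)) (fun _ => C 1) (coordinateForm b ℂ 0)
      (coordinateForm b ℂ 1) +
    (coordinateForm b ℂ 2 * coordinateForm b ℂ 0 ^ (d - 1) +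
      C c * coordinateForm b ℂ 2 ^ d) with hf
  have hfhom : f.IsHomogeneous d := by
    refine (isHomogeneous_linearProduct ℓ t _ (isHomogeneous_coordinateForm b 0)
      (isHomogeneous_coordinateForm b 1)).add (IsHomogeneous.add ?_ (IsHomogeneous.C_mul ?_ _))
    · have := (isHomogeneous_coordinateForm (R := ℂ) b 2).mul
        ((isHomogeneous_coordinateForm (R := ℂ) b 0).pow (d - 1))
      rwa [one_mul, Nat.add_sub_cancel' hdpos] at this
    · have := (isHomogeneous_coordinateForm (R := ℂ) b 2).pow d
      rwa [one_mul] at this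
  have hcoord : ∀ (j : Fin 3) (x : Fin 3 → ℂ), eval x (coordinateForm b ℂ j) = b.repr x j :=
    fun j x => eval_coordinateForm (R := ℂ) b j x
  have hfeval : ∀ x, eval x f = linearProduct ℓ t (fun _ => 1) (b.repr x 0) (b.repr x 1) +
      (b.repr x 2 * b.repr x 0 ^ (d - 1) + c * b.repr x 2 ^ d) := by
    intro x
    simp only [hf, map_add, map_mul, map_pow, map_linearProduct, eval_C, hcoord]
  refine ⟨f, hfhom, fun p hp hp0 => ?_, fun x y => ?_⟩
  · by_contra! hall
    have hder : ∀ q, (restrictTo f p q).derivative.eval 0 = 0 := by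
      intro q
      rw [eval_derivative_restrictTo]
      exact Finset.sum_eq_zero fun i _ => by rw [hall i, mul_zero]
    set x := b.repr p 0 with hx
    set y := b.repr p 1 with hy
    set w := b.repr p 2 with hw
    -- the derivative in the direction transversal to the line
    have hdw : x ^ (d - 1) + c * (d * w ^ (d - 1)) = 0 := by
      have h1 : restrictTo f p (b 2) = Polynomial.C (linearProduct ℓ t (fun _ => 1) x y) +
          ((Polynomial.C w + Polynomial.X) * Polynomial.C (x ^ (d - 1)) +
            Polynomial.C c * (Polynomial.C w + Polynomial.X) ^ d) := by
        refine Polynomial.funext fun s => ?_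
        rw [eval_restrictTo, hfeval]
        simp only [add_smul_basis_repr]
        simp [hx, hy, hw]
      have h2 := hder (b 2)
      rw [h1] at h2
      simpa [Polynomial.derivative_pow] using h2
    have hd1 : d - 1 ≠ 0 := by
      intro hd1
      rw [hd1, show d = 1 by omega] at hdw
      simp only [pow_zero, Nat.cast_one, mul_one] at hdw
      exact hc1 (by linear_combination hdw)
    by_cases hx0 : x = 0
    · rw [hx0, zero_pow hd1, zero_add] at hdw
      have hw0 : w = 0 := by
        have hdc : (d : ℂ) ≠ 0 := Nat.cast_ne_zero.2 hdpos.ne'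
        have := (mul_eq_zero.1 ((mul_eq_zero.1 hdw).resolve_left hc0)).resolve_left hdc
        exact (pow_eq_zero_iff hd1).1 this
      have hy0 : y ≠ 0 := by
        intro hy0
        refine hp (b.ext_elem fun j => ?_)
        rw [map_zero, Finsupp.coe_zero, Pi.zero_apply]
        fin_cases j
        · exact hx0
        · exact hy0
        · exact hw0
      rw [hfeval, ← hx, ← hy, ← hw, hx0, hw0, zero_mul, zero_pow hdpos.ne', mul_zero, add_zero,
        add_zero] at hp0
      refine Finset.prod_ne_zero_iff.2 (fun k _ => pow_ne_zero _ ?_) hp0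
      rwa [mul_zero, zero_add, one_mul]
    · have hpow : x ^ d = x * x ^ (d - 1) := by
        rw [← pow_succ', Nat.sub_add_cancel hdpos]
      -- the derivative along the line
      have hcrit : γ.derivative.eval (y / x) = 0 := by
        have h1 : restrictTo f p (b 1) =
            Polynomial.C (x ^ d) *
              γ.comp (Polynomial.C (y / x) + Polynomial.C (1 / x) * Polynomial.X) +
            Polynomial.C (w * x ^ (d - 1) + c * w ^ d) := by
          refine Polynomial.funext fun s => ?_
          rw [eval_restrictTo, hfeval]
          simp only [add_smul_basis_repr]
          simp only [Polynomial.eval_add, Polynomial.eval_mul, Polynomial.eval_C,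
            Polynomial.eval_comp, Polynomial.eval_X, hγeval, hd]
          rw [← linearProduct_mul]
          have e1 : x * (y / x + 1 / x * s) = y + s := by field_simp
          rw [e1]
          simp [hx, hy, hw]
        have h2 := hder (b 1)
        rw [h1, Polynomial.derivative_add, Polynomial.derivative_C, add_zero,
          Polynomial.derivative_C_mul, Polynomial.eval_C_mul, Polynomial.derivative_comp] at h2
        simpa [hx0] using (mul_eq_zero.1 h2).resolve_left (pow_ne_zero _ hx0)
      refine hc _ hcrit ?_
      have hdC : (d : ℂ) - 1 ≠ 0 := by
        intro h
        have h1 : (d : ℂ) = (1 : ℕ) := by rw [Nat.cast_one]; linear_combination h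
        have := Nat.cast_injective h1
        omega
      have hw' : w / x = -(γ.eval (y / x) * d / (d - 1)) := by
        have h1 : linearProduct ℓ t (fun _ => 1) x y = x ^ d * γ.eval (y / x) := by
          rw [hγeval, hd, ← linearProduct_mul, mul_one, mul_div_cancel₀ _ hx0]
        rw [hfeval, ← hx, ← hy, ← hw, h1] at hp0
        have hwd : w ^ d = w * w ^ (d - 1) := by
          rw [← pow_succ', Nat.sub_add_cancel hdpos]
        rw [hwd, hpow] at hp0
        have hxp : x ^ (d - 1) ≠ 0 := pow_ne_zero _ hx0
        have h2 : x ^ (d - 1) * (x * γ.eval (y / x) * d + w * (d - 1)) = 0 := by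
          linear_combination d * hp0 - w * hdw
        have h3 := (mul_eq_zero.1 h2).resolve_left hxp
        rw [div_eq_iff hx0, neg_mul, div_mul_eq_mul_div, eq_neg_iff_add_eq_zero,
          ← sub_neg_eq_add, sub_eq_zero, eq_neg_iff_add_eq_zero]
        field_simp
        linear_combination h3
      rw [← hw', div_pow]
      field_simp
      linear_combination hdw
  · rw [hfeval, repr_linePoint_zero, repr_linePoint_one, repr_linePoint_two, zero_mul,
      zero_pow hdpos.ne', mul_zero, add_zero, add_zero]

theorem smoothLocus_nonempty {L : Submodule ℂ (Fin 3 → ℂ)} (hb : ∀ x, x ∈ L ↔ b.repr x 2 = 0) :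
    (smoothLocus (weight ℓ) L ℓ).Nonempty := by
  -- the points of the divisor
  obtain ⟨t, ht⟩ : ∃ t : RootIndex ℓ → ℂ, Function.Injective t :=
    ⟨fun k => (Fintype.equivFin _ k : ℕ), fun k l h =>
      (Fintype.equivFin _).injective (Fin.ext (Nat.cast_injective h))⟩
  obtain ⟨f, hf, hsm, hline⟩ := exists_isSmoothCurve_eval_linePoint ℓ b (t := t)
  have hform := form_coeff hf
  set a : Exponent (weight ℓ) → ℂ := fun m => f.coeff (m : Fin 3 →₀ ℕ) with ha
  have ha0 : a ≠ 0 := by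
    intro h0
    obtain ⟨s, hs⟩ := exists_linearProduct_ne_zero ℓ (u := t) (v := fun _ => 1)
      fun _ => Or.inr one_ne_zero
    rw [← hline, ← hform, h0, ← formLinear_apply, map_zero, map_zero] at hs
    exact hs rfl
  obtain ⟨e, he, hrep⟩ := exists_rep_mk_eq_smul ha0
  have heq : CurveSpace.equation (Projectivization.mk ℂ a ha0) = e • f := by
    rw [CurveSpace.equation, hrep, ← formLinear_apply, map_smul, formLinear_apply, hform]
  refine ⟨Projectivization.mk ℂ a ha0, ?_, ?_⟩
  · rw [heq]
    exact hsm.smul he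
  · refine (exists_divisor_iff_exists_linearProduct b ℓ hb (isHomogeneous_form _)).2
      ⟨t, fun _ => 1, e, fun _ => Or.inr one_ne_zero, fun k l hkl h => hkl (ht ?_), he,
        fun x y => ?_⟩
    · linear_combination h
    · change eval _ (CurveSpace.equation _) = _
      rw [heq, smul_eval, hline]

end Existence

/-! ### The degree -/

section Degree

variable {n : ℕ} (ℓ : Fin n → ℕ)

theorem sum_antidiagonal_le_of_shift {q a w : ℕ → ℕ} {c : ℕ} (h : ∀ s, q s ≤ a (s + c)) (t : ℕ) :
    ∑ x ∈ Finset.HasAntidiagonal.antidiagonal t, q x.1 * w x.2 ≤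
      ∑ x ∈ Finset.HasAntidiagonal.antidiagonal (t + c), a x.1 * w x.2 := by
  refine (Finset.sum_le_sum fun x _ => Nat.mul_le_mul_right _ (h x.1)).trans ?_
  rw [← Finset.sum_image (s := Finset.HasAntidiagonal.antidiagonal t)
    (g := fun x : ℕ × ℕ => (x.1 + c, x.2)) (f := fun x : ℕ × ℕ => a x.1 * w x.2)]
  · refine Finset.sum_le_sum_of_subset fun x hx => ?_
    obtain ⟨y, hy, rfl⟩ := Finset.mem_image.1 hx
    rw [Finset.HasAntidiagonal.mem_antidiagonal] at hy ⊢
    simp only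
    omega
  · rintro ⟨x₁, x₂⟩ _ ⟨y₁, y₂⟩ _ h
    simpa using h

instance (s : ℕ) : FiniteDimensional ℂ ↥(productSpan ℓ ^ s) :=
  Submodule.finiteDimensional_of_le (productSpan_pow_le ℓ s)

theorem hilbertFunction_closure_smoothLocus (b : Module.Basis (Fin 3) ℂ (Fin 3 → ℂ))
    {L : Submodule ℂ (Fin 3 → ℂ)} (hb : ∀ x, x ∈ L ↔ b.repr x 2 = 0) (t : ℕ) :
    hilbertFunction (zariskiClosure (smoothLocus (weight ℓ) L ℓ)) t =
      ∑ x ∈ Finset.HasAntidiagonal.antidiagonal t, Module.finrank ℂ ↥(productSpan ℓ ^ x.1) *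
        Nat.multichoose (Fintype.card (ResidualIndex (weight ℓ))) x.2 := by
  rw [hilbertFunction_zariskiClosure, hilbertFunction_eq_finrank_span_pow _
    (genericParametrization b ℓ) t fun F hF =>
      forall_eval_eq_zero_iff b ℓ hb (smoothLocus_nonempty ℓ b hb) hF,
    span_range_genericParametrization, conePart_one_pow, finrank_conePart]

/-- The Hilbert function is at most that of a cone over a Segre–Veronese variety, and by
birationality at least a shift of it; this determines the degree of the Hilbert polynomial and its
leading coefficient. -/
theorem hasDegree_closure_smoothLocus (b : Module.Basis (Fin 3) ℂ (Fin 3 → ℂ))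
    {L : Submodule ℂ (Fin 3 → ℂ)} (hb : ∀ x, x ∈ L ↔ b.repr x 2 = 0) :
    HasDegree (zariskiClosure (smoothLocus (weight ℓ) L ℓ)) (nNumber ℓ * mNumber ℓ) := by
  set k := Fintype.card (ResidualIndex (weight ℓ)) with hk
  set H : ℕ → ℕ := hilbertFunction (zariskiClosure (smoothLocus (weight ℓ) L ℓ)) with hH
  have hHsum : ∀ t, H t = ∑ x ∈ Finset.HasAntidiagonal.antidiagonal t,
      Module.finrank ℂ ↥(productSpan ℓ ^ x.1) * Nat.multichoose k x.2 :=
    hilbertFunction_closure_smoothLocus ℓ b hb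
  obtain ⟨P, hP⟩ := exists_isHilbertPolynomial (zariskiClosure (smoothLocus (weight ℓ) L ℓ))
  obtain ⟨Q₀, hQ₀, hQ₀eval, hQ₀lead⟩ := exists_polynomial_prod_multichoose ℓ
  obtain ⟨Q, -, hQeval, hQlead⟩ := exists_polynomial_sum_multichoose hQ₀ hQ₀eval k
  have hq : ∀ s : ℕ, ∏ i, Nat.multichoose (ℓ i + 1) (s * ((i : ℕ) + 1)) =
      Module.finrank ℂ (multiForms (Sigma.fst : FactorIndex ℓ → Fin n) (s • multVector n)) := by
    intro s
    rw [finrank_multiForms]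
    rfl
  simp only [hq] at hQeval
  obtain ⟨c, hc⟩ := exists_finrank_multiForms_le ℓ
  have hle : ∀ t : ℕ, (H t : ℚ) ≤ Q.eval (t : ℚ) := by
    intro t
    rw [← hQeval, hHsum]
    refine Nat.cast_le.2 ?_
    exact Finset.sum_le_sum fun x _ => Nat.mul_le_mul_right _
      (Submodule.finrank_mono (productSpan_pow_le ℓ x.1))
  have hge : ∀ t : ℕ, Q.eval (t : ℚ) ≤ (H (t + c) : ℚ) := by
    intro t
    rw [← hQeval, hHsum]
    exact Nat.cast_le.2 (sum_antidiagonal_le_of_shift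
      (q := fun s => Module.finrank ℂ
        (multiForms (Sigma.fst : FactorIndex ℓ → Fin n) (s • multVector n)))
      (a := fun s => Module.finrank ℂ ↥(productSpan ℓ ^ s)) (w := Nat.multichoose k) hc t)
  obtain ⟨hdeg, hlead⟩ := natDegree_leadingCoeff_eq_of_squeeze (P := P) (Q := Q) c
    (hP.mono fun t ht => by rw [← ht]; exact hle t)
    (((tendsto_add_atTop_nat c).eventually hP).mono fun t ht => by rw [← ht]; exact hge t)
  refine ⟨P, hP, ?_⟩
  rw [hdeg, hlead]
  exact hQlead.trans hQ₀lead

theorem isZariskiLocallyClosed_smoothLocus (b : Module.Basis (Fin 3) ℂ (Fin 3 → ℂ))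
    {L : Submodule ℂ (Fin 3 → ℂ)} (hb : ∀ x, x ∈ L ↔ b.repr x 2 = 0) :
    IsZariskiLocallyClosed (smoothLocus (weight ℓ) L ℓ) := by
  rw [smoothLocus_eq_inter b ℓ hb]
  let _ := zariskiTopology (Exponent (weight ℓ))
  exact (isOpen_genericLocus b ℓ _).isLocallyClosed.inter
    (isClosed_degenerateLocus b ℓ).isLocallyClosed

end Degree

end TangencyLocus

end

theorem corollary2p3 (L : Submodule ℂ (Fin 3 → ℂ)) (hL : Module.finrank ℂ L = 2)
    {n : ℕ} (ℓ : Fin n → ℕ) (d : ℕ) (hd : d = TangencyLocus.weight ℓ) :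
    TangencyLocus.IsZariskiLocallyClosed (TangencyLocus.smoothLocus d L ℓ) ∧
      TangencyLocus.HasDegree
        (TangencyLocus.zariskiClosure (TangencyLocus.smoothLocus d L ℓ))
        (TangencyLocus.nNumber ℓ * TangencyLocus.mNumber ℓ) := by
  subst hd
  obtain ⟨b, hb⟩ := TangencyLocus.exists_basis_mem_iff hL
  exact ⟨TangencyLocus.isZariskiLocallyClosed_smoothLocus ℓ b hb,
    TangencyLocus.hasDegree_closure_smoothLocus ℓ b hb⟩
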